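/- **Setting.** Here $[\,\cdot\,]$ denotes closed linear span. *Partial automorphisms.* Let $B$ be a $C^*$-algebra. A partial automorphism of $B$ is a $*$-isomorphism $\theta\colon \mathrm{Dom}(\theta)\to \mathrm{Img}(\theta)$ between closed two-sided ideals of $B$. The set $\mathrm{PAut}(B)$ of all of them is an inverse semigroup under composition (where defined), with $\theta^*=\theta^{-1}$. It is ordered by extension: $\theta'\le\theta$ iff $\theta$ extends $\theta'$. The meet is denoted $\theta\wedge\theta'$. *Bimodules.* A right $C^*$-$B$-$B$-bimodule is a full right Hilbert $C^*$-module $E$ over $B$ with a nondegenerate $*$-homomorphism from $B$ to the adjointable operators on $E$, written $(b,\xi)\mapsto b\xi$. For $B=E$ we use $\langle b|c\rangle=b^*c$ and left multiplication. For $\theta\in \mathrm{PAut}(B)$ put $$E_\theta=\{\xi\in E\,\mathrm{Dom}(\theta) : \xi b=\theta(b)\xi \text{ for all } b\in \mathrm{Dom}(\theta)\}.$$ For $\Theta\subseteq\mathrm{PAut}(B)$, $E$ is $\Theta$-decomposable if $[\bigcup_{\theta\in\Theta}E_\theta]=E$. $B$ is decomposable if it is $\mathrm{PAut}(B)$-decomposable,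 and it is $\Theta$-supported if $B_\theta=[\bigcup_{\theta'\in\Theta,\ \theta'\le\theta}B_{\theta'}]$ for all $\theta\in\mathrm{PAut}(B)$. An inverse semigroup $\Theta\subseteq \mathrm{PAut}(B)$ is admissible if $B$ is $\Theta$-supported, $\mathrm{id}_B\in\Theta$, and $\theta\wedge\theta'\in\Theta$ for all $\theta,\theta'\in\Theta$. *Homogeneous operators.* Let $E,F$ be right $C^*$-$B$-$B$-bimodules and $\rho,\sigma\in \mathrm{PAut}(B)$. An operator $T\colon E\to F$ is $(\rho,\sigma)$-homogeneous if the following hold: * $TE\subseteq[\mathrm{Img}(\rho)F]$; * $Ta\xi=\rho(a)T\xi$ for all $a\in\mathrm{Dom}(\rho)$ and $\xi\in E$; * there is an operator $S=T^*\colon F\to E$ such that, for all $\xi,\eta$, $\langle S\eta|\xi\rangle\in\mathrm{Dom}(\sigma)$ and $\langle\eta|T\xi\rangle=\sigma(\langle S\eta|\xi\rangle)$. We consider families $\mathcal C=(\mathcal C^\rho_\sigma)_{\rho,\sigma\in\mathrm{PAut}(B)}$ of sets of operators. The adjoint family is given by $(\mathcal C^*)^\rho_\sigma=(\mathcal C^{\rho^*}_{\sigma^*})^*$.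 The component $[\mathcal D\mathcal C]^{\rho''}_{\sigma''}$ of a product is the closed linear span of all $T'T$ with $T'\in\mathcal D^{\rho'}_{\sigma'}$, $T\in\mathcal C^\rho_\sigma$, $\rho'\rho\le\rho''$ and $\sigma'\sigma\le\sigma''$. For $\xi\in E$ define $|\xi\rangle,|\xi]\colon B\to E$ by $|\xi\rangle b=\xi b$ and $|\xi]b=b\xi$. For $b\in B$ define $l_b,r_b\colon E\to E$ by $l_b\xi=b\xi$ and $r_b\xi=\xi b$. Let $|E\rangle$ be the family with $|E\rangle^\theta_{\mathrm{id}}=\{|\xi\rangle:\xi\in E_\theta\}$, and let $|E]$ be the family with $|E]^{\mathrm{id}}_{\theta}=\{|\xi]:\xi\in E_{\theta^*}\}$, for all $\theta\in\mathrm{PAut}(B)$; all other components are $0$. A right $C^*$-$B$-$B$-bimodule $E$ is $\Theta$-admissible if it is $\Theta$-decomposable, $[|E\rangle^*|E\rangle]=|B\rangle$ and $[|E]^*|E]]=|B]$. *Representations.* A covariant representation of $(B,\Theta)$ on a Hilbert space $\mathfrak K$ consists of a $*$-representation $\pi\colon B\to\mathcal L(\mathfrak K)$ and a $*$-homomorphism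 $\upsilon\colon\Theta\to\mathcal L(\mathfrak K)$ (that is, $\upsilon(\theta\theta')=\upsilon(\theta)\upsilon(\theta')$ and $\upsilon(\theta^*)=\upsilon(\theta)^*$) such that $\upsilon(\theta)\mathfrak K=[\pi(\mathrm{Img}(\theta))\mathfrak K]$ and $\upsilon(\theta)\pi(b)\upsilon(\theta)^*=\pi(\theta(b))$ for all $\theta\in\Theta$ and $b\in \mathrm{Dom}(\theta)$. Given such a representation, let $F(E)=E\otimes_\pi\mathfrak K$, and for a $(\rho,\sigma)$-homogeneous operator $T$ with $\rho,\sigma\in\Theta$ let $F(T)=T\otimes\upsilon(\sigma)$, that is, $F(T)(\xi\otimes\zeta)=T\xi\otimes\upsilon(\sigma)\zeta$. For a family $\mathcal C$ let $F_*(\mathcal C)=[F(c): c\in\mathcal C^\rho_\sigma,\ \rho,\sigma\in\Theta]$. *$C^*$-bases.* A $C^*$-base $(\mathfrak H,\mathfrak B,\mathfrak B^\dagger)$ is a Hilbert space $\mathfrak H$ with two commuting nondegenerate $C^*$-algebras $\mathfrak B,\mathfrak B^\dagger\subseteq\mathcal L(\mathfrak H)$. A $C^*$-factorization of a Hilbert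 space $H$ with respect to it is a closed subspace $\alpha\subseteq\mathcal L(\mathfrak H,H)$ with $[\alpha^*\alpha]=\mathfrak B$, $[\alpha\mathfrak B]=\alpha$ and $[\alpha\mathfrak H]=H$. The associated representation $\rho_\alpha\colon\mathfrak B^\dagger\to\mathcal L(H)$ is determined by $\rho_\alpha(b)\xi\zeta=\xi b\zeta$ for $b\in\mathfrak B^\dagger$, $\xi\in\alpha$ and $\zeta\in\mathfrak H$. A $C^*$-factorization $\alpha$ with respect to $(\mathfrak H,\mathfrak B,\mathfrak B^\dagger)$ and a $C^*$-factorization $\beta$ of the same $H$ with respect to $(\mathfrak K',\mathfrak C,\mathfrak C^\dagger)$ are compatible if $[\rho_\alpha(\mathfrak B^\dagger)\beta]=\beta$ and $[\rho_\beta(\mathfrak C^\dagger)\alpha]=\alpha$. **Theorem.** Let $B$ be a decomposable $C^*$-algebra, $\Theta\subseteq\mathrm{PAut}(B)$ an admissible inverse semigroup, and $(\pi,\upsilon)$ a covariant representation of $(B,\Theta)$ on a Hilbert space $\mathfrak K$ with $\pi$ faithful. Put $$\mathfrak H=F(B)=B\otimes_\pi\mathfrak K,\qquad \mathfrak B=F_*(|B\rangle),\qquad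 \mathfrak B^\dagger=F_*(|B]).$$ 1. $(\mathfrak H,\mathfrak B,\mathfrak B^\dagger)$ is a $C^*$-base: $\mathfrak B$ and $\mathfrak B^\dagger$ are commuting nondegenerate $C^*$-algebras on $\mathfrak H$. 2. For every $\Theta$-admissible right $C^*$-$B$-$B$-bimodule $E$, the spaces $$\alpha(E)=F_*(|E\rangle)\quad\text{and}\quad\beta(E)=F_*(|E])\qquad\text{in } \mathcal L(\mathfrak H,F(E))$$ are compatible $C^*$-factorizations of $F(E)$, with respect to $(\mathfrak H,\mathfrak B,\mathfrak B^\dagger)$ and $(\mathfrak H,\mathfrak B^\dagger,\mathfrak B)$, respectively. The representations $\rho_{\beta(E)}\colon\mathfrak B\to\mathcal L(F(E))$ and $\rho_{\alpha(E)}\colon\mathfrak B^\dagger\to\mathcal L(F(E))$ are given by $$\rho_{\beta(E)}(F(|b\rangle))=F(l_b),\qquad \rho_{\alpha(E)}(F(|b]))=F(r_b)\qquad\text{for all } b\in B_\theta,\ \theta\in\Theta.$$ Here, for $\theta\in\Theta$, the operators $|b\rangle$, $l_b$ with $b\in B_\theta$ and $|\xi\rangle$ with $\xi\in E_\theta$ are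 $(\theta,\mathrm{id})$-homogeneous, and the operators $|b]$, $r_b$ with $b\in B_\theta$ and $|\xi]$ with $\xi\in E_\theta$ are $(\mathrm{id},\theta^*)$-homogeneous, so that $F$ applies to them with $\sigma=\mathrm{id}$ and $\sigma=\theta^*$, respectively. -/

import Mathlib

open scoped TensorProduct InnerProductSpace RightActions
open MulOpposite ContinuousLinearMap

set_option linter.unusedSectionVars false

noncomputable section

namespace HomMod

/-- The closed linear span of a subset of a complex normed space. -/
def clspan {V : Type*} [SeminormedAddCommGroup V] [NormedSpace ℂ V] (S : Set V) :
    Submodule ℂ V :=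
  (Submodule.span ℂ S).topologicalClosure

/-! ### Right Hilbert modules

A right Hilbert module over `B` is a `CStarModule` over `Bᵐᵒᵖ`: with `E` written as a right
module, `op b • ξ` (also written `ξ <• b`) is `ξ b`, and the `B`-valued inner product, linear in
the second variable and with `⟨ξ | η b⟩ = ⟨ξ | η⟩ b`, is `ip`. -/

section Modules

variable {B : Type*} [NonUnitalCStarAlgebra B] [PartialOrder B] [StarOrderedRing B]
variable {E : Type*} [NormedAddCommGroup E] [NormedSpace ℂ E] [SMul Bᵐᵒᵖ E] [CStarModule Bᵐᵒᵖ E]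

variable (B) in
/-- The `B`-valued inner product `⟨ξ | η⟩` of a right Hilbert `B`-module. -/
def ip (ξ η : E) : B := unop (inner Bᵐᵒᵖ ξ η)

lemma ip_add_right (ξ η η' : E) : ip B ξ (η + η') = ip B ξ η + ip B ξ η' := by
  simp [ip]

lemma ip_add_left (ξ ξ' η : E) : ip B (ξ + ξ') η = ip B ξ η + ip B ξ' η := by
  simp [ip]

lemma ip_smul_right (c : ℂ) (ξ η : E) : ip B ξ (c • η) = c • ip B ξ η := by
  simp [ip]

lemma ip_smul_left (c : ℂ) (ξ η : E) : ip B (c • ξ) η = star c • ip B ξ η := by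
  simp [ip]

lemma ip_rsmul_right (b : B) (ξ η : E) : ip B ξ (η <• b) = ip B ξ η * b := by
  simp [ip]

lemma ip_rsmul_left (b : B) (ξ η : E) : ip B (ξ <• b) η = star b * ip B ξ η := by
  simp [ip]

lemma star_ip (ξ η : E) : star (ip B ξ η) = ip B η ξ := by
  rw [ip, ← unop_star, CStarModule.star_inner]; rfl

lemma norm_ip_le (ξ η : E) : ‖ip B ξ η‖ ≤ ‖ξ‖ * ‖η‖ :=
  CStarModule.norm_inner_le (A := Bᵐᵒᵖ) E

lemma norm_sq_eq_ip (ξ : E) : ‖ξ‖ ^ 2 = ‖ip B ξ ξ‖ :=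
  CStarModule.norm_sq_eq Bᵐᵒᵖ

lemma ip_self_eq_star_mul_self (ξ : E) : ∃ c : B, ip B ξ ξ = star c * c := by
  have h : (0 : B) ≤ ip B ξ ξ := CStarModule.inner_self_nonneg (A := Bᵐᵒᵖ) (x := ξ)
  exact CStarAlgebra.nonneg_iff_eq_star_mul_self.mp h

lemma ext_ip {ξ η : E} (h : ∀ ζ, ip B ζ ξ = ip B ζ η) : ξ = η := by
  have h0 : ip B (ξ - η) (ξ - η) = 0 := by
    have h1 : ip B (ξ - η) (ξ - η) = ip B (ξ - η) ξ - ip B (ξ - η) η := by simp [ip]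
    rw [h1, h, sub_self]
  have h2 := norm_sq_eq_ip (B := B) (ξ - η)
  rw [h0, norm_zero] at h2
  exact sub_eq_zero.mp (norm_eq_zero.mp (pow_eq_zero_iff (two_ne_zero) |>.mp h2))

lemma norm_rsmul_le (b : B) (ξ : E) : ‖ξ <• b‖ ≤ ‖ξ‖ * ‖b‖ := by
  have h : ‖ξ <• b‖ ^ 2 ≤ (‖ξ‖ * ‖b‖) ^ 2 := by
    rw [norm_sq_eq_ip (B := B), ip_rsmul_left, ip_rsmul_right]
    calc ‖star b * (ip B ξ ξ * b)‖ ≤ ‖star b‖ * (‖ip B ξ ξ‖ * ‖b‖) :=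
          (norm_mul_le _ _).trans (by gcongr; exact norm_mul_le _ _)
      _ = (‖ξ‖ * ‖b‖) ^ 2 := by rw [norm_star, ← norm_sq_eq_ip]; ring
  exact abs_le_of_sq_le_sq' h (by positivity) |>.2

variable (B E) in
/-- The right multiplication `(ξ, b) ↦ ξ b` of a right Hilbert module as a bounded bilinear map. -/
def rmul : E →L[ℂ] B →L[ℂ] E :=
  LinearMap.mkContinuous₂
    (LinearMap.mk₂ ℂ (fun (ξ : E) (b : B) => ξ <• b)
      (fun ξ ξ' b => ext_ip (B := B) fun ζ => by
        simp only [ip_rsmul_right, ip_add_right, add_mul])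
      (fun c ξ b => ext_ip (B := B) fun ζ => by
        simp only [ip_rsmul_right, ip_smul_right, smul_mul_assoc])
      (fun ξ b b' => ext_ip (B := B) fun ζ => by
        simp only [ip_rsmul_right, ip_add_right, mul_add])
      (fun c ξ b => ext_ip (B := B) fun ζ => by
        simp only [ip_rsmul_right, ip_smul_right, mul_smul_comm]))
    1 (fun ξ b => by simpa using norm_rsmul_le b ξ)

@[simp] lemma rmul_apply (ξ : E) (b : B) : rmul B E ξ b = ξ <• b := rfl

/-- `B` as a right Hilbert module over itself, with `⟨b | c⟩ = b* c`. -/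
instance selfModule : CStarModule Bᵐᵒᵖ B where
  inner b c := op (star b * c)
  inner_add_right := by intros; rw [mul_add, op_add]
  inner_self_nonneg {b} := show (0 : B) ≤ star b * b from star_mul_self_nonneg b
  inner_self {b} := by rw [op_eq_zero_iff]; exact CStarRing.star_mul_self_eq_zero_iff b
  inner_op_smul_right {a x y} := by
    rw [← op_unop a, ← op_mul, op_smul_eq_mul, mul_assoc]
  inner_smul_right_complex := by intros; rw [mul_smul_comm, op_smul]
  star_inner x y := by rw [← op_star]; simp
  norm_eq_sqrt_norm_inner_self b := by
    rw [norm_op, CStarRing.norm_star_mul_self, Real.sqrt_mul_self (norm_nonneg b)]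

@[simp] lemma ip_self (b c : B) : ip B b c = star b * c := rfl

variable (B E) in
/-- A left action of `B` on a right Hilbert `B`-module by adjointable operators, that is, a
`*`-homomorphism from `B` to the adjointable operators of `E` (such a `*`-homomorphism is
automatically bounded). -/
class LeftAction where
  /-- left multiplication `lact b ξ = b ξ` -/
  lact : B →L[ℂ] E →L[ℂ] E
  lact_mul : ∀ (b c : B) (ξ : E), lact (b * c) ξ = lact b (lact c ξ)
  ip_lact : ∀ (b : B) (ξ η : E), ip B (lact b ξ) η = ip B ξ (lact (star b) η)

/-- `B` acts on itself by left multiplication. -/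
instance selfAction : LeftAction B B where
  lact := ContinuousLinearMap.mul ℂ B
  lact_mul b c d := mul_assoc b c d
  ip_lact b c d := by simp [mul_assoc]

variable (B E) in
/-- The conditions for a complete right Hilbert `B`-module with a left action of `B` to be a right
`C*`-`B`-`B`-bimodule: it is full and the left action is nondegenerate. -/
structure IsRightBimodule [LeftAction B E] : Prop where
  complete : CompleteSpace E
  full : clspan {b : B | ∃ ξ η : E, b = ip B ξ η} = ⊤
  nondegenerate : clspan {ξ : E | ∃ (b : B) (η : E), ξ = LeftAction.lact b η} = ⊤

end Modules

/-! ### The internal tensor product of a right Hilbert module and a represented Hilbert space -/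

section Tensor

variable {B : Type*} [NonUnitalCStarAlgebra B] [PartialOrder B] [StarOrderedRing B]
variable {K : Type*} [NormedAddCommGroup K] [InnerProductSpace ℂ K] [CompleteSpace K]
variable {E : Type*} [NormedAddCommGroup E] [NormedSpace ℂ E] [SMul Bᵐᵒᵖ E] [CStarModule Bᵐᵒᵖ E]
variable {F : Type*} [NormedAddCommGroup F] [NormedSpace ℂ F] [SMul Bᵐᵒᵖ F] [CStarModule Bᵐᵒᵖ F]

/-- The algebraic tensor product of `E` and `K`, carrying the semi-inner product
`⟨ξ ⊗ ζ | ξ' ⊗ ζ'⟩ = ⟨ζ | π ⟨ξ | ξ'⟩ ζ'⟩`. -/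
def AlgTensor (_π : B →⋆ₙₐ[ℂ] (K →L[ℂ] K)) (E : Type*) [NormedAddCommGroup E] [NormedSpace ℂ E] :
    Type _ := E ⊗[ℂ] K

instance (π : B →⋆ₙₐ[ℂ] (K →L[ℂ] K)) : AddCommGroup (AlgTensor π E) :=
  inferInstanceAs (AddCommGroup (E ⊗[ℂ] K))

instance (π : B →⋆ₙₐ[ℂ] (K →L[ℂ] K)) : Module ℂ (AlgTensor π E) :=
  inferInstanceAs (Module ℂ (E ⊗[ℂ] K))

variable (π : B →⋆ₙₐ[ℂ] (K →L[ℂ] K))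

/-- The sesquilinear form `⟨ξ ⊗ ζ | ξ' ⊗ ζ'⟩ = ⟨ζ | π ⟨ξ | ξ'⟩ ζ'⟩`. -/
def tensorForm : E ⊗[ℂ] K →ₗ⋆[ℂ] E ⊗[ℂ] K →ₗ[ℂ] ℂ :=
  TensorProduct.lift
    (LinearMap.mk₂'ₛₗ (starRingEnd ℂ) (starRingEnd ℂ)
      (fun (ξ : E) (ζ : K) => TensorProduct.lift
        (LinearMap.mk₂ ℂ (fun (ξ' : E) (ζ' : K) => inner ℂ ζ (π (ip B ξ ξ') ζ'))
          (fun ξ₁ ξ₂ ζ' => by simp [ip_add_right])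
          (fun c ξ₁ ζ' => by simp [ip_smul_right])
          (fun ξ₁ ζ₁ ζ₂ => by simp)
          (fun c ξ₁ ζ' => by simp)))
      (fun ξ₁ ξ₂ ζ => by
        ext; simp [ip_add_left])
      (fun c ξ ζ => by
        ext; simp [ip_smul_left])
      (fun ξ ζ₁ ζ₂ => by
        ext; simp)
      (fun c ξ ζ => by
        ext; simp [mul_comm]))

@[simp] lemma tensorForm_tmul (ξ ξ' : E) (ζ ζ' : K) :
    tensorForm π (ξ ⊗ₜ ζ) (ξ' ⊗ₜ ζ') = inner ℂ ζ (π (ip B ξ ξ') ζ') := rfl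

lemma tensorForm_symm (x y : E ⊗[ℂ] K) :
    (starRingEnd ℂ) (tensorForm π y x) = tensorForm π x y := by
  induction x using TensorProduct.induction_on with
  | zero => simp
  | add x₁ x₂ h₁ h₂ => simp [h₁, h₂]
  | tmul ξ ζ =>
    induction y using TensorProduct.induction_on with
    | zero => simp
    | add y₁ y₂ h₁ h₂ => simp [h₁, h₂]
    | tmul ξ' ζ' =>
      rw [tensorForm_tmul, tensorForm_tmul, inner_conj_symm, ← star_ip, map_star,
        ContinuousLinearMap.star_eq_adjoint, ContinuousLinearMap.adjoint_inner_left]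

end Tensor

section
variable {B : Type*} [NonUnitalCStarAlgebra B] [PartialOrder B] [StarOrderedRing B]
variable {K : Type*} [NormedAddCommGroup K] [InnerProductSpace ℂ K] [CompleteSpace K]
variable {E : Type*} [NormedAddCommGroup E] [NormedSpace ℂ E] [SMul Bᵐᵒᵖ E] [CStarModule Bᵐᵒᵖ E]
variable (π : B →⋆ₙₐ[ℂ] (K →L[ℂ] K))

lemma ip_sum_left {ι : Type*} (s : Finset ι) (ξ : ι → E) (η : E) :
    ip B (∑ i ∈ s, ξ i) η = ∑ i ∈ s, ip B (ξ i) η := by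
  simp [ip, CStarModule.inner_sum_left]

lemma ip_sum_right {ι : Type*} (s : Finset ι) (ξ : ι → E) (η : E) :
    ip B η (∑ i ∈ s, ξ i) = ∑ i ∈ s, ip B η (ξ i) := by
  simp [ip, CStarModule.inner_sum_right]

lemma gram_cyclic {ι : Type*} [Fintype ι] (ξ : ι → E) (b : ι → B) (ω : K) :
    0 ≤ (∑ i, ∑ j, inner ℂ (π (b i) ω) (π (ip B (ξ i) (ξ j)) (π (b j) ω))).re := by
  obtain ⟨c, hc⟩ := ip_self_eq_star_mul_self (B := B) (∑ i, ξ i <• b i)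
  have key : ∑ i, ∑ j, inner ℂ (π (b i) ω) (π (ip B (ξ i) (ξ j)) (π (b j) ω))
      = inner ℂ (π c ω) (π c ω) := by
    have h : inner ℂ (π c ω) (π c ω) = inner ℂ ω (π (star c * c) ω) := by
      rw [map_mul, map_star, ContinuousLinearMap.star_eq_adjoint, mul_apply_eq_comp,
        ContinuousLinearMap.adjoint_inner_right]
    rw [h, ← hc]
    simp only [ip_sum_left, ip_sum_right, Finset.sum_mul, ip_rsmul_left, ip_rsmul_right, map_sum,
      _root_.sum_apply, inner_sum]
    rw [Finset.sum_comm]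
    refine Finset.sum_congr rfl fun i _ => Finset.sum_congr rfl fun j _ => ?_
    rw [map_mul, map_mul, map_star, ContinuousLinearMap.star_eq_adjoint,
      mul_apply_eq_comp, mul_apply_eq_comp,
      ContinuousLinearMap.adjoint_inner_right]
  rw [key]
  exact inner_self_nonneg (𝕜 := ℂ)

lemma gram_cyclic' {ι : Type*} [Fintype ι] (ξ : ι → E) (ζ : ι → K) (ω : K)
    (h : ∀ i, ζ i ∈ closure (Set.range fun b : B => π b ω)) :
    0 ≤ (∑ i, ∑ j, inner ℂ (ζ i) (π (ip B (ξ i) (ξ j)) (ζ j))).re := by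
  have hcl : IsClosed {ζ : ι → K |
      0 ≤ (∑ i, ∑ j, inner ℂ (ζ i) (π (ip B (ξ i) (ξ j)) (ζ j))).re} := by
    refine isClosed_le continuous_const (Complex.continuous_re.comp ?_)
    fun_prop
  have hmem : ζ ∈ closure (Set.univ.pi fun _ : ι => Set.range fun b : B => π b ω) := by
    rw [closure_pi_set]
    exact fun i _ => h i
  refine closure_minimal ?_ hcl hmem
  intro ζ' hζ'
  choose b hb using fun i => hζ' i (Set.mem_univ i)
  have : ζ' = fun i => π (b i) ω := funext fun i => (hb i).symm
  rw [this]
  exact gram_cyclic π ξ b ω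

lemma gram_nonneg_aux {ι : Type*} [Fintype ι] [DecidableEq ι] (ξ : ι → E) (s : Finset ι) :
    ∀ ζ : ι → K, (∀ i ∉ s, ∀ b, π b (ζ i) = 0) →
    0 ≤ (∑ i, ∑ j, inner ℂ (ζ i) (π (ip B (ξ i) (ξ j)) (ζ j))).re := by
  induction s using Finset.induction_on with
  | empty => intro ζ h; simp [h]
  | insert a s ha ih =>
    intro ζ h
    let R : Submodule ℂ K :=
      { carrier := Set.range fun b : B => π b (ζ a)
        add_mem' := by
          rintro _ _ ⟨b, rfl⟩ ⟨c, rfl⟩; exact ⟨b + c, by simp⟩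
        zero_mem' := ⟨0, by simp⟩
        smul_mem' := by rintro c _ ⟨b, rfl⟩; exact ⟨c • b, by simp⟩ }
    let M : Submodule ℂ K := R.topologicalClosure
    have hMc : IsClosed (M : Set K) := Submodule.isClosed_topologicalClosure R
    have : CompleteSpace M := hMc.completeSpace_coe
    have hinv : ∀ (b : B), ∀ x ∈ M, π b x ∈ M := by
      intro b x hx
      have hmaps : Set.MapsTo (π b) (R : Set K) (R : Set K) := by
        rintro _ ⟨c, rfl⟩; exact ⟨b * c, by simp⟩
      exact hmaps.closure (π b).continuous hx
    have hinv' : ∀ (b : B), ∀ x ∈ Mᗮ, π b x ∈ Mᗮ := by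
      intro b x hx u hu
      have h1 := hx _ (hinv (star b) u hu)
      rwa [map_star, ContinuousLinearMap.star_eq_adjoint,
        ContinuousLinearMap.adjoint_inner_left] at h1
    let P : K →L[ℂ] K := M.starProjection
    have hP : ∀ x, P x ∈ M := fun x => M.starProjection_apply_mem x
    have hQ : ∀ x, x - P x ∈ Mᗮ := fun x => M.sub_starProjection_mem_orthogonal x
    have hsplit : ∀ (b : B) (x y : K), inner ℂ x (π b y)
        = inner ℂ (P x) (π b (P y)) + inner ℂ (x - P x) (π b (y - P y)) := by
      intro b x y
      have e1 : inner ℂ (P x) (π b (y - P y)) = 0 := hinv' b _ (hQ y) _ (hP x)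
      have e2 : inner ℂ (x - P x) (π b (P y)) = 0 :=
        Submodule.inner_left_of_mem_orthogonal (hinv b _ (hP y)) (hQ x)
      calc inner ℂ x (π b y)
          = inner ℂ (P x + (x - P x)) (π b (P y + (y - P y))) := by
            rw [add_sub_cancel, add_sub_cancel]
        _ = _ := by rw [map_add (π b), inner_add_left, inner_add_right, inner_add_right, e1, e2]; ring
    have hsum : ∑ i, ∑ j, inner ℂ (ζ i) (π (ip B (ξ i) (ξ j)) (ζ j))
        = ∑ i, ∑ j, inner ℂ (P (ζ i)) (π (ip B (ξ i) (ξ j)) (P (ζ j)))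
          + ∑ i, ∑ j, inner ℂ (ζ i - P (ζ i)) (π (ip B (ξ i) (ξ j)) (ζ j - P (ζ j))) := by
      simp only [← Finset.sum_add_distrib]
      exact Finset.sum_congr rfl fun i _ => Finset.sum_congr rfl fun j _ => hsplit _ _ _
    rw [hsum, Complex.add_re]
    refine add_nonneg (gram_cyclic' π ξ (fun i => P (ζ i)) (ζ a) fun i => hP (ζ i))
      (ih (fun i => ζ i - P (ζ i)) ?_)
    intro i hi b
    by_cases hia : i = a
    · subst hia
      have h1 : π b (ζ i - P (ζ i)) ∈ Mᗮ := hinv' b _ (hQ _)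
      have h2 : π b (ζ i - P (ζ i)) ∈ M := by
        rw [map_sub]
        exact M.sub_mem (R.le_topologicalClosure ⟨b, rfl⟩) (hinv b _ (hP _))
      exact inner_self_eq_zero (𝕜 := ℂ).mp (h1 _ h2)
    · have h0 : ∀ c, π c (ζ i) = 0 := h i (by simp [hia, hi])
      have h3 : P (ζ i) = 0 := by
        refine (Submodule.starProjection_apply_eq_zero_iff M).mpr ?_
        rw [Submodule.orthogonal_closure]
        rintro _ ⟨c, rfl⟩
        change inner ℂ (π c (ζ a)) (ζ i) = 0
        rw [← star_star c, map_star, ContinuousLinearMap.star_eq_adjoint,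
          ContinuousLinearMap.adjoint_inner_left, h0, inner_zero_right]
      simp [h3, h0]

lemma tensorForm_nonneg (x : E ⊗[ℂ] K) : 0 ≤ (tensorForm π x x).re := by
  classical
  obtain ⟨n, ξ, ζ, rfl⟩ : ∃ (n : ℕ) (ξ : Fin n → E) (ζ : Fin n → K), x = ∑ i, ξ i ⊗ₜ[ℂ] ζ i := by
    induction x using TensorProduct.induction_on with
    | zero => exact ⟨0, Fin.elim0, Fin.elim0, by simp⟩
    | tmul ξ ζ => exact ⟨1, fun _ => ξ, fun _ => ζ, by simp⟩
    | add x y hx hy =>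
      obtain ⟨n, ξ, ζ, rfl⟩ := hx
      obtain ⟨m, ξ', ζ', rfl⟩ := hy
      exact ⟨n + m, Fin.append ξ ξ', Fin.append ζ ζ', by simp [Fin.sum_univ_add]⟩
  simp only [map_sum, LinearMap.sum_apply, tensorForm_tmul]
  rw [Finset.sum_comm]
  exact gram_nonneg_aux π ξ Finset.univ ζ (by simp)
end

section Completion

variable {B : Type*} [NonUnitalCStarAlgebra B] [PartialOrder B] [StarOrderedRing B]
variable {K : Type*} [NormedAddCommGroup K] [InnerProductSpace ℂ K] [CompleteSpace K]
variable {E : Type*} [NormedAddCommGroup E] [NormedSpace ℂ E] [SMul Bᵐᵒᵖ E] [CStarModule Bᵐᵒᵖ E]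
variable {F : Type*} [NormedAddCommGroup F] [NormedSpace ℂ F] [SMul Bᵐᵒᵖ F] [CStarModule Bᵐᵒᵖ F]

/-- The pre-inner product structure of `AlgTensor π E`. -/
@[reducible]
def tensorCore (π : B →⋆ₙₐ[ℂ] (K →L[ℂ] K)) : PreInnerProductSpace.Core ℂ (AlgTensor π E) where
  inner x y := tensorForm π x y
  conj_inner_symm x y := tensorForm_symm π x y
  re_inner_nonneg x := tensorForm_nonneg π x
  add_left x y z := LinearMap.map_add₂ (tensorForm (E := E) π) x y z
  smul_left x y c := LinearMap.map_smulₛₗ₂ (tensorForm (E := E) π) c x y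

instance (π : B →⋆ₙₐ[ℂ] (K →L[ℂ] K)) : SeminormedAddCommGroup (AlgTensor π E) :=
  @InnerProductSpace.Core.toSeminormedAddCommGroup ℂ (AlgTensor π E) _ _ _ (tensorCore π)

instance (π : B →⋆ₙₐ[ℂ] (K →L[ℂ] K)) : InnerProductSpace ℂ (AlgTensor π E) :=
  InnerProductSpace.ofCore (tensorCore π)

/-- The internal tensor product `E ⊗_π K`: the Hilbert space obtained from the algebraic tensor
product by dividing out the null space of the semi-inner product and completing. -/
abbrev ITensor (π : B →⋆ₙₐ[ℂ] (K →L[ℂ] K)) (E : Type*) [NormedAddCommGroup E] [NormedSpace ℂ E]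
    [SMul Bᵐᵒᵖ E] [CStarModule Bᵐᵒᵖ E] : Type _ :=
  UniformSpace.Completion (AlgTensor π E)

variable (π : B →⋆ₙₐ[ℂ] (K →L[ℂ] K))

/-- The canonical map from the algebraic tensor product to `E ⊗_π K`. -/
def toITensor : E ⊗[ℂ] K →ₗ[ℂ] ITensor π E :=
  (UniformSpace.Completion.toComplL (𝕜 := ℂ) (E := AlgTensor π E)).toLinearMap

/-- The elementary tensor `ξ ⊗ ζ` in `E ⊗_π K`. -/
def tmul (ξ : E) (ζ : K) : ITensor π E := toITensor π (ξ ⊗ₜ[ℂ] ζ)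

lemma inner_toITensor (x y : E ⊗[ℂ] K) :
    inner ℂ (toITensor π x) (toITensor π y) = tensorForm π x y :=
  UniformSpace.Completion.inner_coe (𝕜 := ℂ) (E := AlgTensor π E) x y

lemma inner_tmul_tmul (ξ ξ' : E) (ζ ζ' : K) :
    inner ℂ (tmul π ξ ζ) (tmul π ξ' ζ') = inner ℂ ζ (π (ip B ξ ξ') ζ') := by
  rw [tmul, tmul, inner_toITensor, tensorForm_tmul]

lemma denseRange_toITensor : DenseRange (toITensor (E := E) π) :=
  UniformSpace.Completion.denseRange_coe (α := AlgTensor π E)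

lemma norm_tmul_le (ξ : E) (ζ : K) : ‖tmul π ξ ζ‖ ≤ ‖ξ‖ * ‖ζ‖ := by
  have h : ‖tmul π ξ ζ‖ ^ 2 ≤ (‖ξ‖ * ‖ζ‖) ^ 2 := by
    rw [← inner_self_eq_norm_sq (𝕜 := ℂ), inner_tmul_tmul]
    calc RCLike.re (inner ℂ ζ (π (ip B ξ ξ) ζ)) ≤ ‖inner ℂ ζ (π (ip B ξ ξ) ζ)‖ :=
          RCLike.re_le_norm _
      _ ≤ ‖ζ‖ * (‖π (ip B ξ ξ)‖ * ‖ζ‖) :=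
          (norm_inner_le_norm _ _).trans (by gcongr; exact (π _).le_opNorm _)
      _ ≤ ‖ζ‖ * (‖ip B ξ ξ‖ * ‖ζ‖) := by
          gcongr; exact NonUnitalStarAlgHom.norm_apply_le π _
      _ = (‖ξ‖ * ‖ζ‖) ^ 2 := by rw [← norm_sq_eq_ip]; ring
  exact abs_le_of_sq_le_sq' h (by positivity) |>.2

open Classical in
/-- The operator `T ⊗ s : E ⊗_π K → F ⊗_π K`, `ξ ⊗ ζ ↦ T ξ ⊗ s ζ`; it is unique if it exists. -/
def amp (T : E →L[ℂ] F) (s : K →L[ℂ] K) : ITensor π E →L[ℂ] ITensor π F :=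
  if h : ∃ R : ITensor π E →L[ℂ] ITensor π F, ∀ ξ ζ, R (tmul π ξ ζ) = tmul π (T ξ) (s ζ) then
    h.choose
  else 0

lemma amp_tmul_of_exists {T : E →L[ℂ] F} {s : K →L[ℂ] K}
    (h : ∃ R : ITensor π E →L[ℂ] ITensor π F, ∀ ξ ζ, R (tmul π ξ ζ) = tmul π (T ξ) (s ζ))
    (ξ : E) (ζ : K) : amp π T s (tmul π ξ ζ) = tmul π (T ξ) (s ζ) := by
  rw [amp, dif_pos h]
  exact h.choose_spec ξ ζ

lemma ext_tmul {V : Type*} [NormedAddCommGroup V] [NormedSpace ℂ V]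
    {R R' : ITensor π E →L[ℂ] V} (h : ∀ ξ ζ, R (tmul π ξ ζ) = R' (tmul π ξ ζ)) : R = R' := by
  have h1 : R.toLinearMap ∘ₗ toITensor π = R'.toLinearMap ∘ₗ toITensor π :=
    TensorProduct.ext' h
  refine ContinuousLinearMap.ext fun x => ?_
  refine congrFun ((denseRange_toITensor π).equalizer R.continuous R'.continuous ?_) x
  exact funext fun y => LinearMap.congr_fun h1 y

/-- Existence of `T ⊗ s` when there is a bounded `X` on `E` such that
`⟨T ξ ⊗ s ζ | T ξ' ⊗ s ζ'⟩ = ⟨X ξ ⊗ ζ | ξ' ⊗ ζ'⟩`. -/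
lemma exists_amp {T : E →L[ℂ] F} {s : K →L[ℂ] K} (X : E →L[ℂ] E)
    (h : ∀ ξ ξ' ζ ζ', inner ℂ (s ζ) (π (ip B (T ξ) (T ξ')) (s ζ'))
      = inner ℂ ζ (π (ip B (X ξ) ξ') ζ')) :
    ∃ R : ITensor π E →L[ℂ] ITensor π F, ∀ ξ ζ, R (tmul π ξ ζ) = tmul π (T ξ) (s ζ) := by
  let f : E ⊗[ℂ] K →ₗ[ℂ] ITensor π F :=
    toITensor π ∘ₗ TensorProduct.map T.toLinearMap s.toLinearMap
  let Y : E ⊗[ℂ] K →ₗ[ℂ] E ⊗[ℂ] K := TensorProduct.map X.toLinearMap LinearMap.id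
  have hf : ∀ x y, inner ℂ (f x) (f y) = inner ℂ (toITensor π (Y x)) (toITensor π y) := by
    intro x y
    induction x using TensorProduct.induction_on with
    | zero => simp
    | add x₁ x₂ h₁ h₂ => simp only [map_add, inner_add_left, h₁, h₂]
    | tmul ξ ζ =>
      induction y using TensorProduct.induction_on with
      | zero => simp
      | add y₁ y₂ h₁ h₂ => simp only [map_add, inner_add_right, h₁, h₂]
      | tmul ξ' ζ' =>
        change inner ℂ (tmul π (T ξ) (s ζ)) (tmul π (T ξ') (s ζ'))
          = inner ℂ (tmul π (X ξ) ζ) (tmul π ξ' ζ')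
        rw [inner_tmul_tmul, inner_tmul_tmul, h]
  have hsymm : ∀ x y, inner ℂ (toITensor π (Y x)) (toITensor π y)
      = inner ℂ (toITensor π x) (toITensor π (Y y)) := by
    intro x y
    rw [← hf, ← inner_conj_symm, hf, inner_conj_symm]
  let M : ℝ := ‖X‖ + 1
  have hM : 0 < M := by positivity
  have hgrow : ∀ x : E ⊗[ℂ] K, ∃ C : ℝ, ∀ n : ℕ, ‖toITensor π ((Y ^ n) x)‖ ≤ C * M ^ n := by
    intro x
    induction x using TensorProduct.induction_on with
    | zero => exact ⟨0, fun n => by simp⟩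
    | add x₁ x₂ h₁ h₂ =>
      obtain ⟨C₁, h₁⟩ := h₁
      obtain ⟨C₂, h₂⟩ := h₂
      refine ⟨C₁ + C₂, fun n => ?_⟩
      rw [map_add, map_add, add_mul]
      exact (norm_add_le _ _).trans (add_le_add (h₁ n) (h₂ n))
    | tmul ξ ζ =>
      have h1 : ∀ n : ℕ, (Y ^ n) (ξ ⊗ₜ ζ) = ((X ^ n) ξ) ⊗ₜ ζ := by
        intro n
        induction n with
        | zero => simp
        | succ n ih => rw [pow_succ', Module.End.mul_apply, ih, pow_succ']; rfl
      have h2 : ∀ n : ℕ, ‖(X ^ n) ξ‖ ≤ M ^ n * ‖ξ‖ := by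
        intro n
        induction n with
        | zero => simp
        | succ n ih =>
          have h3 : (X ^ (n + 1)) ξ = X ((X ^ n) ξ) := by rw [pow_succ']; rfl
          rw [h3]
          calc ‖X ((X ^ n) ξ)‖ ≤ ‖X‖ * ‖(X ^ n) ξ‖ := X.le_opNorm _
            _ ≤ M * (M ^ n * ‖ξ‖) := mul_le_mul (by simp [M]) ih (norm_nonneg _) hM.le
            _ = M ^ (n + 1) * ‖ξ‖ := by ring
      refine ⟨‖ξ‖ * ‖ζ‖, fun n => ?_⟩
      rw [h1]
      calc ‖tmul π ((X ^ n) ξ) ζ‖ ≤ ‖(X ^ n) ξ‖ * ‖ζ‖ := norm_tmul_le π _ _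
        _ ≤ M ^ n * ‖ξ‖ * ‖ζ‖ := by gcongr; exact h2 n
        _ = ‖ξ‖ * ‖ζ‖ * M ^ n := by ring
  have hstep : ∀ x : E ⊗[ℂ] K, ‖toITensor π (Y x)‖ ^ 2
      ≤ ‖toITensor π x‖ * ‖toITensor π (Y (Y x))‖ := by
    intro x
    rw [← inner_self_eq_norm_sq (𝕜 := ℂ), hsymm]
    exact (RCLike.re_le_norm _).trans (norm_inner_le_norm _ _)
  have hY : ∀ x : E ⊗[ℂ] K, ‖toITensor π (Y x)‖ ≤ M * ‖toITensor π x‖ := by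
    intro x
    by_contra! hlt
    obtain ⟨C, hC⟩ := hgrow x
    set a : ℕ → ℝ := fun n => ‖toITensor π ((Y ^ n) x)‖ with ha
    have hsucc : ∀ n, a (n + 1) ^ 2 ≤ a n * a (n + 2) := by
      intro n
      have := hstep ((Y ^ n) x)
      simpa only [ha, pow_succ', Module.End.mul_apply] using this
    have a0 : a 0 = ‖toITensor π x‖ := by simp [ha]
    have a1 : a 1 = ‖toITensor π (Y x)‖ := by simp [ha]
    rw [← a0, ← a1] at hlt
    have hnn : ∀ n, 0 ≤ a n := fun n => norm_nonneg _
    have ha0 : 0 < a 0 := by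
      rcases (hnn 0).eq_or_lt with h0 | h0
      · have h1 := hsucc 0
        rw [← h0, zero_mul] at h1
        have h2 : a 1 = 0 := by
          have := le_antisymm h1 (sq_nonneg _)
          exact pow_eq_zero_iff two_ne_zero |>.mp this
        rw [← h0, h2] at hlt
        simp at hlt
      · exact h0
    set r := a 1 / a 0 with hr
    have hrM : M < r := by rw [hr, lt_div_iff₀ ha0]; exact hlt
    have hr0 : 0 < r := hM.trans hrM
    have hratio : ∀ n, 0 < a n ∧ r * a n ≤ a (n + 1) := by
      intro n
      induction n with
      | zero => exact ⟨ha0, by rw [hr, div_mul_cancel₀ _ ha0.ne']⟩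
      | succ n ih =>
        have hpos : 0 < a (n + 1) := (mul_pos hr0 ih.1).trans_le ih.2
        refine ⟨hpos, ?_⟩
        have h1 := hsucc n
        have h2 : r * a n * a (n + 1) ≤ a (n + 1) ^ 2 := by
          rw [sq]; exact mul_le_mul_of_nonneg_right ih.2 hpos.le
        have h3 : a n * (r * a (n + 1)) ≤ a n * a (n + 2) := by nlinarith
        exact le_of_mul_le_mul_left h3 ih.1
    have hlow : ∀ n, r ^ n * a 0 ≤ a n := by
      intro n
      induction n with
      | zero => simp
      | succ n ih =>
        calc r ^ (n + 1) * a 0 = r * (r ^ n * a 0) := by ring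
          _ ≤ r * a n := by gcongr
          _ ≤ a (n + 1) := (hratio n).2
    have hbig : ∀ n : ℕ, (r / M) ^ n ≤ C / a 0 := by
      intro n
      rw [le_div_iff₀ ha0, div_pow, div_mul_eq_mul_div, div_le_iff₀ (by positivity)]
      exact (hlow n).trans (hC n)
    obtain ⟨n, hn⟩ := pow_unbounded_of_one_lt (C / a 0) ((one_lt_div hM).mpr hrM)
    exact absurd (hbig n) (not_le.mpr hn)
  have hbound : ∀ x, ‖f x‖ ≤ M * ‖toITensor π x‖ := by
    intro x
    have h1 : ‖f x‖ ^ 2 ≤ (M * ‖toITensor π x‖) ^ 2 := by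
      have hM1 : 1 ≤ M := by simp [M]
      rw [← inner_self_eq_norm_sq (𝕜 := ℂ), hf]
      calc RCLike.re (inner ℂ (toITensor π (Y x)) (toITensor π x))
          ≤ ‖toITensor π (Y x)‖ * ‖toITensor π x‖ :=
            (RCLike.re_le_norm _).trans (norm_inner_le_norm _ _)
        _ ≤ (M * ‖toITensor π x‖) * ‖toITensor π x‖ := by gcongr; exact hY x
        _ = M * ‖toITensor π x‖ ^ 2 := by ring
        _ ≤ M ^ 2 * ‖toITensor π x‖ ^ 2 := by gcongr; nlinarith
        _ = _ := by ring
    exact abs_le_of_sq_le_sq' h1 (by positivity) |>.2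
  refine ⟨f.extendOfNorm (toITensor π), fun ξ ζ => ?_⟩
  exact LinearMap.extendOfNorm_eq (denseRange_toITensor π) ⟨M, hbound⟩ (ξ ⊗ₜ ζ)

end Completion

/-! ### Partial automorphisms, homogeneous elements and operators -/

section PartialAutomorphisms

variable {B : Type*} [NonUnitalCStarAlgebra B]

/-- Closed two-sided ideals of a `C*`-algebra. -/
structure IsClosedIdeal (I : Set B) : Prop where
  isClosed : IsClosed I
  zero_mem : (0 : B) ∈ I
  add_mem : ∀ {a b : B}, a ∈ I → b ∈ I → a + b ∈ I
  smul_mem : ∀ (c : ℂ) {a : B}, a ∈ I → c • a ∈ I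
  mul_mem_left : ∀ (b : B) {a : B}, a ∈ I → b * a ∈ I
  mul_mem_right : ∀ (b : B) {a : B}, a ∈ I → a * b ∈ I

variable (B) in
/-- A partial automorphism `θ` of `B`: a `*`-isomorphism between two closed ideals of `B`. It is
given by a partial bijection of `B`; `c ∈ θ.map b` says that `b ∈ Dom θ` and `θ b = c`. -/
@[ext]
structure PAut where
  map : B ≃. B
  dom_ideal : IsClosedIdeal {b : B | ∃ c, c ∈ map b}
  img_ideal : IsClosedIdeal {c : B | ∃ b, c ∈ map b}
  map_add : ∀ {a b a' b' : B}, a' ∈ map a → b' ∈ map b → a' + b' ∈ map (a + b)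
  map_smul : ∀ (z : ℂ) {a a' : B}, a' ∈ map a → z • a' ∈ map (z • a)
  map_mul : ∀ {a b a' b' : B}, a' ∈ map a → b' ∈ map b → a' * b' ∈ map (a * b)
  map_star : ∀ {a a' : B}, a' ∈ map a → star a' ∈ map (star a)

namespace PAut

/-- The domain of a partial automorphism. -/
def dom (θ : PAut B) : Set B := {b | ∃ c, c ∈ θ.map b}

/-- The image of a partial automorphism. -/
def img (θ : PAut B) : Set B := {c | ∃ b, c ∈ θ.map b}

/-- `θ ≤ θ'` means that `θ'` extends `θ`. -/
instance : PartialOrder (PAut B) := PartialOrder.lift PAut.map fun _ _ => PAut.ext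

variable (B) in
/-- The identity of `B` as a partial automorphism. -/
def id : PAut B where
  map := PEquiv.refl B
  dom_ideal := by constructor <;> simp
  img_ideal := by constructor <;> simp
  map_add := by simp +contextual
  map_smul := by simp +contextual
  map_mul := by simp +contextual
  map_star := by simp +contextual

/-- The inverse `θ* = θ⁻¹`. -/
def symm (θ : PAut B) : PAut B where
  map := θ.map.symm
  dom_ideal := by simpa only [PEquiv.mem_iff_mem] using θ.img_ideal
  img_ideal := by simpa only [PEquiv.mem_iff_mem] using θ.dom_ideal
  map_add h h' := (PEquiv.mem_iff_mem _).mpr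
    (θ.map_add ((PEquiv.mem_iff_mem _).mp h) ((PEquiv.mem_iff_mem _).mp h'))
  map_smul z _ _ h := (PEquiv.mem_iff_mem _).mpr (θ.map_smul z ((PEquiv.mem_iff_mem _).mp h))
  map_mul h h' := (PEquiv.mem_iff_mem _).mpr
    (θ.map_mul ((PEquiv.mem_iff_mem _).mp h) ((PEquiv.mem_iff_mem _).mp h'))
  map_star h := (PEquiv.mem_iff_mem _).mpr (θ.map_star ((PEquiv.mem_iff_mem _).mp h))

/-- `τ` is the composition `θ θ'` (first `θ'`, then `θ`, wherever this is defined). -/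
def IsComp (θ θ' τ : PAut B) : Prop := τ.map = θ'.map.trans θ.map

/-- `τ` is the meet `θ ∧ θ'`, the largest partial automorphism extended by `θ` and `θ'`. -/
def IsMeet (θ θ' τ : PAut B) : Prop := IsGreatest {ρ : PAut B | ρ ≤ θ ∧ ρ ≤ θ'} τ

end PAut

/-- A set of partial automorphisms that is an inverse semigroup (under composition and `*`). -/
structure IsInverseSemigroup (Θ : Set (PAut B)) : Prop where
  comp_mem : ∀ θ ∈ Θ, ∀ θ' ∈ Θ, ∃ τ ∈ Θ, PAut.IsComp θ θ' τ
  symm_mem : ∀ θ ∈ Θ, θ.symm ∈ Θ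

end PartialAutomorphisms

section Homogeneous

variable {B : Type*} [NonUnitalCStarAlgebra B] [PartialOrder B] [StarOrderedRing B]
variable {E : Type*} [NormedAddCommGroup E] [NormedSpace ℂ E] [SMul Bᵐᵒᵖ E] [CStarModule Bᵐᵒᵖ E]
  [LeftAction B E]
variable {F : Type*} [NormedAddCommGroup F] [NormedSpace ℂ F] [SMul Bᵐᵒᵖ F] [CStarModule Bᵐᵒᵖ F]
  [LeftAction B F]
variable {G : Type*} [NormedAddCommGroup G] [NormedSpace ℂ G] [SMul Bᵐᵒᵖ G] [CStarModule Bᵐᵒᵖ G]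
  [LeftAction B G]

variable (E) in
/-- The `θ`-homogeneous elements of `E`: those `ξ ∈ E Dom(θ)` with `ξ b = θ(b) ξ` for all
`b ∈ Dom(θ)`. Here `E Dom(θ)` is written as the closed linear span of the products `η d`; by the
Cohen factorization theorem each element of it is a single product. -/
def homog (θ : PAut B) : Set E :=
  {ξ | ξ ∈ clspan {x : E | ∃ (η : E), ∃ d ∈ θ.dom, x = η <• d} ∧
    ∀ b c, c ∈ θ.map b → ξ <• b = LeftAction.lact c ξ}

variable (E) in
/-- `E` is `Θ`-decomposable: the `θ`-homogeneous elements, `θ ∈ Θ`, are linearly dense. -/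
def IsDecomposable (Θ : Set (PAut B)) : Prop :=
  clspan {ξ : E | ∃ θ ∈ Θ, ξ ∈ homog E θ} = ⊤

variable (E) in
/-- `E` is `Θ`-supported: for each partial automorphism `θ`, the space of `θ`-homogeneous elements
is the closed linear span of the `θ'`-homogeneous elements with `θ' ∈ Θ`, `θ' ≤ θ`. -/
def IsSupported (Θ : Set (PAut B)) : Prop :=
  ∀ θ : PAut B, homog E θ = (clspan {ξ : E | ∃ θ' ∈ Θ, θ' ≤ θ ∧ ξ ∈ homog E θ'} : Set E)

/-- Admissible inverse semigroups of partial automorphisms. -/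
structure IsAdmissible (Θ : Set (PAut B)) : Prop where
  inverseSemigroup : IsInverseSemigroup Θ
  supported : IsSupported B Θ
  id_mem : PAut.id B ∈ Θ
  meet_mem : ∀ θ ∈ Θ, ∀ θ' ∈ Θ, ∃ τ ∈ Θ, PAut.IsMeet θ θ' τ

/-- `S` is the adjoint of `T` relative to `σ`: `⟨S η | ξ⟩ ∈ Dom(σ)` and
`⟨η | T ξ⟩ = σ ⟨S η | ξ⟩`. -/
def IsAdjoint (σ : PAut B) (T : E →L[ℂ] F) (S : F →L[ℂ] E) : Prop :=
  ∀ ξ η, ip B η (T ξ) ∈ σ.map (ip B (S η) ξ)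

/-- `(ρ, σ)`-homogeneous operators (such operators, and their adjoints, are automatically linear
and bounded): the image of `T` lies in `[Img(ρ) F]`, `T a ξ = ρ(a) T ξ` for `a ∈ Dom(ρ)`, and `T`
has an adjoint relative to `σ`. -/
structure IsHomogeneous (ρ σ : PAut B) (T : E →L[ℂ] F) : Prop where
  range_subset : ∀ ξ, T ξ ∈ clspan {x : F | ∃ c ∈ ρ.img, ∃ η : F, x = LeftAction.lact c η}
  map_lact : ∀ a c, c ∈ ρ.map a → ∀ ξ, T (LeftAction.lact a ξ) = LeftAction.lact c (T ξ)
  exists_adjoint : ∃ S, IsAdjoint σ T S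

variable (B E F) in
/-- Families `C = (C^ρ_σ)` of sets of operators, indexed by pairs of partial automorphisms;
`C ρ σ` is `C^ρ_σ`. -/
abbrev OpFamily : Type _ := PAut B → PAut B → Set (E →L[ℂ] F)

namespace OpFamily

/-- The adjoint family, `(C*)^ρ_σ = (C^{ρ*}_{σ*})*`. -/
def adj (C : OpFamily B E F) : OpFamily B F E := fun ρ σ =>
  {S | ∃ T ∈ C ρ.symm σ.symm, IsAdjoint σ.symm T S}

/-- The product family: `[D C]^{ρ''}_{σ''}` is the closed linear span of all `T' T` with
`T' ∈ D^{ρ'}_{σ'}`, `T ∈ C^ρ_σ`, `ρ' ρ ≤ ρ''` and `σ' σ ≤ σ''`. -/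
def prod (D : OpFamily B F G) (C : OpFamily B E F) : OpFamily B E G := fun ρ'' σ'' =>
  clspan {R : E →L[ℂ] G | ∃ ρ' σ' ρ σ : PAut B, ρ.map.trans ρ'.map ≤ ρ''.map ∧
    σ.map.trans σ'.map ≤ σ''.map ∧ ∃ T' ∈ D ρ' σ', ∃ T ∈ C ρ σ, R = T' ∘L T}

end OpFamily

variable (B) in
/-- The operator `|ξ⟩ : B → E`, `b ↦ ξ b`. -/
def ket (ξ : E) : B →L[ℂ] E := rmul B E ξ

variable (B) in
/-- The operator `|ξ] : B → E`, `b ↦ b ξ`. -/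
def rket (ξ : E) : B →L[ℂ] E := (LeftAction.lact (B := B) (E := E)).flip ξ

variable (E) in
/-- The operator `E → E`, `ξ ↦ b ξ`. -/
def leftMul (b : B) : E →L[ℂ] E := LeftAction.lact b

variable (E) in
/-- The operator `E → E`, `ξ ↦ ξ b`. -/
def rightMul (b : B) : E →L[ℂ] E := (rmul B E).flip b

variable (B E) in
open Classical in
/-- The family `|E⟩` of operators from `B` to `E`: `|E⟩^θ_id = {|ξ⟩ : ξ ∈ E_θ}`, and the other
components are zero. -/
def ketFamily : OpFamily B B E := fun ρ σ =>
  if σ = PAut.id B then {T | ∃ ξ ∈ homog E ρ, T = ket B ξ} else {0}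

variable (B E) in
open Classical in
/-- The family `|E]` of operators from `B` to `E`: `|E]^id_θ = {|ξ] : ξ ∈ E_{θ*}}`, and the other
components are zero. -/
def rketFamily : OpFamily B B E := fun ρ σ =>
  if ρ = PAut.id B then {T | ∃ ξ ∈ homog E σ.symm, T = rket B ξ} else {0}

variable (E) in
/-- `Θ`-admissible right `C*`-`B`-`B`-bimodules. -/
structure IsAdmissibleBimodule (Θ : Set (PAut B)) : Prop where
  bimodule : IsRightBimodule B E
  decomposable : IsDecomposable E Θ
  ket_adj_ket : (ketFamily B E).adj.prod (ketFamily B E) = ketFamily B B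
  rket_adj_rket : (rketFamily B E).adj.prod (rketFamily B E) = rketFamily B B

end Homogeneous

/-! ### Covariant representations and the functor `F` -/

section Functor

variable {B : Type*} [NonUnitalCStarAlgebra B] [PartialOrder B] [StarOrderedRing B]

/-- A covariant representation `(π, υ)` of `(B, Θ)` on a Hilbert space `K`. (Only the values of
`υ` on `Θ` are used.) -/
structure CovariantRep (Θ : Set (PAut B)) (K : Type*) [NormedAddCommGroup K]
    [InnerProductSpace ℂ K] [CompleteSpace K] where
  π : B →⋆ₙₐ[ℂ] (K →L[ℂ] K)
  υ : PAut B → (K →L[ℂ] K)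
  υ_comp : ∀ θ ∈ Θ, ∀ θ' ∈ Θ, ∀ τ ∈ Θ, PAut.IsComp θ θ' τ → υ θ ∘L υ θ' = υ τ
  υ_symm : ∀ θ ∈ Θ, adjoint (υ θ) = υ θ.symm
  range_υ : ∀ θ ∈ Θ, Set.range (υ θ) = (clspan {x : K | ∃ b ∈ θ.img, ∃ ζ, x = π b ζ} : Set K)
  covariant : ∀ θ ∈ Θ, ∀ b c, c ∈ θ.map b → υ θ ∘L π b ∘L adjoint (υ θ) = π c

namespace CovariantRep

variable {K : Type*} [NormedAddCommGroup K] [InnerProductSpace ℂ K] [CompleteSpace K]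
variable {E : Type*} [NormedAddCommGroup E] [NormedSpace ℂ E] [SMul Bᵐᵒᵖ E] [CStarModule Bᵐᵒᵖ E]
  [LeftAction B E]
variable {F : Type*} [NormedAddCommGroup F] [NormedSpace ℂ F] [SMul Bᵐᵒᵖ F] [CStarModule Bᵐᵒᵖ F]
  [LeftAction B F]
variable {Θ : Set (PAut B)} (R : CovariantRep Θ K)

variable (E) in
/-- The functor `F` on objects: `F(E) = E ⊗_π K`. -/
abbrev obj : Type _ := ITensor R.π E

/-- The functor `F` on morphisms: `F(T) = T ⊗ υ(σ)` for a `(ρ, σ)`-homogeneous operator `T`. -/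
def mor (σ : PAut B) (T : E →L[ℂ] F) : R.obj E →L[ℂ] R.obj F := amp R.π T (R.υ σ)

/-- `F_*(C)` for a family `C`: the closed linear span of the operators `F(c)` with `c ∈ C^ρ_σ`, `ρ, σ ∈ Θ`. -/
def morSpan (C : OpFamily B E F) : Submodule ℂ (R.obj E →L[ℂ] R.obj F) :=
  clspan {S | ∃ ρ ∈ Θ, ∃ σ ∈ Θ, ∃ T ∈ C ρ σ, S = R.mor σ T}

lemma symm_trans_symm {α : Type*} (f : α ≃. α) :
    (f.symm.trans f).trans f.symm = f.symm := by
  refine PEquiv.ext fun x => Option.ext fun y => ?_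
  rw [← Option.mem_def, ← Option.mem_def]
  constructor
  · intro h
    obtain ⟨z, hz, hy⟩ := (PEquiv.mem_trans _ _ _ _).mp h
    obtain ⟨w, hw, hz'⟩ := (PEquiv.mem_trans _ _ _ _).mp hz
    have h1 : x ∈ f w := (PEquiv.mem_iff_mem _).mp hw
    have h2 : x = z := Option.mem_unique h1 hz'
    rwa [h2]
  · intro h
    exact (PEquiv.mem_trans _ _ _ _).mpr
      ⟨x, (PEquiv.mem_trans _ _ _ _).mpr ⟨y, h, (PEquiv.mem_iff_mem _).mp h⟩, h⟩

lemma υ_adjoint_comp_self (hΘ : IsInverseSemigroup Θ) {σ : PAut B} (hσ : σ ∈ Θ) {b : B}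
    (hb : b ∈ σ.dom) (ζ : K) : adjoint (R.υ σ) (R.υ σ (R.π b ζ)) = R.π b ζ := by
  have hs := hΘ.symm_mem σ hσ
  have hmem : R.π b ζ ∈ Set.range (R.υ σ.symm) := by
    rw [R.range_υ _ hs]
    refine Submodule.le_topologicalClosure _ (Submodule.subset_span ⟨b, ?_, ζ, rfl⟩)
    obtain ⟨c, hc⟩ := hb
    exact ⟨c, (PEquiv.mem_iff_mem _).mpr hc⟩
  obtain ⟨κ, hκ⟩ := hmem
  obtain ⟨τ, hτ, hcomp⟩ := hΘ.comp_mem σ.symm hs σ hσ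
  have h1 := R.υ_comp _ hs _ hσ _ hτ hcomp
  have h2 : PAut.IsComp τ σ.symm σ.symm := by
    unfold PAut.IsComp at *
    rw [hcomp]
    change σ.map.symm = σ.map.symm.trans (σ.map.trans σ.map.symm)
    rw [← PEquiv.trans_assoc]
    exact (symm_trans_symm σ.map).symm
  have h3 := R.υ_comp _ hτ _ hs _ hs h2
  rw [R.υ_symm σ hσ, ← hκ]
  calc R.υ σ.symm (R.υ σ (R.υ σ.symm κ)) = (R.υ σ.symm ∘L R.υ σ) (R.υ σ.symm κ) := rfl
    _ = (R.υ τ ∘L R.υ σ.symm) κ := by rw [h1]; rfl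
    _ = R.υ σ.symm κ := by rw [h3]

/-- `F(T)` satisfies its defining identity for every homogeneous operator. -/
theorem mor_tmul (hΘ : IsInverseSemigroup Θ) {ρ σ : PAut B} (hσ : σ ∈ Θ) {T : E →L[ℂ] F}
    (hT : IsHomogeneous ρ σ T) (ξ : E) (ζ : K) :
    R.mor σ T (tmul R.π ξ ζ) = tmul R.π (T ξ) (R.υ σ ζ) := by
  obtain ⟨S, hS⟩ := hT.exists_adjoint
  refine amp_tmul_of_exists _ (exists_amp _ (S ∘L T) fun ξ ξ' ζ ζ' => ?_) ξ ζ
  have hmem := hS ξ' (T ξ)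
  change inner ℂ (R.υ σ ζ) (R.π _ (R.υ σ ζ')) = inner ℂ ζ (R.π (ip B (S (T ξ)) ξ') ζ')
  rw [← R.covariant σ hσ _ _ hmem]
  set c := ip B (S (T ξ)) ξ'
  have hc : c ∈ σ.dom := ⟨_, hmem⟩
  have hc' : star c ∈ σ.dom := ⟨_, σ.map_star hmem⟩
  have hadj : ∀ x y : K, inner ℂ x (R.π c y) = inner ℂ (R.π (star c) x) y := by
    intro x y
    rw [map_star, ContinuousLinearMap.star_eq_adjoint,
      ContinuousLinearMap.adjoint_inner_left]
  change inner ℂ (R.υ σ ζ) (R.υ σ (R.π c (adjoint (R.υ σ) (R.υ σ ζ')))) = _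
  rw [← ContinuousLinearMap.adjoint_inner_right, R.υ_adjoint_comp_self hΘ hσ hc, hadj,
    ContinuousLinearMap.adjoint_inner_right, ← ContinuousLinearMap.adjoint_inner_left,
    R.υ_adjoint_comp_self hΘ hσ hc', ← hadj]

end CovariantRep

end Functor

/-! ### `C*`-bases and `C*`-factorizations -/

section Bases

variable {H : Type*} [NormedAddCommGroup H] [InnerProductSpace ℂ H] [CompleteSpace H]
variable {H' : Type*} [NormedAddCommGroup H'] [InnerProductSpace ℂ H'] [CompleteSpace H']
variable {K : Type*} [NormedAddCommGroup K] [InnerProductSpace ℂ K] [CompleteSpace K]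

variable (H) in
/-- A `C*`-base `(H, 𝔅, 𝔅†)`: a Hilbert space `H` with two commuting nondegenerate
`C*`-algebras `𝔅 = left` and `𝔅† = right` of operators on `H`. -/
structure CStarBase where
  left : NonUnitalStarSubalgebra ℂ (H →L[ℂ] H)
  right : NonUnitalStarSubalgebra ℂ (H →L[ℂ] H)
  isClosed_left : IsClosed (left : Set (H →L[ℂ] H))
  isClosed_right : IsClosed (right : Set (H →L[ℂ] H))
  commute : ∀ a ∈ left, ∀ b ∈ right, Commute a b
  nondegenerate_left : clspan {x : H | ∃ a ∈ left, ∃ ζ, x = a ζ} = ⊤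
  nondegenerate_right : clspan {x : H | ∃ b ∈ right, ∃ ζ, x = b ζ} = ⊤

namespace CStarBase

/-- The opposite `C*`-base `(H, 𝔅†, 𝔅)`. -/
def op (𝒞 : CStarBase H) : CStarBase H where
  left := 𝒞.right
  right := 𝒞.left
  isClosed_left := 𝒞.isClosed_right
  isClosed_right := 𝒞.isClosed_left
  commute a ha b hb := (𝒞.commute b hb a ha).symm
  nondegenerate_left := 𝒞.nondegenerate_right
  nondegenerate_right := 𝒞.nondegenerate_left

/-- `α` is a `C*`-factorization of `K` with respect to the `C*`-base `(H, 𝔅, 𝔅†)`: a closed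
subspace of the operators from `H` to `K` such that `[α* α] = 𝔅`, `[α 𝔅] = α`, `[α H] = K`. -/
structure IsFactorization (𝒞 : CStarBase H) (α : Submodule ℂ (H →L[ℂ] K)) : Prop where
  isClosed : IsClosed (α : Set (H →L[ℂ] K))
  adjoint_comp : (clspan {x : H →L[ℂ] H | ∃ ξ ∈ α, ∃ η ∈ α, x = adjoint ξ ∘L η} :
    Set (H →L[ℂ] H)) = 𝒞.left
  comp_left : clspan {x : H →L[ℂ] K | ∃ ξ ∈ α, ∃ a ∈ 𝒞.left, x = ξ ∘L a} = α
  nondegenerate : clspan {x : K | ∃ ξ ∈ α, ∃ ζ, x = ξ ζ} = ⊤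

namespace IsFactorization

variable {𝒞 : CStarBase H} {α : Submodule ℂ (H →L[ℂ] K)}

lemma adjoint_comp_mem (hα : 𝒞.IsFactorization α) {ξ η : H →L[ℂ] K} (hξ : ξ ∈ α) (hη : η ∈ α) :
    adjoint ξ ∘L η ∈ 𝒞.left := by
  rw [← SetLike.mem_coe, ← hα.adjoint_comp]
  exact Submodule.le_topologicalClosure _ (Submodule.subset_span ⟨ξ, hξ, η, hη, rfl⟩)

lemma ext_comp (hα : 𝒞.IsFactorization α) {T T' : K →L[ℂ] K}
    (h : ∀ ξ ∈ α, ∀ ζ, T (ξ ζ) = T' (ξ ζ)) : T = T' := by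
  have hle : clspan {x : K | ∃ ξ ∈ α, ∃ ζ, x = ξ ζ} ≤ (T - T').ker := by
    refine Submodule.topologicalClosure_minimal _ (Submodule.span_le.mpr ?_)
      (T - T').isClosed_ker
    rintro _ ⟨ξ, hξ, ζ, rfl⟩
    simp [h ξ hξ ζ]
  rw [hα.nondegenerate] at hle
  ext x
  have hx : (T - T') x = 0 := hle (Submodule.mem_top (x := x))
  exact sub_eq_zero.mp hx

/-- The map `ξ ⊗ ζ ↦ ξ b ζ` on the algebraic tensor product of `α` and `H`. -/
def evalMap (α : Submodule ℂ (H →L[ℂ] K)) (b : H →L[ℂ] H) : α ⊗[ℂ] H →ₗ[ℂ] K :=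
  TensorProduct.lift (LinearMap.mk₂ ℂ (fun (ξ : α) (ζ : H) => (ξ : H →L[ℂ] K) (b ζ))
    (by intros; simp) (by intros; simp) (by intros; simp) (by intros; simp))

@[simp] lemma evalMap_tmul (b : H →L[ℂ] H) (ξ : α) (ζ : H) :
    evalMap α b (ξ ⊗ₜ ζ) = (ξ : H →L[ℂ] K) (b ζ) := rfl

lemma inner_evalMap (hα : 𝒞.IsFactorization α) {b c : H →L[ℂ] H}
    (hb : ∀ a ∈ 𝒞.left, Commute a b) (x y : α ⊗[ℂ] H) :
    inner ℂ (evalMap α b x) (evalMap α c y)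
      = inner ℂ (evalMap α 1 x) (evalMap α (star b * c) y) := by
  induction x using TensorProduct.induction_on with
  | zero => simp
  | add x₁ x₂ h₁ h₂ => simp only [map_add, inner_add_left, h₁, h₂]
  | tmul ξ ζ =>
    induction y using TensorProduct.induction_on with
    | zero => simp
    | add y₁ y₂ h₁ h₂ => simp only [map_add, inner_add_right, h₁, h₂]
    | tmul η ω =>
      have hm := hα.adjoint_comp_mem ξ.2 η.2
      have hm' := hα.adjoint_comp_mem η.2 ξ.2
      have hcomm : star b * (adjoint ξ.1 ∘L η.1) = (adjoint ξ.1 ∘L η.1) * star b := by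
        have h1 := (hb _ (star_mem hm)).eq
        have h2 := congrArg star h1
        simpa [star_mul] using h2
      have h3 : ∀ z, star b (adjoint ξ.1 (η.1 z)) = adjoint ξ.1 (η.1 (star b z)) := fun z =>
        congrArg (fun T : H →L[ℂ] H => T z) hcomm
      simp only [evalMap_tmul]
      rw [← ContinuousLinearMap.adjoint_inner_right, ← ContinuousLinearMap.adjoint_inner_right,
        ← ContinuousLinearMap.star_eq_adjoint b, h3, ContinuousLinearMap.adjoint_inner_right]
      rfl

lemma norm_evalMap_le (hα : 𝒞.IsFactorization α) {b : H →L[ℂ] H} (hb : b ∈ 𝒞.right)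
    (x : α ⊗[ℂ] H) : ‖evalMap α b x‖ ≤ ‖b‖ * ‖evalMap α 1 x‖ := by
  have hbc : ∀ a ∈ 𝒞.left, Commute a b := fun a ha => 𝒞.commute a ha b hb
  set D : H →L[ℂ] H := algebraMap ℝ (H →L[ℂ] H) (‖b‖ ^ 2) - star b * b with hD
  have hD0 : 0 ≤ D := by
    have h1 := IsSelfAdjoint.le_algebraMap_norm_self (IsSelfAdjoint.star_mul_self b)
    rw [CStarRing.norm_star_mul_self, ← sq] at h1
    exact sub_nonneg.mpr h1
  have hDc : ∀ a ∈ 𝒞.left, Commute a D := by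
    intro a ha
    refine Commute.sub_right (Algebra.commute_algebraMap_right _ _) ?_
    have h1 : Commute a (star b) := by
      have h2 := (hbc _ (star_mem ha)).star_star
      rwa [star_star] at h2
    exact h1.mul_right (hbc a ha)
  set d := CFC.sqrt D with hd
  have hdd : star d * d = D := by
    rw [(CFC.sqrt_nonneg D).isSelfAdjoint.star_eq]
    exact CFC.sqrt_mul_sqrt_self D hD0
  have hdc : ∀ a ∈ 𝒞.left, Commute a d := fun a ha => by
    rw [hd, CFC.sqrt]
    exact ((hDc a ha).symm.cfcₙ_nnreal _).symm
  have e3 : evalMap α D x = (‖b‖ ^ 2 : ℝ) • evalMap α 1 x - evalMap α (star b * b) x := by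
    clear_value d D
    rw [hD]
    clear hD hD0 hDc hd hdd hdc
    induction x using TensorProduct.induction_on with
    | zero => simp
    | add x y hx hy => simp only [map_add, hx, hy, smul_add]; abel
    | tmul ξ ζ => simp [Algebra.algebraMap_eq_smul_one]
  have e1 := hα.inner_evalMap (c := b) hbc x x
  have e2 := hα.inner_evalMap (c := d) hdc x x
  rw [hdd, e3, inner_sub_right, ← e1, inner_smul_right_eq_smul] at e2
  have e4 := congrArg Complex.re e2
  rw [Complex.sub_re, Complex.smul_re, smul_eq_mul] at e4
  have e5 : 0 ≤ (inner ℂ (evalMap α d x) (evalMap α d x)).re := inner_self_nonneg (𝕜 := ℂ)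
  have e6 : (inner ℂ (evalMap α b x) (evalMap α b x)).re = ‖evalMap α b x‖ ^ 2 :=
    inner_self_eq_norm_sq (𝕜 := ℂ) _
  have e7 : (inner ℂ (evalMap α 1 x) (evalMap α 1 x)).re = ‖evalMap α 1 x‖ ^ 2 :=
    inner_self_eq_norm_sq (𝕜 := ℂ) _
  rw [e4, e6, e7] at e5
  have e8 : ‖evalMap α b x‖ ^ 2 ≤ (‖b‖ * ‖evalMap α 1 x‖) ^ 2 := by rw [mul_pow]; linarith
  exact abs_le_of_sq_le_sq' e8 (by positivity) |>.2

lemma exists_extension {A : Type*} [AddCommGroup A] [Module ℂ A] (f e : A →ₗ[ℂ] K)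
    (he : DenseRange e) (C : ℝ) (h : ∀ x, ‖f x‖ ≤ C * ‖e x‖) :
    ∃ T : K →L[ℂ] K, ∀ x, T (e x) = f x :=
  ⟨f.extendOfNorm e, LinearMap.extendOfNorm_eq he ⟨C, h⟩⟩

lemma exists_rep (hα : 𝒞.IsFactorization α) (b : 𝒞.right) :
    ∃ T : K →L[ℂ] K, ∀ ξ ∈ α, ∀ ζ, T (ξ ζ) = ξ (b.1 ζ) := by
  have hdense : DenseRange (evalMap α 1) := by
    have h1 : clspan {x : K | ∃ ξ ∈ α, ∃ ζ, x = ξ ζ} ≤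
        (LinearMap.range (evalMap α 1)).topologicalClosure := by
      refine Submodule.topologicalClosure_mono (Submodule.span_le.mpr ?_)
      rintro _ ⟨ξ, hξ, ζ, rfl⟩
      exact ⟨(⟨ξ, hξ⟩ : α) ⊗ₜ ζ, evalMap_tmul 1 ⟨ξ, hξ⟩ ζ⟩
    intro x
    have h2 := h1 (hα.nondegenerate ▸ Submodule.mem_top (x := x))
    rwa [← SetLike.mem_coe, Submodule.topologicalClosure_coe, LinearMap.coe_range] at h2
  have hn : ∀ x, ‖evalMap α b.1 x‖ ≤ ‖b.1‖ * ‖evalMap α 1 x‖ := hα.norm_evalMap_le b.2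
  have hf : ∀ (ξ : α) (ζ : H), evalMap α b.1 (ξ ⊗ₜ ζ) = ξ.1 (b.1 ζ) := fun ξ ζ => rfl
  have he : ∀ (ξ : α) (ζ : H), evalMap α 1 (ξ ⊗ₜ ζ) = ξ.1 ζ := fun ξ ζ => rfl
  generalize evalMap α b.1 = f at hn hf
  generalize evalMap α 1 = e at hn he hdense
  obtain ⟨T, hT⟩ := exists_extension (A := α ⊗[ℂ] H) f e hdense ‖b.1‖ hn
  refine ⟨T, fun ξ hξ ζ => ?_⟩
  have h := hT ((⟨ξ, hξ⟩ : α) ⊗ₜ ζ)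
  rw [he, hf] at h
  exact h

/-- The operator `ρ_α(b)`, determined by `ρ_α(b) ξ ζ = ξ b ζ` for `ξ ∈ α`, `ζ ∈ H`. -/
def repFun (hα : 𝒞.IsFactorization α) (b : 𝒞.right) : K →L[ℂ] K := (hα.exists_rep b).choose

lemma repFun_apply (hα : 𝒞.IsFactorization α) (b : 𝒞.right) {ξ : H →L[ℂ] K} (hξ : ξ ∈ α)
    (ζ : H) : hα.repFun b (ξ ζ) = ξ (b.1 ζ) :=
  (hα.exists_rep b).choose_spec ξ hξ ζ

/-- The representation `ρ_α` of `𝔅†` on `K` associated to a `C*`-factorization `α`; it is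
determined by `ρ_α(b) ξ ζ = ξ b ζ` for `b ∈ 𝔅†`, `ξ ∈ α`, `ζ ∈ H`. -/
def rep (hα : 𝒞.IsFactorization α) : 𝒞.right →⋆ₙₐ[ℂ] (K →L[ℂ] K) where
  toFun := hα.repFun
  map_smul' z b := hα.ext_comp fun ξ hξ ζ => by simp [hα.repFun_apply _ hξ]
  map_zero' := hα.ext_comp fun ξ hξ ζ => by simp [hα.repFun_apply _ hξ]
  map_add' b c := hα.ext_comp fun ξ hξ ζ => by simp [hα.repFun_apply _ hξ]
  map_mul' b c := hα.ext_comp fun ξ hξ ζ => by simp [hα.repFun_apply _ hξ]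
  map_star' b := by
    rw [ContinuousLinearMap.star_eq_adjoint, ContinuousLinearMap.eq_adjoint_iff]
    have key : ∀ ξ ∈ α, ∀ ζ, ∀ η ∈ α, ∀ ω,
        inner ℂ (hα.repFun (star b) (ξ ζ)) (η ω) = inner ℂ (ξ ζ) (hα.repFun b (η ω)) := by
      intro ξ hξ ζ η hη ω
      rw [hα.repFun_apply _ hξ, hα.repFun_apply _ hη]
      have h := hα.inner_evalMap (b := star b.1) (c := 1)
        (fun a ha => 𝒞.commute a ha _ (star_mem b.2)) ((⟨ξ, hξ⟩ : α) ⊗ₜ ζ) ((⟨η, hη⟩ : α) ⊗ₜ ω)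
      simpa using h
    have hd : ∀ (S T : K →L[ℂ] K), (∀ ξ ∈ α, ∀ ζ, ∀ η ∈ α, ∀ ω,
        inner ℂ (S (ξ ζ)) (η ω) = inner ℂ (ξ ζ) (T (η ω))) → S = adjoint T := by
      intro S T hST
      refine hα.ext_comp fun ξ hξ ζ => ?_
      refine ext_inner_right ℂ fun y => ?_
      rw [ContinuousLinearMap.adjoint_inner_left]
      have h2 : (innerSL ℂ (S (ξ ζ))) = (innerSL ℂ (ξ ζ)) ∘L T := by
        have hle : clspan {x : K | ∃ ξ ∈ α, ∃ ζ, x = ξ ζ} ≤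
            ((innerSL ℂ (S (ξ ζ))) - (innerSL ℂ (ξ ζ)) ∘L T).ker := by
          refine Submodule.topologicalClosure_minimal _ (Submodule.span_le.mpr ?_)
            (ContinuousLinearMap.isClosed_ker _)
          rintro _ ⟨η, hη, ω, rfl⟩
          simp [hST ξ hξ ζ η hη ω]
        rw [hα.nondegenerate] at hle
        ext x
        exact sub_eq_zero.mp (hle (Submodule.mem_top (x := x)))
      exact congrArg (fun T => T y) h2
    intro x y
    rw [hd _ _ key, ContinuousLinearMap.adjoint_inner_left]

theorem rep_apply (hα : 𝒞.IsFactorization α) (b : 𝒞.right) {ξ : H →L[ℂ] K} (hξ : ξ ∈ α) (ζ : H) :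
    hα.rep b (ξ ζ) = ξ (b.1 ζ) :=
  hα.repFun_apply b hξ ζ

/-- Compatibility of `C*`-factorizations `α`, `β` of the same Hilbert space, with respect to
`C*`-bases `(H, 𝔅, 𝔅†)` and `(H', ℭ, ℭ†)`: `[ρ_α(𝔅†) β] = β` and `[ρ_β(ℭ†) α] = α`. -/
def Compatible {𝒟 : CStarBase H'} {β : Submodule ℂ (H' →L[ℂ] K)} (hα : 𝒞.IsFactorization α)
    (hβ : 𝒟.IsFactorization β) : Prop :=
  clspan {x : H' →L[ℂ] K | ∃ b, ∃ η ∈ β, x = hα.rep b ∘L η} = β ∧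
    clspan {x : H →L[ℂ] K | ∃ c, ∃ ξ ∈ α, x = hβ.rep c ∘L ξ} = α

end IsFactorization

end CStarBase

end Bases

end HomMod

end

open HomMod

/-! On elementary tensors the generators act by F(|ξ⟩)(b ⊗ ζ) = ξb ⊗ ζ and, for ξ homogeneous of
degree θ, F(|ξ])(b ⊗ ζ) = bξ ⊗ υ(θ*)ζ. Right and left multiplication commute, so most relations
between the operator spaces can be read off there. What needs proof is that |ξ] has an adjoint, that
the partial isometries υ(θ) cancel where they should, and that the closed spans are large enough.

The adjoint comes from homogeneity. If ξ has degree θ, all ⟨η|ξ⟩ lie in Dom(θ), and moving elements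
of Img(θ) across ξ with an approximate unit gives θ⟨η|bξ⟩ = θ(⟨η|ξ⟩)b (`homog.app_ip_lact`). Hence η
↦ θ⟨ξ|η⟩ is the adjoint of |ξ] relative to θ*. The same method shows that inner products of two
elements of equal degree are central, and that a θ-homogeneous b in B is normal, is fixed by θ and
satisfies θ(xb) = bx (`homog.app_mul_right`); this makes r_b homogeneous and gives F(|b])* =
F(|b*]). A product υ(θ)υ(θ*) disappears from a tensor whose first factor lies in Img(θ), because ξ ⊗
ζ depends on ζ only through the vectors π(⟨η|ξ⟩)ζ (`tmul_congr`).

For α(E), F(|ξ⟩) makes sense for every ξ, F(|ξ⟩)*F(|η⟩) = F(|⟨ξ|η⟩⟩), and fullness of E gives [α*α]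
= 𝔅. For β(E), the equation [|E]*|E]] = |B] puts each product of generators F(|ξ])*F(|η]) into 𝔅†.
The reverse inclusion does not follow by applying F to that equation, since its product family also
involves partial automorphisms outside Θ. Instead, the multipliers h in B for which F(|hc]) and
F(|h*c]) lie in [β*β], for all homogeneous c with degree in Θ, form a closed *-algebra. It contains
all θ⟨ξ|ξ⟩ with θ in Θ, so its approximate unit acts as one on E, hence on the elements σ⟨ξ|η⟩,
hence on B-elements that they approximate (`mor_rket_mem_clspan_adjoint_comp`).

Finally ρ_β(F(|b⟩)) = F(l_b) and ρ_α(F(|b])) = F(r_b) by commutation with the generators.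
Compatibility then rests on nondegeneracy of the left action for α(E), and for β(E) on ⟨ξ|ξ⟩ being
central, so that an approximate unit of the centre fixes ξ in the limit. -/

noncomputable section

namespace HomMod

open Filter Topology
open HomMod.LeftAction (lact)

/-! ### Closed linear spans -/

section ClosedSpan

variable {V W : Type*} [SeminormedAddCommGroup V] [NormedSpace ℂ V]
  [SeminormedAddCommGroup W] [NormedSpace ℂ W]

lemma subset_clspan (S : Set V) : S ⊆ clspan S := fun _ hx =>
  Submodule.le_topologicalClosure _ (Submodule.subset_span hx)

lemma isClosed_clspan (S : Set V) : IsClosed (clspan S : Set V) :=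
  Submodule.isClosed_topologicalClosure _

lemma clspan_le {S : Set V} {M : Submodule ℂ V} (hM : IsClosed (M : Set V)) (h : S ⊆ M) :
    clspan S ≤ M :=
  Submodule.topologicalClosure_minimal _ (Submodule.span_le.mpr h) hM

lemma clspan_mono {S T : Set V} (h : S ⊆ T) : clspan S ≤ clspan T :=
  clspan_le (isClosed_clspan T) (h.trans (subset_clspan T))

lemma map_mem_of_mem_clspan (f : V →L[ℂ] W) {S : Set V} {M : Submodule ℂ W}
    (hM : IsClosed (M : Set W)) (h : ∀ x ∈ S, f x ∈ M) {x : V} (hx : x ∈ clspan S) : f x ∈ M :=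
  clspan_le (M := M.comap f.toLinearMap) (hM.preimage f.continuous) h hx

lemma map₂_mem_of_mem_clspan {X : Type*} [SeminormedAddCommGroup X] [NormedSpace ℂ X]
    (f : V →L[ℂ] W →L[ℂ] X) {S : Set V} {T : Set W}
    {M : Submodule ℂ X} (hM : IsClosed (M : Set X)) (h : ∀ x ∈ S, ∀ y ∈ T, f x y ∈ M)
    {x : V} {y : W} (hx : x ∈ clspan S) (hy : y ∈ clspan T) : f x y ∈ M := by
  have h1 : ∀ x ∈ S, f x y ∈ M := fun x hx => map_mem_of_mem_clspan (f x) hM (h x hx) hy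
  exact map_mem_of_mem_clspan (f.flip y) hM h1 hx

/-- Uniform boundedness makes the set of vectors with T i x → x a closed subspace, so convergence
need only be tested on generators. -/
lemma tendsto_of_mem_clspan {ι : Type*} {l : Filter ι} {T : ι → V →L[ℂ] V} {C : ℝ}
    (hC : ∀ i, ‖T i‖ ≤ C) {S : Set V} (h : ∀ x ∈ S, Tendsto (fun i => T i x) l (𝓝 x)) {x : V}
    (hx : x ∈ clspan S) : Tendsto (fun i => T i x) l (𝓝 x) := by
  -- A nontrivial filter supplies an index, and with it C ≥ 0.
  rcases l.eq_or_neBot with rfl | hl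
  · exact tendsto_bot
  obtain ⟨i₀, -⟩ := hl.nonempty_of_mem univ_mem
  have hC0 : 0 ≤ C := (norm_nonneg _).trans (hC i₀)
  let N : Submodule ℂ V :=
    { carrier := {x | Tendsto (fun i => T i x) l (𝓝 x)}
      add_mem' := fun {a b} ha hb => by
        simpa only [Set.mem_ofPred_eq, map_add] using Tendsto.add ha hb
      zero_mem' := by
        simpa only [Set.mem_ofPred_eq, map_zero] using tendsto_const_nhds
      smul_mem' := fun c x hx => by
        simpa only [Set.mem_ofPred_eq, map_smul] using Tendsto.const_smul hx c }
  have hN : IsClosed (N : Set V) := by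
    refine isClosed_of_closure_subset fun y hy => ?_
    change Tendsto (fun i => T i y) l (𝓝 y)
    rw [Metric.tendsto_nhds]
    intro ε hε
    -- The radius is chosen so that (C + 1)‖y - z‖ < ε / 2 covers both T i (y - z) and y - z.
    obtain ⟨z, hz, hyz⟩ := Metric.mem_closure_iff.mp hy (ε / (2 * (C + 1))) (by positivity)
    have hz' : Tendsto (fun i => T i z) l (𝓝 z) := hz
    filter_upwards [Metric.tendsto_nhds.mp hz' (ε / 2) (by positivity)] with i hi
    rw [dist_eq_norm] at hi hyz ⊢
    have e : T i y - y = T i (y - z) + (T i z - z) - (y - z) := by rw [map_sub]; abel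
    rw [e]
    have h1 : ‖T i (y - z)‖ ≤ C * ‖y - z‖ :=
      (T i).le_of_opNorm_le (hC i) _
    have h2 : (C + 1) * ‖y - z‖ < ε / 2 := by
      have := (lt_div_iff₀ (by positivity)).mp hyz
      linarith
    calc ‖T i (y - z) + (T i z - z) - (y - z)‖
        ≤ ‖T i (y - z)‖ + ‖T i z - z‖ + ‖y - z‖ :=
          (norm_sub_le _ _).trans (by gcongr; exact norm_add_le _ _)
      _ < ε := by linarith
  exact clspan_le hN h hx

end ClosedSpan

/-! ### Approximate units -/

section ApproximateUnits

variable {B : Type*} [NonUnitalCStarAlgebra B]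

/-- A contractive self-adjoint approximate unit of a subset `S` of a `C*`-algebra. -/
structure IsAU (S : Set B) {ι : Type*} (l : Filter ι) (e : ι → B) : Prop where
  neBot : l.NeBot
  mem : ∀ i, e i ∈ S
  norm_le : ∀ i, ‖e i‖ ≤ 1
  star_eq : ∀ i, star (e i) = e i
  mul_right : ∀ x ∈ S, Tendsto (fun i => x * e i) l (𝓝 x)
  mul_left : ∀ x ∈ S, Tendsto (fun i => e i * x) l (𝓝 x)

/-- A closed *-subalgebra is itself a C*-algebra and has its canonical approximate unit.
Contractivity and self-adjointness hold there only eventually; pulling the filter back to the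
subtype makes them hold at every index. -/
lemma exists_isAU (S : NonUnitalStarSubalgebra ℂ B) (hS : IsClosed (S : Set B)) :
    ∃ l : Filter {x : S // ‖x‖ ≤ 1 ∧ IsSelfAdjoint x}, IsAU (S : Set B) l fun x => (x.1 : B) := by
  have : IsClosed (S : Set B) := hS
  let : PartialOrder S := CStarAlgebra.spectralOrder S
  have : StarOrderedRing S := CStarAlgebra.spectralOrderedRing S
  have h := CStarAlgebra.increasingApproximateUnit S
  refine ⟨(CStarAlgebra.approximateUnit (A := S)).comap Subtype.val, ?_, fun i => i.1.2,
    fun i => i.2.1, fun i => congrArg Subtype.val i.2.2.star_eq, fun x hx => ?_, fun x hx => ?_⟩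
  · refine comap_neBot_iff_frequently.mpr (Eventually.frequently ?_)
    filter_upwards [h.eventually_norm, h.eventually_isSelfAdjoint] with x h1 h2
    exact ⟨⟨x, h1, h2⟩, rfl⟩
  · exact (continuous_subtype_val.tendsto _).comp
      ((h.tendsto_mul_left ⟨x, hx⟩).comp tendsto_comap)
  · exact (continuous_subtype_val.tendsto _).comp
      ((h.tendsto_mul_right ⟨x, hx⟩).comp tendsto_comap)

lemma isClosed_top_subalgebra : IsClosed ((⊤ : NonUnitalStarSubalgebra ℂ B) : Set B) := by
  rw [NonUnitalStarAlgebra.coe_top]; exact isClosed_univ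

end ApproximateUnits

/-! ### Partial automorphisms as functions -/

namespace IsClosedIdeal

variable {B : Type*} [NonUnitalCStarAlgebra B] {I : Set B}

/-- A closed ideal as a subspace. -/
def toSubmodule (h : IsClosedIdeal I) : Submodule ℂ B where
  carrier := I
  add_mem' := h.add_mem
  zero_mem' := h.zero_mem
  smul_mem' := fun c _ hx => h.smul_mem c hx

lemma sub_mem (h : IsClosedIdeal I) {a b : B} (ha : a ∈ I) (hb : b ∈ I) : a - b ∈ I :=
  h.toSubmodule.sub_mem ha hb

lemma mem_of_tendsto (h : IsClosedIdeal I) {ι : Type*} {l : Filter ι} [l.NeBot] {f : ι → B} {x : B}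
    (hf : ∀ i, f i ∈ I) (hx : Tendsto f l (𝓝 x)) : x ∈ I :=
  h.isClosed.mem_of_tendsto hx (Eventually.of_forall hf)

end IsClosedIdeal

namespace PAut

variable {B : Type*} [NonUnitalCStarAlgebra B] (θ : PAut B)

/-- The value `θ b`, which is `0` outside the domain of `θ`. -/
def app (b : B) : B := (θ.map b).getD 0

lemma isClosedIdeal_dom : IsClosedIdeal θ.dom := θ.dom_ideal

lemma isClosedIdeal_img : IsClosedIdeal θ.img := θ.img_ideal

variable {θ}

lemma app_mem_map {b : B} (hb : b ∈ θ.dom) : θ.app b ∈ θ.map b := by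
  obtain ⟨c, hc⟩ := hb
  rw [Option.mem_def] at hc
  rw [app, hc]; rfl

lemma app_eq {b c : B} (h : c ∈ θ.map b) : θ.app b = c :=
  Option.mem_unique (app_mem_map ⟨c, h⟩) h

lemma mem_dom {b c : B} (h : c ∈ θ.map b) : b ∈ θ.dom := ⟨c, h⟩

lemma app_mem_img {b : B} (hb : b ∈ θ.dom) : θ.app b ∈ θ.img := ⟨b, app_mem_map hb⟩

@[simp] lemma symm_symm (θ : PAut B) : θ.symm.symm = θ := rfl

lemma dom_symm (θ : PAut B) : θ.symm.dom = θ.img := by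
  ext b
  exact exists_congr fun c => PEquiv.mem_iff_mem _

lemma img_symm (θ : PAut B) : θ.symm.img = θ.dom := by
  ext b
  exact exists_congr fun c => PEquiv.mem_iff_mem _

@[simp] lemma id_symm : (PAut.id B).symm = PAut.id B := rfl

lemma mem_id_map {b c : B} : c ∈ (PAut.id B).map b ↔ b = c := by
  change c ∈ (PEquiv.refl B) b ↔ _
  simp

lemma mem_dom_id (b : B) : b ∈ (PAut.id B).dom := ⟨b, mem_id_map.mpr rfl⟩

lemma mem_img_id (b : B) : b ∈ (PAut.id B).img := ⟨b, mem_id_map.mpr rfl⟩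

lemma symm_app_app {b : B} (hb : b ∈ θ.dom) : θ.symm.app (θ.app b) = b :=
  app_eq ((PEquiv.mem_iff_mem _).mpr (app_mem_map hb))

lemma app_symm_app {b : B} (hb : b ∈ θ.img) : θ.app (θ.symm.app b) = b :=
  symm_app_app (θ := θ.symm) (by rwa [dom_symm])

lemma symm_app_mem_dom {b : B} (hb : b ∈ θ.img) : θ.symm.app b ∈ θ.dom := by
  rw [← img_symm]; exact app_mem_img (by rwa [dom_symm])

lemma star_mem_dom {b : B} (hb : b ∈ θ.dom) : star b ∈ θ.dom :=
  mem_dom (θ.map_star (app_mem_map hb))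

lemma star_mem_img {b : B} (hb : b ∈ θ.img) : star b ∈ θ.img := by
  rw [← dom_symm] at hb ⊢; exact star_mem_dom hb

lemma app_add {a b : B} (ha : a ∈ θ.dom) (hb : b ∈ θ.dom) :
    θ.app (a + b) = θ.app a + θ.app b :=
  app_eq (θ.map_add (app_mem_map ha) (app_mem_map hb))

lemma app_smul (z : ℂ) {a : B} (ha : a ∈ θ.dom) : θ.app (z • a) = z • θ.app a :=
  app_eq (θ.map_smul z (app_mem_map ha))

lemma app_mul {a b : B} (ha : a ∈ θ.dom) (hb : b ∈ θ.dom) :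
    θ.app (a * b) = θ.app a * θ.app b :=
  app_eq (θ.map_mul (app_mem_map ha) (app_mem_map hb))

lemma app_star {a : B} (ha : a ∈ θ.dom) : θ.app (star a) = star (θ.app a) :=
  app_eq (θ.map_star (app_mem_map ha))

lemma app_zero : θ.app 0 = 0 := by
  have h := app_smul 0 θ.isClosedIdeal_dom.zero_mem
  simpa using h

lemma app_sub {a b : B} (ha : a ∈ θ.dom) (hb : b ∈ θ.dom) :
    θ.app (a - b) = θ.app a - θ.app b := by
  have h := app_add (θ.isClosedIdeal_dom.sub_mem ha hb) hb
  rw [sub_add_cancel] at h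
  rw [h, add_sub_cancel_right]

variable (θ) in
/-- The domain of a partial automorphism as a subalgebra. -/
def domAlg : NonUnitalStarSubalgebra ℂ B where
  carrier := θ.dom
  add_mem' := θ.isClosedIdeal_dom.add_mem
  zero_mem' := θ.isClosedIdeal_dom.zero_mem
  smul_mem' := fun c _ hx => θ.isClosedIdeal_dom.smul_mem c hx
  mul_mem' := fun {a _} _ hb => θ.isClosedIdeal_dom.mul_mem_left a hb
  star_mem' := star_mem_dom

/-- The domain is a C*-algebra and θ a *-homomorphism on it, hence contractive; applied also to the
inverse, this makes θ isometric and so continuous on its domain. -/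
lemma norm_app_le {b : B} (hb : b ∈ θ.dom) : ‖θ.app b‖ ≤ ‖b‖ := by
  have : IsClosed (θ.domAlg : Set B) := θ.isClosedIdeal_dom.isClosed
  let f : θ.domAlg →⋆ₙₐ[ℂ] B :=
    { toFun := fun x => θ.app x
      map_smul' := fun z x => app_smul z x.2
      map_zero' := app_zero
      map_add' := fun x y => app_add x.2 y.2
      map_mul' := fun x y => app_mul x.2 y.2
      map_star' := fun x => app_star x.2 }
  exact NonUnitalStarAlgHom.norm_apply_le f ⟨b, hb⟩

lemma norm_app {b : B} (hb : b ∈ θ.dom) : ‖θ.app b‖ = ‖b‖ := by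
  refine le_antisymm (norm_app_le hb) ?_
  have h := norm_app_le (θ := θ.symm) (b := θ.app b) (by rw [dom_symm]; exact app_mem_img hb)
  rwa [symm_app_app hb] at h

lemma tendsto_app {ι : Type*} {l : Filter ι} {f : ι → B} {x : B} (hf : ∀ i, f i ∈ θ.dom)
    (hx : x ∈ θ.dom) (h : Tendsto f l (𝓝 x)) : Tendsto (fun i => θ.app (f i)) l (𝓝 (θ.app x)) := by
  rw [tendsto_iff_norm_sub_tendsto_zero] at h ⊢
  refine h.congr fun i => ?_
  rw [← app_sub (hf i) hx, norm_app (θ.isClosedIdeal_dom.sub_mem (hf i) hx)]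

variable (θ) in
lemma exists_isAU_dom : ∃ l : Filter {x : θ.domAlg // ‖x‖ ≤ 1 ∧ IsSelfAdjoint x},
    IsAU θ.dom l fun x => (x.1 : B) :=
  exists_isAU θ.domAlg θ.isClosedIdeal_dom.isClosed

end PAut

lemma IsAU.app {B : Type*} [NonUnitalCStarAlgebra B] {θ : PAut B} {ι : Type*} {l : Filter ι}
    {e : ι → B} (h : IsAU θ.dom l e) : IsAU θ.img l fun i => θ.app (e i) where
  neBot := h.neBot
  mem i := PAut.app_mem_img (h.mem i)
  norm_le i := (PAut.norm_app_le (h.mem i)).trans (h.norm_le i)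
  star_eq i := by rw [← PAut.app_star (h.mem i), h.star_eq]
  mul_right x hx := by
    have hd := PAut.symm_app_mem_dom hx
    have h1 := PAut.tendsto_app (fun i => θ.isClosedIdeal_dom.mul_mem_right (e i) hd) hd
      (h.mul_right _ hd)
    rw [PAut.app_symm_app hx] at h1
    refine h1.congr fun i => ?_
    rw [PAut.app_mul hd (h.mem i), PAut.app_symm_app hx]
  mul_left x hx := by
    have hd := PAut.symm_app_mem_dom hx
    have h1 := PAut.tendsto_app (fun i => θ.isClosedIdeal_dom.mul_mem_left (e i) hd) hd
      (h.mul_left _ hd)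
    rw [PAut.app_symm_app hx] at h1
    refine h1.congr fun i => ?_
    rw [PAut.app_mul (h.mem i) hd, PAut.app_symm_app hx]

/-- An element of an ideal commuting with the ideal is central. -/
lemma IsAU.central_of_commute_ideal {B : Type*} [NonUnitalCStarAlgebra B] {I : Set B}
    (hI : IsClosedIdeal I) {ι : Type*} {l : Filter ι} {e : ι → B} (he : IsAU I l e) {z : B}
    (hz : z ∈ I) (h : ∀ d ∈ I, z * d = d * z) (x : B) : z * x = x * z := by
  have := he.neBot
  -- Both zx = lim z x e_i and lim x e_i z = xz; the two nets agree because x e_i lies in I and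
  -- commutes with z.
  have h1 := he.mul_right _ (hI.mul_mem_right x hz)
  refine tendsto_nhds_unique h1 (Tendsto.congr (fun i => ?_) ((he.mul_left z hz).const_mul x))
  rw [mul_assoc, h _ (hI.mul_mem_left x (he.mem i)), mul_assoc]

/-! ### Homogeneous elements of a bimodule and their inner products -/

section HomogeneousElements

variable {B : Type*} [NonUnitalCStarAlgebra B] [PartialOrder B] [StarOrderedRing B]
variable {E : Type*} [NormedAddCommGroup E] [NormedSpace ℂ E] [SMul Bᵐᵒᵖ E] [CStarModule Bᵐᵒᵖ E]

lemma rsmul_mul (ξ : E) (a b : B) : ξ <• (a * b) = (ξ <• a) <• b :=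
  ext_ip (B := B) fun ζ => by simp only [ip_rsmul_right, mul_assoc]

lemma add_rsmul (ξ η : E) (b : B) : (ξ + η) <• b = ξ <• b + η <• b := by
  simp only [← rmul_apply, map_add, _root_.add_apply]

lemma smul_rsmul (z : ℂ) (ξ : E) (b : B) : (z • ξ) <• b = z • (ξ <• b) := by
  simp only [← rmul_apply, map_smul, _root_.smul_apply]

lemma tendsto_rsmul {ι : Type*} {l : Filter ι} {f : ι → E} {g : ι → B} {ξ : E} {b : B}
    (hf : Tendsto f l (𝓝 ξ)) (hg : Tendsto g l (𝓝 b)) :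
    Tendsto (fun i => f i <• g i) l (𝓝 (ξ <• b)) :=
  ((rmul B E).continuous₂.tendsto (ξ, b)).comp (hf.prodMk_nhds hg)

variable (B E) in
/-- The inner product as a bounded map, for a fixed left entry. -/
def bra (ξ : E) : E →L[ℂ] B :=
  LinearMap.mkContinuous
    { toFun := fun η => ip B ξ η
      map_add' := fun η η' => ip_add_right ξ η η'
      map_smul' := fun c η => ip_smul_right c ξ η } ‖ξ‖ fun η => norm_ip_le ξ η

@[simp] lemma bra_apply (ξ η : E) : bra B E ξ η = ip B ξ η := rfl

lemma ip_sub_right (ξ η η' : E) : ip B ξ (η - η') = ip B ξ η - ip B ξ η' := by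
  simp [ip]

lemma ip_sub_left (ξ ξ' η : E) : ip B (ξ - ξ') η = ip B ξ η - ip B ξ' η := by
  simp [ip]

lemma tendsto_ip_right {ι : Type*} {l : Filter ι} {f : ι → E} {ξ : E} (η : E)
    (hf : Tendsto f l (𝓝 ξ)) : Tendsto (fun i => ip B η (f i)) l (𝓝 (ip B η ξ)) :=
  ((bra B E η).continuous.tendsto ξ).comp hf

lemma tendsto_ip_left {ι : Type*} {l : Filter ι} {f : ι → E} {ξ : E} (η : E)
    (hf : Tendsto f l (𝓝 ξ)) : Tendsto (fun i => ip B (f i) η) l (𝓝 (ip B ξ η)) := by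
  have h := (continuous_star.tendsto _).comp (tendsto_ip_right (B := B) η hf)
  simpa only [Function.comp_def, star_ip] using h

lemma tendsto_of_tendsto_ip_self {ι : Type*} {l : Filter ι} {f : ι → E} {ξ : E}
    (h : Tendsto (fun i => ip B (f i - ξ) (f i - ξ)) l (𝓝 0)) : Tendsto f l (𝓝 ξ) := by
  rw [tendsto_iff_norm_sub_tendsto_zero]
  have h1 := (continuous_norm.tendsto _).comp h
  have h2 := (Real.continuous_sqrt.tendsto _).comp h1
  rw [norm_zero, Real.sqrt_zero] at h2
  refine h2.congr fun i => ?_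
  simp only [Function.comp_apply, ← norm_sq_eq_ip, Real.sqrt_sq (norm_nonneg _)]

lemma IsAU.tendsto_rsmul {S : Set B} {ι : Type*} {l : Filter ι} {e : ι → B} (h : IsAU S l e) {ξ : E}
    (hξ : ξ ∈ clspan {x : E | ∃ (η : E), ∃ d ∈ S, x = η <• d}) :
    Tendsto (fun i => ξ <• e i) l (𝓝 ξ) := by
  refine tendsto_of_mem_clspan (T := fun i => (rmul B E).flip (e i)) (C := 1) (fun i => ?_) ?_ hξ
  · refine opNorm_le_bound _ zero_le_one fun x => ?_
    rw [one_mul]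
    exact (norm_rsmul_le _ _).trans (mul_le_of_le_one_right (norm_nonneg _) (h.norm_le i))
  · rintro _ ⟨η, d, hd, rfl⟩
    refine Tendsto.congr (fun i => ?_) (HomMod.tendsto_rsmul (tendsto_const_nhds (x := η))
      (h.mul_right d hd))
    exact rsmul_mul η d (e i)

/-- If `⟨ξ | ξ⟩` is approximately unaltered by a self-adjoint approximate unit, so is `ξ`. -/
lemma IsAU.tendsto_rsmul_of_ip_self {S : Set B} {ι : Type*} {l : Filter ι} {e : ι → B}
    (h : IsAU S l e) {ξ : E} (hξ : ip B ξ ξ ∈ S) : Tendsto (fun i => ξ <• e i) l (𝓝 ξ) := by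
  refine tendsto_of_tendsto_ip_self (B := B) ?_
  have h1 : Tendsto (fun i => ip B ξ ξ * e i - ip B ξ ξ) l (𝓝 0) := by
    simpa using (h.mul_right _ hξ).sub_const (ip B ξ ξ)
  -- With p = ⟨ξ|ξ⟩, the inner square of ξe - ξ is e(pe - p) - (pe - p); each of the two terms
  -- contributes at most ‖pe - p‖.
  refine squeeze_zero_norm (a := fun i => 2 * ‖ip B ξ ξ * e i - ip B ξ ξ‖) (fun i => ?_)
    (by simpa using (h1.norm.const_mul 2))
  have e1 : ip B (ξ <• e i - ξ) (ξ <• e i - ξ)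
      = star (e i) * (ip B ξ ξ * e i - ip B ξ ξ) - (ip B ξ ξ * e i - ip B ξ ξ) := by
    simp only [ip_sub_left, ip_sub_right, ip_rsmul_left, ip_rsmul_right, mul_sub]
    noncomm_ring
  rw [e1]
  have h2 : ‖star (e i) * (ip B ξ ξ * e i - ip B ξ ξ)‖ ≤ ‖ip B ξ ξ * e i - ip B ξ ξ‖ := by
    refine (norm_mul_le _ _).trans (mul_le_of_le_one_left (norm_nonneg _) ?_)
    rw [norm_star]; exact h.norm_le i
  refine (norm_sub_le _ _).trans ?_
  linarith

lemma mem_clspan_rsmul {I : Set B} {ι : Type*} {l : Filter ι} [l.NeBot] {e : ι → B}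
    (he : ∀ i, e i ∈ I) {ξ : E} (h : Tendsto (fun i => ξ <• e i) l (𝓝 ξ)) :
    ξ ∈ clspan {x : E | ∃ (η : E), ∃ d ∈ I, x = η <• d} :=
  (isClosed_clspan _).mem_of_tendsto h
    (Eventually.of_forall fun i => subset_clspan _ ⟨ξ, e i, he i, rfl⟩)

/-- A right Hilbert module is nondegenerate. -/
lemma clspan_rsmul_eq_top : clspan {x : E | ∃ (η : E) (d : B), x = η <• d} = ⊤ := by
  obtain ⟨l, hl⟩ := exists_isAU (⊤ : NonUnitalStarSubalgebra ℂ B) isClosed_top_subalgebra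
  have := hl.neBot
  refine eq_top_iff.mpr fun ξ _ => ?_
  have h := mem_clspan_rsmul hl.mem (hl.tendsto_rsmul_of_ip_self (ξ := ξ) trivial)
  refine clspan_mono ?_ h
  rintro _ ⟨η, d, -, rfl⟩
  exact ⟨η, d, rfl⟩

variable [LeftAction B E]

/-- An operator with an adjoint is automatically a module map. -/
lemma lact_rsmul (b c : B) (ξ : E) : lact b (ξ <• c) = lact b ξ <• c :=
  ext_ip (B := B) fun ζ => by
    have h (η : E) : ip B ζ (lact b η) = ip B (lact (star b) ζ) η := by
      rw [LeftAction.ip_lact, star_star]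
    rw [h, ip_rsmul_right, ip_rsmul_right, h]

lemma ip_lact_right (b : B) (ξ η : E) : ip B ξ (lact b η) = ip B (lact (star b) ξ) η := by
  rw [LeftAction.ip_lact, star_star]

@[simp] lemma lact_self (b c : B) : lact b c = b * c := rfl

@[simp] lemma rsmul_self (b c : B) : b <• c = b * c := rfl

lemma tendsto_lact {ι : Type*} {l : Filter ι} {f : ι → B} {g : ι → E} {b : B} {ξ : E}
    (hf : Tendsto f l (𝓝 b)) (hg : Tendsto g l (𝓝 ξ)) :
    Tendsto (fun i => lact (f i) (g i)) l (𝓝 (lact b ξ)) :=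
  ((lact (B := B) (E := E)).continuous₂.tendsto (b, ξ)).comp (hf.prodMk_nhds hg)

lemma IsAU.tendsto_lact {S : Set B} {ι : Type*} {l : Filter ι} {e : ι → B} (h : IsAU S l e) {ξ : E}
    (hξ : ξ ∈ clspan {x : E | ∃ d ∈ S, ∃ η : E, x = lact d η}) :
    Tendsto (fun i => lact (e i) ξ) l (𝓝 ξ) := by
  refine tendsto_of_mem_clspan (T := fun i => lact (B := B) (E := E) (e i))
    (C := ‖lact (B := B) (E := E)‖) (fun i => ?_) ?_ hξ
  · exact (le_opNorm _ _).trans (mul_le_of_le_one_right (norm_nonneg _) (h.norm_le i))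
  · rintro _ ⟨d, hd, η, rfl⟩
    refine Tendsto.congr (fun i => ?_) (HomMod.tendsto_lact (h.mul_left d hd)
      (tendsto_const_nhds (x := η)))
    exact LeftAction.lact_mul _ _ _

variable {θ : PAut B}

lemma homog.rsmul_eq {ξ : E} (hξ : ξ ∈ homog E θ) {b : B} (hb : b ∈ θ.dom) :
    ξ <• b = lact (θ.app b) ξ :=
  hξ.2 b _ (PAut.app_mem_map hb)

lemma homog.tendsto_rsmul {ξ : E} (hξ : ξ ∈ homog E θ) {ι : Type*} {l : Filter ι} {e : ι → B}
    (h : IsAU θ.dom l e) : Tendsto (fun i => ξ <• e i) l (𝓝 ξ) :=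
  h.tendsto_rsmul hξ.1

lemma homog.tendsto_lact {ξ : E} (hξ : ξ ∈ homog E θ) {ι : Type*} {l : Filter ι} {e : ι → B}
    (h : IsAU θ.dom l e) : Tendsto (fun i => lact (θ.app (e i)) ξ) l (𝓝 ξ) :=
  (homog.tendsto_rsmul hξ h).congr fun i => homog.rsmul_eq hξ (h.mem i)

lemma mem_homog {ξ : E} (h : ξ ∈ clspan {x : E | ∃ (η : E), ∃ d ∈ θ.dom, x = η <• d})
    (h' : ∀ d ∈ θ.dom, ξ <• d = lact (θ.app d) ξ) : ξ ∈ homog E θ :=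
  ⟨h, fun b c hc => by rw [h' b (PAut.mem_dom hc), PAut.app_eq hc]⟩

variable (E θ) in
/-- The `θ`-homogeneous elements as a subspace. -/
def homogSub : Submodule ℂ E where
  carrier := homog E θ
  add_mem' := fun hξ hη => ⟨add_mem hξ.1 hη.1, fun b c hc => by
    rw [add_rsmul, hξ.2 b c hc, hη.2 b c hc, map_add]⟩
  zero_mem' := ⟨zero_mem _, fun b c _ => by
    rw [map_zero, ← rmul_apply, map_zero, _root_.zero_apply]⟩
  smul_mem' := fun z ξ hξ => ⟨Submodule.smul_mem _ z hξ.1, fun b c hc => by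
    rw [smul_rsmul, hξ.2 b c hc, map_smul]⟩

@[simp] lemma mem_homogSub {ξ : E} : ξ ∈ homogSub E θ ↔ ξ ∈ homog E θ := Iff.rfl

/-- With e_i an approximate unit of the closed ideal Dom(θ), ξ = lim ξe_i and ⟨η|ξe_i⟩ = ⟨η|ξ⟩e_i
stays in the ideal. -/
lemma homog.ip_mem_dom {ξ : E} (hξ : ξ ∈ homog E θ) (η : E) : ip B η ξ ∈ θ.dom := by
  obtain ⟨l, hl⟩ := θ.exists_isAU_dom
  have := hl.neBot
  refine θ.isClosedIdeal_dom.mem_of_tendsto (fun i => ?_)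
    (tendsto_ip_right η (homog.tendsto_rsmul hξ hl))
  rw [ip_rsmul_right]
  exact θ.isClosedIdeal_dom.mul_mem_left _ (hl.mem i)

lemma homog.ip_mem_dom' {ξ : E} (hξ : ξ ∈ homog E θ) (η : E) : ip B ξ η ∈ θ.dom := by
  rw [← star_ip]; exact PAut.star_mem_dom (homog.ip_mem_dom hξ η)

/-- `θ ⟨η | b ξ⟩ = θ(⟨η | ξ⟩) b` for `θ`-homogeneous `ξ`. -/
lemma homog.app_ip_lact {ξ : E} (hξ : ξ ∈ homog E θ) (η : E) (b : B) :
    θ.app (ip B η (lact b ξ)) = θ.app (ip B η ξ) * b := by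
  obtain ⟨l, hl⟩ := θ.exists_isAU_dom
  have := hl.neBot
  have hm (c : B) : ip B η (lact c ξ) ∈ θ.dom := by
    rw [ip_lact_right]; exact homog.ip_mem_dom hξ _
  have hip := homog.ip_mem_dom hξ η
  -- The element b itself cannot be moved across ξ, but bθ(e_i) lies in Img(θ) and can: bθ(e_i)ξ = ξ
  -- θ⁻¹(bθ(e_i)). Applying θ to the inner product gives θ(⟨η|ξ⟩)bθ(e_i), and both sides converge.
  have h1 : Tendsto (fun i => ip B η (lact (b * θ.app i.1.1) ξ))
    l (𝓝 (ip B η (lact b ξ))) := by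
    simp only [LeftAction.lact_mul]
    exact tendsto_ip_right η (HomMod.tendsto_lact tendsto_const_nhds (homog.tendsto_lact hξ hl))
  have h2 := PAut.tendsto_app (fun i => hm _) (hm b) h1
  refine tendsto_nhds_unique h2 (Tendsto.congr (fun i => ?_) (hl.app.mul_right _
    (θ.isClosedIdeal_img.mul_mem_right b (PAut.app_mem_img hip))))
  have h3 : b * θ.app i.1 ∈ θ.img := θ.isClosedIdeal_img.mul_mem_left b (hl.app.mem i)
  have h4 := PAut.symm_app_mem_dom h3
  have h5 := homog.rsmul_eq hξ h4
  rw [PAut.app_symm_app h3] at h5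
  rw [← h5, ip_rsmul_right, PAut.app_mul hip h4, PAut.app_symm_app h3, mul_assoc]

/-- `θ ⟨b ξ | η⟩ = b* θ(⟨ξ | η⟩)` for `θ`-homogeneous `ξ`. -/
lemma homog.app_ip_lact' {ξ : E} (hξ : ξ ∈ homog E θ) (η : E) (b : B) :
    θ.app (ip B (lact b ξ) η) = star b * θ.app (ip B ξ η) := by
  have hm : ip B η (lact b ξ) ∈ θ.dom := by
    rw [ip_lact_right]; exact homog.ip_mem_dom hξ _
  have h := congrArg star (homog.app_ip_lact hξ η b)
  rwa [← PAut.app_star hm, star_ip, star_mul, ← PAut.app_star (homog.ip_mem_dom hξ η),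
    star_ip] at h

/-- For d in Dom(θ), ⟨ξ|η⟩d = ⟨ξ|θ(d)η⟩ = ⟨θ(d*)ξ|η⟩ = ⟨ξd*|η⟩ = d⟨ξ|η⟩. An element of an ideal that
commutes with the ideal is central. -/
lemma homog.ip_self_mul {ξ : E} (hξ : ξ ∈ homog E θ) {η : E} (hη : η ∈ homog E θ) (b : B) :
    ip B ξ η * b = b * ip B ξ η := by
  obtain ⟨l, hl⟩ := θ.exists_isAU_dom
  refine hl.central_of_commute_ideal θ.isClosedIdeal_dom (homog.ip_mem_dom hη ξ) (fun d hd => ?_) b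
  have hd' := PAut.star_mem_dom hd
  rw [← ip_rsmul_right, homog.rsmul_eq hη hd, ip_lact_right, ← PAut.app_star hd,
    ← homog.rsmul_eq hξ hd', ip_rsmul_left, star_star]

/-- Applying θ to the previous commutation shows that θ⟨ξ|η⟩ commutes with Img(θ), in which it lies.
-/
lemma homog.app_ip_self_mul {ξ : E} (hξ : ξ ∈ homog E θ) {η : E} (hη : η ∈ homog E θ) (b : B) :
    θ.app (ip B ξ η) * b = b * θ.app (ip B ξ η) := by
  obtain ⟨l, hl⟩ := θ.exists_isAU_dom
  have hip := homog.ip_mem_dom hη ξ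
  refine hl.app.central_of_commute_ideal θ.isClosedIdeal_img (PAut.app_mem_img hip)
    (fun d hd => ?_) b
  have hd' := PAut.symm_app_mem_dom hd
  have h := congrArg θ.app (homog.ip_self_mul hξ hη (θ.symm.app d))
  rwa [PAut.app_mul hip hd', PAut.app_mul hd' hip, PAut.app_symm_app hd] at h

lemma homog.mem_img_span {ξ : E} (hξ : ξ ∈ homog E θ) :
    ξ ∈ clspan {x : E | ∃ c ∈ θ.img, ∃ η : E, x = lact c η} := by
  obtain ⟨l, hl⟩ := θ.exists_isAU_dom
  have := hl.neBot
  exact (isClosed_clspan _).mem_of_tendsto (homog.tendsto_lact hξ hl)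
    (Eventually.of_forall fun i => subset_clspan _ ⟨_, hl.app.mem i, ξ, rfl⟩)

/-- Multiplication by a central element preserves homogeneity. -/
lemma homog.lact_central {ξ : E} (hξ : ξ ∈ homog E θ) {z : B} (hz : ∀ b, z * b = b * z) :
    lact z ξ ∈ homog E θ := by
  obtain ⟨l, hl⟩ := θ.exists_isAU_dom
  have := hl.neBot
  refine mem_homog (mem_clspan_rsmul (l := l) hl.mem ?_) fun d hd => ?_
  · simp only [← lact_rsmul]
    exact HomMod.tendsto_lact tendsto_const_nhds (homog.tendsto_rsmul hξ hl)
  · rw [← lact_rsmul, homog.rsmul_eq hξ hd, ← LeftAction.lact_mul, hz, LeftAction.lact_mul]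

/-- Central elements are homogeneous for the identity. -/
lemma homog_id_of_central {z : B} (hz : ∀ b, z * b = b * z) : z ∈ homog B (PAut.id B) := by
  obtain ⟨l, hl⟩ := exists_isAU (⊤ : NonUnitalStarSubalgebra ℂ B) isClosed_top_subalgebra
  have := hl.neBot
  refine mem_homog (mem_clspan_rsmul (l := l) (e := fun i => (i.1 : B)) (fun i => PAut.mem_dom_id _)
    (hl.mul_right z trivial)) fun d _ => ?_
  rw [PAut.app_eq (PAut.mem_id_map.mpr rfl)]
  exact hz d

/-! ### Products of homogeneous elements -/

variable {θ' τ : PAut B}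

lemma PAut.mem_comp {θ θ' τ : PAut B} (h : PAut.IsComp θ θ' τ) {b c : B} :
    c ∈ τ.map b ↔ ∃ a, a ∈ θ'.map b ∧ c ∈ θ.map a := by
  rw [h, PEquiv.mem_trans]

lemma PAut.comp_dom {θ θ' τ : PAut B} (h : PAut.IsComp θ θ' τ) {b : B} (hb : b ∈ τ.dom) :
    b ∈ θ'.dom ∧ θ'.app b ∈ θ.dom ∧ τ.app b = θ.app (θ'.app b) := by
  obtain ⟨a, ha, ha'⟩ := (PAut.mem_comp h).mp (PAut.app_mem_map hb)
  rw [PAut.app_eq ha]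
  exact ⟨PAut.mem_dom ha, PAut.mem_dom ha', (PAut.app_eq ha').symm⟩

lemma PAut.symm_app_mem_comp_dom {θ θ' τ : PAut B} (h : PAut.IsComp θ θ' τ) {b : B} (hb : b ∈ θ.dom)
    (hb' : b ∈ θ'.img) : θ'.symm.app b ∈ τ.dom := by
  have h1 : b ∈ θ'.map (θ'.symm.app b) := by
    have h2 := PAut.app_mem_map (PAut.symm_app_mem_dom hb')
    rwa [PAut.app_symm_app hb'] at h2
  exact PAut.mem_dom ((PAut.mem_comp h).mpr ⟨b, h1, PAut.app_mem_map hb⟩)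

/-- The delicate point is ξb ∈ [E Dom(τ)]. Approximate ξb by ξe_i θ'(e'_j)b with approximate units
of Dom(θ) and Dom(θ'). The element e_i θ'(e'_j) lies in Dom(θ) ∩ Img(θ'), so it moves through b to
the right and becomes an element of Dom(τ). -/
lemma homog.rsmul_mem {ξ : E} (hξ : ξ ∈ homog E θ) {b : B} (hb : b ∈ homog B θ')
    (h : PAut.IsComp θ θ' τ) : ξ <• b ∈ homog E τ := by
  obtain ⟨l, hl⟩ := θ.exists_isAU_dom
  obtain ⟨l', hl'⟩ := θ'.exists_isAU_dom
  have := hl.neBot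
  have := hl'.neBot
  refine mem_homog ?_ fun d hd => ?_
  · refine (isClosed_clspan _).mem_of_tendsto (b := l)
      (HomMod.tendsto_rsmul (homog.tendsto_rsmul hξ hl) (tendsto_const_nhds (x := b)))
      (Eventually.of_forall fun i => ?_)
    refine (isClosed_clspan _).mem_of_tendsto (b := l')
      (HomMod.tendsto_rsmul (tendsto_const_nhds (x := ξ <• (i.1 : B)))
      (homog.tendsto_lact hb hl')) (Eventually.of_forall fun j => subset_clspan _ ?_)
    have h1 := θ.isClosedIdeal_dom.mul_mem_right (θ'.app j.1) (hl.mem i)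
    have h2 := θ'.isClosedIdeal_img.mul_mem_left (i.1 : B) (hl'.app.mem j)
    refine ⟨ξ <• b, _, PAut.symm_app_mem_comp_dom h h1 h2, ?_⟩
    have h3 := homog.rsmul_eq hb (PAut.symm_app_mem_dom h2)
    rw [PAut.app_symm_app h2, rsmul_self] at h3
    rw [← rsmul_mul ξ b, h3, lact_self, lact_self, ← rsmul_mul, mul_assoc]
  · obtain ⟨h1, h2, h3⟩ := PAut.comp_dom h hd
    have h4 := homog.rsmul_eq hb h1
    rw [rsmul_self, lact_self] at h4
    rw [← rsmul_mul, h4, rsmul_mul, homog.rsmul_eq hξ h2, h3, lact_rsmul]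

/-- The same double approximation works, with e_i θ'(e'_j) now placed between b and ξ and moved
through ξ. -/
lemma homog.lact_mem {b : B} (hb : b ∈ homog B θ) {ξ : E} (hξ : ξ ∈ homog E θ')
    (h : PAut.IsComp θ θ' τ) : lact b ξ ∈ homog E τ := by
  obtain ⟨l, hl⟩ := θ.exists_isAU_dom
  obtain ⟨l', hl'⟩ := θ'.exists_isAU_dom
  have := hl.neBot
  have := hl'.neBot
  refine mem_homog ?_ fun d hd => ?_
  · refine (isClosed_clspan _).mem_of_tendsto (b := l)
      (HomMod.tendsto_lact (homog.tendsto_rsmul hb hl) (tendsto_const_nhds (x := ξ)))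
      (Eventually.of_forall fun i => ?_)
    refine (isClosed_clspan _).mem_of_tendsto (b := l')
      (HomMod.tendsto_lact (tendsto_const_nhds (x := b <• (i.1 : B)))
      (homog.tendsto_lact hξ hl')) (Eventually.of_forall fun j => subset_clspan _ ?_)
    have h1 := θ.isClosedIdeal_dom.mul_mem_right (θ'.app j.1) (hl.mem i)
    have h2 := θ'.isClosedIdeal_img.mul_mem_left (i.1 : B) (hl'.app.mem j)
    refine ⟨lact b ξ, _, PAut.symm_app_mem_comp_dom h h1 h2, ?_⟩
    have h3 := homog.rsmul_eq hξ (PAut.symm_app_mem_dom h2)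
    rw [PAut.app_symm_app h2] at h3
    rw [← lact_rsmul, h3, rsmul_self, ← LeftAction.lact_mul, ← LeftAction.lact_mul, mul_assoc]
  · obtain ⟨h1, h2, h3⟩ := PAut.comp_dom h hd
    have h4 := homog.rsmul_eq hb h2
    rw [rsmul_self, lact_self] at h4
    rw [← lact_rsmul, homog.rsmul_eq hξ h1, ← LeftAction.lact_mul, h4, h3, LeftAction.lact_mul]

/-! ### Homogeneous elements of B itself -/

section Self

variable {b : B}

lemma homog.mul_eq (hb : b ∈ homog B θ) {d : B} (hd : d ∈ θ.dom) : b * d = θ.app d * b :=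
  homog.rsmul_eq hb hd

lemma homog.star_mul_eq (hb : b ∈ homog B θ) {d : B} (hd : d ∈ θ.dom) :
    star b * θ.app d = d * star b := by
  have h := congrArg star (homog.mul_eq hb (PAut.star_mem_dom hd))
  rwa [star_mul, star_mul, star_star, PAut.app_star hd, star_star, eq_comm] at h

lemma homog.mem_dom (hb : b ∈ homog B θ) : b ∈ θ.dom := by
  obtain ⟨l, hl⟩ := θ.exists_isAU_dom
  have := hl.neBot
  exact θ.isClosedIdeal_dom.mem_of_tendsto
    (fun i => θ.isClosedIdeal_dom.mul_mem_left b (hl.mem i)) (homog.tendsto_rsmul hb hl)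

lemma homog.mem_img (hb : b ∈ homog B θ) : b ∈ θ.img := by
  obtain ⟨l, hl⟩ := θ.exists_isAU_dom
  have := hl.neBot
  exact θ.isClosedIdeal_img.mem_of_tendsto
    (fun i => θ.isClosedIdeal_img.mul_mem_right b (hl.app.mem i)) (homog.tendsto_lact hb hl)

lemma homog.star_mem (hb : b ∈ homog B θ) : star b ∈ homog B θ.symm := by
  obtain ⟨l, hl⟩ := θ.exists_isAU_dom
  have := hl.neBot
  refine mem_homog (mem_clspan_rsmul (l := l) (e := fun i => θ.app i.1) (fun i => ?_)
    (hl.app.mul_right _ (PAut.star_mem_img (homog.mem_img hb)))) fun d hd => ?_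
  · rw [PAut.dom_symm]; exact hl.app.mem i
  · rw [PAut.dom_symm] at hd
    have h := homog.star_mul_eq hb (PAut.symm_app_mem_dom hd)
    rwa [PAut.app_symm_app hd] at h

lemma homog.star_mul_self_comm (hb : b ∈ homog B θ) {d : B} (hd : d ∈ θ.dom) :
    star b * b * d = d * (star b * b) := by
  rw [mul_assoc, homog.mul_eq hb hd, ← mul_assoc, homog.star_mul_eq hb hd, mul_assoc]

lemma homog.mul_star_self_comm (hb : b ∈ homog B θ) {d : B} (hd : d ∈ θ.img) :
    b * star b * d = d * (b * star b) := by
  have h := homog.star_mul_self_comm (homog.star_mem hb) (d := d) (by rwa [PAut.dom_symm])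
  rwa [star_star] at h

/-- A self-adjoint element with square zero vanishes, by the C*-identity. -/
lemma eq_of_mul_self_eq {p q : B} (hp : star p = p) (hq : star q = q)
    (h : (p - q) * (p - q) = 0) : p = q := by
  refine sub_eq_zero.mp ((CStarRing.star_mul_self_eq_zero_iff (p - q)).mp ?_)
  rwa [star_sub, hp, hq]

/-- Homogeneous elements of `B` are normal. -/
lemma homog.star_mul_self_eq (hb : b ∈ homog B θ) : star b * b = b * star b := by
  have h1 : star b * b * b = b * (star b * b) := homog.star_mul_self_comm hb (homog.mem_dom hb)
  have h2 : b * star b * b = b * (b * star b) := homog.mul_star_self_comm hb (homog.mem_img hb)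
  have h3 := homog.star_mul_self_comm hb
    (θ.isClosedIdeal_dom.mul_mem_right (star b) (homog.mem_dom hb))
  -- With p = b*b and q = bb*, one gets p² = pq = q² and pq = qp, so (p - q)² = 0.
  have e1 : star b * b * (star b * b) = star b * b * (b * star b) := by
    rw [mul_assoc, ← mul_assoc b, h2, ← mul_assoc]
  have e2 : b * star b * (b * star b) = star b * b * (b * star b) := by
    rw [mul_assoc, ← mul_assoc (star b), ← mul_assoc, ← h1, mul_assoc]
  refine eq_of_mul_self_eq (by simp) (by simp) ?_
  rw [sub_mul, mul_sub, mul_sub, e1, e2, ← h3]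
  simp

/-- Write p = b*b and q = bb*. Homogeneity gives θ(p)q = b p b* = q². The same identity for θ⁻¹ and
b*, transported by θ, gives qθ(p) = θ(p)². Hence (θ(p) - q)² = 0. -/
lemma homog.app_star_mul_self (hb : b ∈ homog B θ) : θ.app (star b * b) = b * star b := by
  have hd := θ.isClosedIdeal_dom.mul_mem_left (star b) (homog.mem_dom hb)
  have h (θ : PAut B) {b : B} (hb : b ∈ homog B θ) :
      θ.app (star b * b) * (b * star b) = b * star b * (b * star b) := by
    rw [← mul_assoc, ← homog.mul_eq hb (θ.isClosedIdeal_dom.mul_mem_left _ (homog.mem_dom hb))]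
    simp only [mul_assoc]
  have h1 := h θ hb
  have hi := θ.isClosedIdeal_img.mul_mem_right (star b) (homog.mem_img hb)
  have h2 := congrArg θ.app (h θ.symm (homog.star_mem hb))
  have hdi := PAut.symm_app_mem_dom hi
  rw [star_star, PAut.app_mul hdi hd, PAut.app_mul hd hd, PAut.app_symm_app hi] at h2
  refine eq_of_mul_self_eq (by rw [← PAut.app_star hd]; simp) (by simp) ?_
  rw [sub_mul, mul_sub, mul_sub, h1, h2]
  simp

/-- A `θ`-homogeneous element of `B` is fixed by `θ`. -/
lemma homog.app_self (hb : b ∈ homog B θ) : θ.app b = b := by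
  have hd := homog.mem_dom hb
  have h1 := homog.star_mul_eq hb hd
  have h2 := congrArg star h1
  rw [star_mul, star_mul, star_star] at h2
  -- In the expansion of (θ(b) - b)*(θ(b) - b) all four products equal bb*.
  refine sub_eq_zero.mp ((CStarRing.star_mul_self_eq_zero_iff _).mp ?_)
  rw [star_sub, sub_mul, mul_sub, mul_sub, h1, h2, ← PAut.app_star hd,
    ← PAut.app_mul (PAut.star_mem_dom hd) hd, homog.app_star_mul_self hb,
    homog.star_mul_self_eq hb]
  simp

/-- Formally θ(xb) = θ(x)θ(b) = θ(x)b = bx. Since x need not lie in Dom(θ), it is replaced by xe_i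
with e_i an approximate unit of the domain. -/
lemma homog.app_mul_right (hb : b ∈ homog B θ) (x : B) : θ.app (x * b) = b * x := by
  obtain ⟨l, hl⟩ := θ.exists_isAU_dom
  have := hl.neBot
  have hd := homog.mem_dom hb
  have h1 : Tendsto (fun i => x * ((i.1 : B) * b)) l (𝓝 (x * b)) :=
    (hl.mul_left b hd).const_mul x
  have h2 := PAut.tendsto_app
    (fun i => θ.isClosedIdeal_dom.mul_mem_left x (θ.isClosedIdeal_dom.mul_mem_left _ hd))
    (θ.isClosedIdeal_dom.mul_mem_left x hd) h1
  refine tendsto_nhds_unique h2 (Tendsto.congr (fun i => ?_) (hl.mul_right _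
    (θ.isClosedIdeal_dom.mul_mem_right x hd)))
  have h3 := θ.isClosedIdeal_dom.mul_mem_left x (hl.mem i)
  rw [← mul_assoc x, PAut.app_mul h3 hd, homog.app_self hb, ← homog.mul_eq hb h3, mul_assoc]

end Self

/-! ### Homogeneity of the standard operators -/

lemma isAdjoint_ket (ξ : E) : IsAdjoint (PAut.id B) (ket B ξ) (bra B E ξ) := fun b η => by
  rw [PAut.mem_id_map]
  simp [ket, ip_rsmul_right, star_ip]

lemma isAdjoint_leftMul (b : B) :
    IsAdjoint (PAut.id B) (leftMul E b) (leftMul E (star b)) := fun ξ η => by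
  rw [PAut.mem_id_map, leftMul, leftMul, ip_lact_right]

/-- The defining relation is θ(⟨η|ξ⟩b) = b⟨η|ξ⟩, an instance of `homog.app_mul_right`. -/
lemma isAdjoint_rightMul {b : B} (hb : b ∈ homog B θ) :
    IsAdjoint θ.symm (rightMul E b) (rightMul E (star b)) := fun ξ η => by
  change ip B η (ξ <• b) ∈ θ.map.symm (ip B (η <• star b) ξ)
  rw [PEquiv.mem_iff_mem, ip_rsmul_right, ip_rsmul_left, star_star, ← homog.app_mul_right hb]
  exact PAut.app_mem_map (θ.isClosedIdeal_dom.mul_mem_left _ (homog.mem_dom hb))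

/-- The adjoint `η ↦ θ ⟨ξ | η⟩` of the operator `|ξ]` for a `θ`-homogeneous `ξ`. -/
def rbra {ξ : E} (hξ : ξ ∈ homog E θ) : E →L[ℂ] B :=
  LinearMap.mkContinuous
    { toFun := fun η => θ.app (ip B ξ η)
      map_add' := fun η η' => by
        rw [ip_add_right, PAut.app_add (homog.ip_mem_dom' hξ η) (homog.ip_mem_dom' hξ η')]
      map_smul' := fun c η => by
        rw [ip_smul_right, PAut.app_smul _ (homog.ip_mem_dom' hξ η)]; rfl } ‖ξ‖
    fun η => (PAut.norm_app_le (homog.ip_mem_dom' hξ η)).trans (norm_ip_le ξ η)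

@[simp] lemma rbra_apply {ξ : E} (hξ : ξ ∈ homog E θ) (η : E) :
    rbra hξ η = θ.app (ip B ξ η) := rfl

/-- The relation to check is θ⟨η|bξ⟩ = θ(⟨η|ξ⟩)b, which is `homog.app_ip_lact`. -/
lemma isAdjoint_rket {ξ : E} (hξ : ξ ∈ homog E θ) :
    IsAdjoint θ.symm (rket B ξ) (rbra hξ) := fun b η => by
  change ip B η (LeftAction.lact b ξ) ∈ θ.map.symm (ip B (rbra hξ η) b)
  rw [PEquiv.mem_iff_mem, rbra_apply, ip_self, ← PAut.app_star (homog.ip_mem_dom' hξ η), star_ip,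
    ← homog.app_ip_lact hξ]
  refine PAut.app_mem_map ?_
  rw [ip_lact_right]
  exact homog.ip_mem_dom hξ _

lemma isHomogeneous_ket {ξ : E} (hξ : ξ ∈ homog E θ) :
    IsHomogeneous θ (PAut.id B) (ket B ξ) where
  range_subset b := by
    refine map_mem_of_mem_clspan ((rmul B E).flip b) (isClosed_clspan _) ?_
      (homog.mem_img_span hξ)
    rintro _ ⟨c, hc, η, rfl⟩
    refine subset_clspan _ ⟨c, hc, η <• b, ?_⟩
    rw [lact_rsmul]; rfl
  map_lact a c hc b := by
    change ξ <• (a * b) = lact c (ξ <• b)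
    rw [rsmul_mul, hξ.2 a c hc, lact_rsmul]
  exists_adjoint := ⟨_, isAdjoint_ket ξ⟩

lemma isHomogeneous_rket {ξ : E} (hξ : ξ ∈ homog E θ) :
    IsHomogeneous (PAut.id B) θ.symm (rket B ξ) where
  range_subset b := subset_clspan _ ⟨b, PAut.mem_img_id b, ξ, rfl⟩
  map_lact a c hc b := by
    rw [PAut.mem_id_map] at hc
    subst hc
    exact LeftAction.lact_mul a b ξ
  exists_adjoint := ⟨_, isAdjoint_rket hξ⟩

lemma isHomogeneous_leftMul {b : B} (hb : b ∈ homog B θ) :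
    IsHomogeneous θ (PAut.id B) (leftMul E b) where
  range_subset ξ := subset_clspan _ ⟨b, homog.mem_img hb, ξ, rfl⟩
  map_lact a c hc ξ := by
    change lact b (lact a ξ) = lact c (lact b ξ)
    rw [← LeftAction.lact_mul, ← LeftAction.lact_mul]
    exact congrArg (fun x => lact x ξ) (hb.2 a c hc)
  exists_adjoint := ⟨_, isAdjoint_leftMul b⟩

lemma isHomogeneous_rightMul (hE : IsRightBimodule B E) {b : B} (hb : b ∈ homog B θ) :
    IsHomogeneous (PAut.id B) θ.symm (rightMul E b) where
  range_subset ξ := by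
    have h : clspan {x : E | ∃ c ∈ (PAut.id B).img, ∃ η : E, x = lact c η} = ⊤ := by
      refine eq_top_iff.mpr (hE.nondegenerate.symm.le.trans (clspan_mono ?_))
      rintro _ ⟨c, η, rfl⟩
      exact ⟨c, PAut.mem_img_id c, η, rfl⟩
    rw [h]
    trivial
  map_lact a c hc ξ := by
    rw [PAut.mem_id_map] at hc
    subst hc
    exact (lact_rsmul a b ξ).symm
  exists_adjoint := ⟨_, isAdjoint_rightMul hb⟩

end HomogeneousElements

/-! ### Elementary tensors in E ⊗_π K -/

section InternalTensor

variable {B : Type*} [NonUnitalCStarAlgebra B] [PartialOrder B] [StarOrderedRing B]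
variable {K : Type*} [NormedAddCommGroup K] [InnerProductSpace ℂ K] [CompleteSpace K]
variable {E : Type*} [NormedAddCommGroup E] [NormedSpace ℂ E] [SMul Bᵐᵒᵖ E] [CStarModule Bᵐᵒᵖ E]
variable (π : B →⋆ₙₐ[ℂ] (K →L[ℂ] K))

lemma ext_inner_tmul {x y : ITensor π E}
    (h : ∀ η ω, inner ℂ (tmul π η ω) x = inner ℂ (tmul π η ω) y) : x = y := by
  have h1 : innerSL ℂ x = innerSL ℂ y := ext_tmul π fun η ω => by
    rw [innerSL_apply_apply, innerSL_apply_apply, ← inner_conj_symm, h, inner_conj_symm]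
  refine ext_inner_right ℂ fun z => ?_
  have h2 := congrArg (fun f => f z) h1
  simpa only [innerSL_apply_apply] using h2

lemma tmul_rsmul (ξ : E) (b : B) (ζ : K) : tmul π (ξ <• b) ζ = tmul π ξ (π b ζ) :=
  ext_inner_tmul π fun η ω => by
    rw [inner_tmul_tmul, inner_tmul_tmul, ip_rsmul_right, map_mul]; rfl

/-- The inner products with elementary tensors see ζ only through π(⟨η|ξ⟩)ζ. This is what removes
partial isometries υ that act trivially only after multiplication by an ideal. -/
lemma tmul_congr {ξ : E} {ζ ζ' : K} (h : ∀ η : E, π (ip B η ξ) ζ = π (ip B η ξ) ζ') :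
    tmul π ξ ζ = tmul π ξ ζ' :=
  ext_inner_tmul π fun η ω => by rw [inner_tmul_tmul, inner_tmul_tmul, h]

/-- The elementary tensors as a bounded bilinear map. -/
def tmulL : E →L[ℂ] K →L[ℂ] ITensor π E :=
  LinearMap.mkContinuous₂ ((TensorProduct.mk ℂ E K).compr₂ (toITensor π)) 1
    fun ξ ζ => by rw [one_mul]; exact norm_tmul_le π ξ ζ

lemma add_tmul (ξ η : E) (ζ : K) : tmul π (ξ + η) ζ = tmul π ξ ζ + tmul π η ζ :=
  congrArg (fun f => f ζ) (map_add (tmulL π) ξ η)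

lemma smul_tmul (z : ℂ) (ξ : E) (ζ : K) : tmul π (z • ξ) ζ = z • tmul π ξ ζ :=
  congrArg (fun f => f ζ) (map_smul (tmulL π) z ξ)

lemma zero_tmul (ζ : K) : tmul π (0 : E) ζ = 0 :=
  congrArg (fun f => f ζ) (map_zero (tmulL (E := E) π))

lemma eq_top_of_tmul_mem {M : Submodule ℂ (ITensor π E)} (hM : IsClosed (M : Set (ITensor π E)))
    {S : Set E} (hS : clspan S = ⊤) (h : ∀ ξ ∈ S, ∀ ζ, tmul π ξ ζ ∈ M) : M = ⊤ := by
  have h1 : ∀ ξ ζ, tmul π ξ ζ ∈ M := fun ξ ζ =>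
    map_mem_of_mem_clspan ((tmulL π).flip ζ) hM (fun ξ hξ => h ξ hξ ζ)
      (hS ▸ Submodule.mem_top (x := ξ))
  refine eq_top_iff.mpr fun x _ => ?_
  have h2 : Set.range (toITensor (E := E) π) ⊆ M := by
    rintro _ ⟨y, rfl⟩
    induction y using TensorProduct.induction_on with
    | zero => rw [map_zero]; exact M.zero_mem
    | tmul ξ ζ => exact h1 ξ ζ
    | add y z hy hz => rw [map_add]; exact M.add_mem hy hz
  exact closure_minimal h2 hM (denseRange_toITensor π x)

end InternalTensor

lemma norm_le_of_adjoint_comp {H H' : Type*} [NormedAddCommGroup H] [InnerProductSpace ℂ H]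
    [CompleteSpace H] [NormedAddCommGroup H'] [InnerProductSpace ℂ H'] [CompleteSpace H']
    (T : H →L[ℂ] H') {C : ℝ} (hC : 0 ≤ C) (h : ‖adjoint T ∘L T‖ ≤ C ^ 2) : ‖T‖ ≤ C := by
  rw [ContinuousLinearMap.norm_adjoint_comp_self, ← sq] at h
  exact abs_le_of_sq_le_sq' h hC |>.2

/-! ### The partial isometries υ(θ) and the action of F on elementary tensors -/

namespace CovariantRep

variable {B : Type*} [NonUnitalCStarAlgebra B] [PartialOrder B] [StarOrderedRing B]
variable {K : Type*} [NormedAddCommGroup K] [InnerProductSpace ℂ K] [CompleteSpace K]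
variable {E : Type*} [NormedAddCommGroup E] [NormedSpace ℂ E] [SMul Bᵐᵒᵖ E] [CStarModule Bᵐᵒᵖ E]
  [LeftAction B E]
variable {F : Type*} [NormedAddCommGroup F] [NormedSpace ℂ F] [SMul Bᵐᵒᵖ F] [CStarModule Bᵐᵒᵖ F]
  [LeftAction B F]
variable {Θ : Set (PAut B)} (R : CovariantRep Θ K)

lemma inner_π_right (b : B) (x y : K) : inner ℂ x (R.π b y) = inner ℂ (R.π (star b) x) y := by
  rw [map_star, ContinuousLinearMap.star_eq_adjoint, ContinuousLinearMap.adjoint_inner_left]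

/-- This is the adjoint of `υ_adjoint_comp_self` for d*. -/
lemma π_υ_adjoint_υ (hΘ : IsInverseSemigroup Θ) {θ : PAut B} (hθ : θ ∈ Θ) {d : B}
    (hd : d ∈ θ.dom) (ζ : K) : R.π d (adjoint (R.υ θ) (R.υ θ ζ)) = R.π d ζ := by
  refine ext_inner_left ℂ fun x => ?_
  rw [inner_π_right, ContinuousLinearMap.adjoint_inner_right,
    ← ContinuousLinearMap.adjoint_inner_left,
    R.υ_adjoint_comp_self hΘ hθ (PAut.star_mem_dom hd), ← inner_π_right]

/-- Covariance in intertwining form; the factor υ(θ)*υ(θ) that arises is absorbed by π(d) because d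
lies in the domain. -/
lemma υ_π (hΘ : IsInverseSemigroup Θ) {θ : PAut B} (hθ : θ ∈ Θ) {d : B}
    (hd : d ∈ θ.dom) (ζ : K) : R.υ θ (R.π d ζ) = R.π (θ.app d) (R.υ θ ζ) := by
  rw [← R.covariant θ hθ d _ (PAut.app_mem_map hd)]
  change _ = R.υ θ (R.π d (adjoint (R.υ θ) (R.υ θ ζ)))
  rw [R.π_υ_adjoint_υ hΘ hθ hd]

lemma π_υ_υ_symm (hΘ : IsInverseSemigroup Θ) {θ : PAut B} (hθ : θ ∈ Θ) {d : B}
    (hd : d ∈ θ.img) (ζ : K) : R.π d (R.υ θ (R.υ θ.symm ζ)) = R.π d ζ := by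
  have h := R.π_υ_adjoint_υ hΘ (hΘ.symm_mem θ hθ) (d := d) (by rwa [PAut.dom_symm]) ζ
  rwa [R.υ_symm _ (hΘ.symm_mem θ hθ)] at h

/-- As π may be degenerate, υ(id) need not be the identity; it is the projection onto [π(B)K]. -/
lemma υ_id_π (hΘ : IsAdmissible Θ) (b : B) (ζ : K) :
    R.υ (PAut.id B) (R.π b ζ) = R.π b ζ := by
  have h1 := R.υ_adjoint_comp_self hΘ.inverseSemigroup hΘ.id_mem (PAut.mem_dom_id b) ζ
  have h2 := R.υ_comp _ hΘ.id_mem _ hΘ.id_mem _ hΘ.id_mem (PEquiv.refl_trans _).symm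
  rw [R.υ_symm _ hΘ.id_mem, PAut.id_symm] at h1
  have h3 := congrArg (fun f => f (R.π b ζ)) h2
  exact h3.symm.trans h1

lemma π_υ_id (hΘ : IsAdmissible Θ) (b : B) (ζ : K) :
    R.π b (R.υ (PAut.id B) ζ) = R.π b ζ := by
  have h := R.υ_π hΘ.inverseSemigroup hΘ.id_mem (PAut.mem_dom_id b) ζ
  rw [R.υ_id_π hΘ, PAut.app_eq (PAut.mem_id_map.mpr rfl)] at h
  exact h.symm

lemma tmul_υ_id (hΘ : IsAdmissible Θ) (ξ : E) (ζ : K) :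
    tmul R.π ξ (R.υ (PAut.id B) ζ) = tmul R.π ξ ζ :=
  tmul_congr R.π fun _ => R.π_υ_id hΘ _ ζ

/-- Only an ordinary adjoint of T is needed, no ρ-homogeneity, and υ(id) is invisible in the tensor.
So F(|ξ⟩) and F(l_b) are available for arbitrary ξ and b, where they depend linearly on them. -/
lemma mor_id_tmul (hΘ : IsAdmissible Θ) {T : E →L[ℂ] F} {S : F →L[ℂ] E}
    (h : IsAdjoint (PAut.id B) T S) (ξ : E) (ζ : K) :
    R.mor (PAut.id B) T (tmul R.π ξ ζ) = tmul R.π (T ξ) ζ := by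
  rw [← R.tmul_υ_id hΘ (T ξ)]
  refine amp_tmul_of_exists _ (exists_amp _ (S ∘L T) fun ξ ξ' ζ ζ' => ?_) ξ ζ
  rw [R.π_υ_id hΘ, ← PAut.mem_id_map.mp (h ξ' (T ξ)), inner_π_right, inner_π_right, R.π_υ_id hΘ]
  rfl

lemma adjoint_mor_id_tmul (hΘ : IsAdmissible Θ) {T : E →L[ℂ] F} {S : F →L[ℂ] E}
    (h : IsAdjoint (PAut.id B) T S) (η : F) (ω : K) :
    adjoint (R.mor (PAut.id B) T) (tmul R.π η ω) = tmul R.π (S η) ω :=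
  ext_inner_tmul R.π fun ξ ζ => by
    rw [ContinuousLinearMap.adjoint_inner_right, R.mor_id_tmul hΘ h, inner_tmul_tmul,
      inner_tmul_tmul, ← star_ip, ← PAut.mem_id_map.mp (h ξ η), star_ip]

lemma adjoint_mor_tmul (hΘ : IsInverseSemigroup Θ) {ρ σ : PAut B} (hσ : σ ∈ Θ) {T : E →L[ℂ] F}
    {S : F →L[ℂ] E} (hT : IsHomogeneous ρ σ T) (hS : IsAdjoint σ T S) (η : F) (ω : K) :
    adjoint (R.mor σ T) (tmul R.π η ω) = tmul R.π (S η) (R.υ σ.symm ω) := by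
  refine ext_inner_tmul R.π fun ξ ζ => ?_
  have hm := hS ξ η
  rw [ContinuousLinearMap.adjoint_inner_right, R.mor_tmul hΘ hσ hT, inner_tmul_tmul,
    inner_tmul_tmul, inner_π_right, inner_π_right, ← R.υ_symm σ hσ, star_ip, star_ip,
    ← PAut.app_eq hm, ← R.υ_π hΘ hσ (PAut.mem_dom hm), ContinuousLinearMap.adjoint_inner_right]

/-- The zero components of the families |E⟩ and |E] contribute just this operator to the spans. -/
lemma mor_zero (σ : PAut B) : R.mor σ (0 : E →L[ℂ] F) = 0 := by
  have h : ∀ (ξ : E) (ζ : K), (0 : R.obj E →L[ℂ] R.obj F) (tmul R.π ξ ζ)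
      = tmul R.π ((0 : E →L[ℂ] F) ξ) (R.υ σ ζ) := fun ξ ζ => by
    rw [_root_.zero_apply, _root_.zero_apply, zero_tmul]
  refine ext_tmul R.π fun ξ ζ => ?_
  rw [mor, amp_tmul_of_exists _ ⟨0, h⟩, h]

/-! ### The operators `F(l_b)` and `F(|ξ⟩)` -/

variable (E) in
/-- The representation `b ↦ F(l_b)` of `B` on `F(E)`. -/
def leftRep (hΘ : IsAdmissible Θ) : B →⋆ₙₐ[ℂ] (R.obj E →L[ℂ] R.obj E) where
  toFun b := R.mor (PAut.id B) (leftMul E b)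
  map_smul' z b := ext_tmul R.π fun ξ ζ => by
    rw [R.mor_id_tmul hΘ (isAdjoint_leftMul _), MonoidHom.id_apply, _root_.smul_apply,
      R.mor_id_tmul hΘ (isAdjoint_leftMul _), leftMul, map_smul, _root_.smul_apply, smul_tmul]
    rfl
  map_zero' := by
    rw [show leftMul E (0 : B) = 0 from map_zero _, R.mor_zero]
  map_add' b c := ext_tmul R.π fun ξ ζ => by
    rw [R.mor_id_tmul hΘ (isAdjoint_leftMul _), _root_.add_apply,
      R.mor_id_tmul hΘ (isAdjoint_leftMul _), R.mor_id_tmul hΘ (isAdjoint_leftMul _),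
      leftMul, map_add, _root_.add_apply, add_tmul]
    rfl
  map_mul' b c := ext_tmul R.π fun ξ ζ => by
    rw [R.mor_id_tmul hΘ (isAdjoint_leftMul _), mul_apply_eq_comp,
      R.mor_id_tmul hΘ (isAdjoint_leftMul _), R.mor_id_tmul hΘ (isAdjoint_leftMul _)]
    exact congrArg (fun x => tmul R.π x ζ) (LeftAction.lact_mul b c ξ)
  map_star' b := ext_tmul R.π fun ξ ζ => by
    rw [R.mor_id_tmul hΘ (isAdjoint_leftMul _), ContinuousLinearMap.star_eq_adjoint,
      R.adjoint_mor_id_tmul hΘ (isAdjoint_leftMul _)]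

@[simp] lemma leftRep_tmul (hΘ : IsAdmissible Θ) (b : B) (ξ : E) (ζ : K) :
    R.leftRep E hΘ b (tmul R.π ξ ζ) = tmul R.π (lact b ξ) ζ :=
  R.mor_id_tmul hΘ (isAdjoint_leftMul _) ξ ζ

lemma norm_leftRep_le (hΘ : IsAdmissible Θ) (b : B) : ‖R.leftRep E hΘ b‖ ≤ ‖b‖ :=
  NonUnitalStarAlgHom.norm_apply_le (R.leftRep E hΘ) b

lemma mor_ket_tmul (hΘ : IsAdmissible Θ) (ξ : E) (b : B) (ζ : K) :
    R.mor (PAut.id B) (ket B ξ) (tmul R.π b ζ) = tmul R.π (ξ <• b) ζ :=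
  R.mor_id_tmul hΘ (isAdjoint_ket ξ) b ζ

lemma adjoint_mor_ket_comp (hΘ : IsAdmissible Θ) (ξ η : E) :
    adjoint (R.mor (PAut.id B) (ket B ξ)) ∘L R.mor (PAut.id B) (ket B η)
      = R.leftRep B hΘ (ip B ξ η) :=
  ext_tmul R.π fun b ζ => by
    rw [ContinuousLinearMap.comp_apply, R.mor_ket_tmul hΘ,
      R.adjoint_mor_id_tmul hΘ (isAdjoint_ket ξ), leftRep_tmul, bra_apply, ip_rsmul_right]
    rfl

variable (E) in
/-- The operators `F(|ξ⟩)`, as a bounded linear map on `E`. -/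
def ketOp (hΘ : IsAdmissible Θ) : E →L[ℂ] R.obj B →L[ℂ] R.obj E :=
  LinearMap.mkContinuous
    { toFun := fun ξ => R.mor (PAut.id B) (ket B ξ)
      map_add' := fun ξ η => ext_tmul R.π fun b ζ => by
        rw [_root_.add_apply, R.mor_ket_tmul hΘ, R.mor_ket_tmul hΘ, R.mor_ket_tmul hΘ, add_rsmul,
          add_tmul]
      map_smul' := fun z ξ => ext_tmul R.π fun b ζ => by
        rw [RingHom.id_apply, _root_.smul_apply, R.mor_ket_tmul hΘ, R.mor_ket_tmul hΘ, smul_rsmul,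
          smul_tmul] } 1 fun ξ => by
    rw [one_mul]
    refine norm_le_of_adjoint_comp _ (norm_nonneg ξ) ?_
    change ‖adjoint (R.mor (PAut.id B) (ket B ξ)) ∘L R.mor (PAut.id B) (ket B ξ)‖ ≤ _
    rw [R.adjoint_mor_ket_comp hΘ, norm_sq_eq_ip (B := B)]
    exact R.norm_leftRep_le hΘ _

@[simp] lemma ketOp_tmul (hΘ : IsAdmissible Θ) (ξ : E) (b : B) (ζ : K) :
    R.ketOp E hΘ ξ (tmul R.π b ζ) = tmul R.π (ξ <• b) ζ :=
  R.mor_ket_tmul hΘ ξ b ζ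

lemma adjoint_ketOp_comp (hΘ : IsAdmissible Θ) (ξ η : E) :
    adjoint (R.ketOp E hΘ ξ) ∘L R.ketOp E hΘ η = R.leftRep B hΘ (ip B ξ η) :=
  R.adjoint_mor_ket_comp hΘ ξ η

lemma ketOp_comp_leftRep (hΘ : IsAdmissible Θ) (ξ : E) (b : B) :
    R.ketOp E hΘ ξ ∘L R.leftRep B hΘ b = R.ketOp E hΘ (ξ <• b) :=
  ext_tmul R.π fun c ζ => by
    rw [ContinuousLinearMap.comp_apply, leftRep_tmul, ketOp_tmul, ketOp_tmul, lact_self, rsmul_mul]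

lemma leftRep_comp_ketOp (hΘ : IsAdmissible Θ) (b : B) (ξ : E) :
    R.leftRep E hΘ b ∘L R.ketOp E hΘ ξ = R.ketOp E hΘ (lact b ξ) :=
  ext_tmul R.π fun c ζ => by
    rw [ContinuousLinearMap.comp_apply, ketOp_tmul, ketOp_tmul, leftRep_tmul, lact_rsmul]

/-! ### The operators `F(|ξ])` and `F(r_b)` -/

variable {θ : PAut B}

lemma mor_rket_tmul (hΘ : IsAdmissible Θ) (hθ : θ ∈ Θ) {ξ : E} (hξ : ξ ∈ homog E θ) (b : B)
    (ζ : K) : R.mor θ.symm (rket B ξ) (tmul R.π b ζ) = tmul R.π (lact b ξ) (R.υ θ.symm ζ) :=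
  R.mor_tmul hΘ.inverseSemigroup (hΘ.inverseSemigroup.symm_mem θ hθ) (isHomogeneous_rket hξ) b ζ

lemma adjoint_mor_rket_tmul (hΘ : IsAdmissible Θ) (hθ : θ ∈ Θ) {ξ : E} (hξ : ξ ∈ homog E θ) (η : E)
    (ω : K) : adjoint (R.mor θ.symm (rket B ξ)) (tmul R.π η ω)
      = tmul R.π (θ.app (ip B ξ η)) (R.υ θ ω) :=
  R.adjoint_mor_tmul hΘ.inverseSemigroup (hΘ.inverseSemigroup.symm_mem θ hθ)
    (isHomogeneous_rket hξ) (isAdjoint_rket hξ) η ω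

lemma adjoint_mor_rket_comp_self (hΘ : IsAdmissible Θ) (hθ : θ ∈ Θ) {ξ : E}
    (hξ : ξ ∈ homog E θ) :
    adjoint (R.mor θ.symm (rket B ξ)) ∘L R.mor θ.symm (rket B ξ)
      = R.leftRep B hΘ (θ.app (ip B ξ ξ)) :=
  ext_tmul R.π fun b ζ => by
    rw [ContinuousLinearMap.comp_apply, R.mor_rket_tmul hΘ hθ hξ,
      R.adjoint_mor_rket_tmul hΘ hθ hξ, leftRep_tmul, homog.app_ip_lact hξ, lact_self]
    -- The leftover υ(θ)υ(θ*) is only a projection; it drops out because the first tensor factor is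
    -- a multiple of θ⟨ξ|ξ⟩ and hence lies in Img(θ).
    refine tmul_congr R.π fun c => R.π_υ_υ_symm hΘ.inverseSemigroup hθ ?_ ζ
    exact θ.isClosedIdeal_img.mul_mem_left _ (θ.isClosedIdeal_img.mul_mem_right _
      (PAut.app_mem_img (homog.ip_mem_dom hξ ξ)))

variable (E θ) in
/-- The operators `F(|ξ])`, as a bounded linear map on the `θ`-homogeneous elements. -/
def rketOp (hΘ : IsAdmissible Θ) (hθ : θ ∈ Θ) :
    homogSub E θ →L[ℂ] R.obj B →L[ℂ] R.obj E :=
  LinearMap.mkContinuous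
    { toFun := fun ξ => R.mor θ.symm (rket B ξ.1)
      map_add' := fun ξ η => ext_tmul R.π fun b ζ => by
        rw [_root_.add_apply, R.mor_rket_tmul hΘ hθ (ξ + η).2, R.mor_rket_tmul hΘ hθ ξ.2,
          R.mor_rket_tmul hΘ hθ η.2, Submodule.coe_add, map_add, add_tmul]
      map_smul' := fun z ξ => ext_tmul R.π fun b ζ => by
        rw [RingHom.id_apply, _root_.smul_apply, R.mor_rket_tmul hΘ hθ (z • ξ).2,
          R.mor_rket_tmul hΘ hθ ξ.2, Submodule.coe_smul, map_smul, smul_tmul] } 1 fun ξ => by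
    rw [one_mul]
    refine norm_le_of_adjoint_comp _ (norm_nonneg ξ) ?_
    change ‖adjoint (R.mor θ.symm (rket B ξ.1)) ∘L R.mor θ.symm (rket B ξ.1)‖ ≤ ‖ξ.1‖ ^ 2
    rw [R.adjoint_mor_rket_comp_self hΘ hθ ξ.2, norm_sq_eq_ip (B := B),
      ← PAut.norm_app (homog.ip_mem_dom ξ.2 ξ.1)]
    exact R.norm_leftRep_le hΘ _

end CovariantRep

/-! ### Operator spaces spanned by given operators -/

section OperatorSpaces

/-- The closed span of a set closed under products and adjoints, as a `*`-algebra. -/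
def spanAlg {A : Type*} [NonUnitalCStarAlgebra A] (S : Set A)
    (hmul : ∀ x ∈ S, ∀ y ∈ S, x * y ∈ clspan S) (hstar : ∀ x ∈ S, star x ∈ clspan S) :
    NonUnitalStarSubalgebra ℂ A where
  __ := clspan S
  mul_mem' := fun hx hy =>
    map₂_mem_of_mem_clspan (ContinuousLinearMap.mul ℂ A) (isClosed_clspan S) hmul hx hy
  star_mem' := fun {a} ha => by
    let N : Submodule ℂ A :=
      { carrier := {x | star x ∈ clspan S}
        add_mem' := fun {x y} hx hy => by
          simpa only [Set.mem_ofPred_eq, star_add] using add_mem hx hy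
        zero_mem' := by simp
        smul_mem' := fun z x hx => by
          simpa only [Set.mem_ofPred_eq, star_smul] using Submodule.smul_mem _ _ hx }
    have hN : IsClosed (N : Set A) := (isClosed_clspan S).preimage continuous_star
    exact clspan_le hN hstar ha

variable {H H' H'' : Type*} [NormedAddCommGroup H] [InnerProductSpace ℂ H] [CompleteSpace H]
  [NormedAddCommGroup H'] [InnerProductSpace ℂ H'] [CompleteSpace H']
  [NormedAddCommGroup H''] [InnerProductSpace ℂ H''] [CompleteSpace H'']

/-- Since x ↦ x* is conjugate-linear, the bilinear version does not apply to the first variable; the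
admissible x are shown directly to form a closed subspace. -/
lemma adjoint_comp_mem_of_mem_clspan {S : Set (H →L[ℂ] H'')} {S' : Set (H' →L[ℂ] H'')}
    {M : Submodule ℂ (H' →L[ℂ] H)} (hM : IsClosed (M : Set (H' →L[ℂ] H)))
    (h : ∀ x ∈ S, ∀ y ∈ S', adjoint x ∘L y ∈ M) {x : H →L[ℂ] H''} {y : H' →L[ℂ] H''}
    (hx : x ∈ clspan S) (hy : y ∈ clspan S') : adjoint x ∘L y ∈ M := by
  have h1 : ∀ x ∈ S, adjoint x ∘L y ∈ M := fun x hx =>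
    map_mem_of_mem_clspan (ContinuousLinearMap.compL ℂ H' H'' H (adjoint x)) hM (h x hx) hy
  let N : Submodule ℂ (H →L[ℂ] H'') :=
    { carrier := {x | adjoint x ∘L y ∈ M}
      add_mem' := fun {x x'} hx hx' => by
        simpa only [Set.mem_ofPred_eq, map_add, ContinuousLinearMap.add_comp] using add_mem hx hx'
      zero_mem' := by simp
      smul_mem' := fun z x hx => by
        simpa only [Set.mem_ofPred_eq, map_smulₛₗ, ContinuousLinearMap.smul_comp]
          using Submodule.smul_mem _ _ hx }
  have hN : IsClosed (N : Set (H →L[ℂ] H'')) := by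
    refine hM.preimage (f := fun x : H →L[ℂ] H'' => adjoint x ∘L y) ?_
    fun_prop
  exact clspan_le hN h1 hx

lemma comp_mem_of_mem_clspan {S : Set (H' →L[ℂ] H'')} {S' : Set (H →L[ℂ] H')}
    {M : Submodule ℂ (H →L[ℂ] H'')} (hM : IsClosed (M : Set (H →L[ℂ] H'')))
    (h : ∀ x ∈ S, ∀ y ∈ S', x ∘L y ∈ M) {x : H' →L[ℂ] H''} {y : H →L[ℂ] H'}
    (hx : x ∈ clspan S) (hy : y ∈ clspan S') : x ∘L y ∈ M :=
  map₂_mem_of_mem_clspan (ContinuousLinearMap.compL ℂ H H' H'') hM h hx hy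

lemma comp_eq_comp_of_mem_clspan {S : Set (H →L[ℂ] H')} (T : H' →L[ℂ] H') (b : H →L[ℂ] H)
    (h : ∀ x ∈ S, T ∘L x = x ∘L b) {x : H →L[ℂ] H'} (hx : x ∈ clspan S) : T ∘L x = x ∘L b := by
  have h1 := map_mem_of_mem_clspan (M := ⊥)
    (ContinuousLinearMap.compL ℂ H H' H' T - (ContinuousLinearMap.compL ℂ H H H').flip b)
    (by simp) (fun x hx => by
      simpa [sub_eq_zero] using h x hx) hx
  simpa [sub_eq_zero] using h1

/-- With p = T*T, the C*-identity gives ‖Te - T‖² = ‖e(pe - p) - (pe - p)‖ ≤ 2‖pe - p‖, which tends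
to zero as p lies in A. -/
lemma tendsto_comp_of_adjoint_comp_mem (A : NonUnitalStarSubalgebra ℂ (H →L[ℂ] H))
    {ι : Type*} {l : Filter ι} {e : ι → H →L[ℂ] H} (he : IsAU (A : Set (H →L[ℂ] H)) l e)
    {T : H →L[ℂ] H'} (hT : adjoint T ∘L T ∈ A) : Tendsto (fun i => T ∘L e i) l (𝓝 T) := by
  rw [tendsto_iff_norm_sub_tendsto_zero]
  set p := adjoint T ∘L T with hp
  have h1 : Tendsto (fun i => 2 * ‖p * e i - p‖) l (𝓝 0) := by
    simpa using ((he.mul_right p hT).sub_const p).norm.const_mul 2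
  have h2 := (Real.continuous_sqrt.tendsto _).comp h1
  rw [Real.sqrt_zero] at h2
  refine squeeze_zero (fun _ => norm_nonneg _) (fun i => ?_) h2
  refine norm_le_of_adjoint_comp _ (Real.sqrt_nonneg _) ?_
  rw [Function.comp_apply, Real.sq_sqrt (by positivity)]
  have e1 : adjoint (T ∘L e i - T) ∘L (T ∘L e i - T) = e i * (p * e i - p) - (p * e i - p) := by
    have h3 : adjoint (e i) = e i := he.star_eq i
    rw [map_sub, ContinuousLinearMap.adjoint_comp, h3]
    ext x
    simp [hp]
    abel
  rw [e1]
  refine (norm_sub_le _ _).trans ?_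
  have h4 : ‖e i * (p * e i - p)‖ ≤ ‖p * e i - p‖ :=
    (norm_mul_le _ _).trans (mul_le_of_le_one_left (norm_nonneg _) (he.norm_le i))
  linarith

/-- Each x in M is the limit of the x e_i, because x*x lies in A. So the axiom [α𝔅] = α of a
factorization reduces to α*α ⊆ 𝔅 and α𝔅 ⊆ α. -/
lemma clspan_comp_eq {M : Submodule ℂ (H →L[ℂ] H')} (hM : IsClosed (M : Set (H →L[ℂ] H')))
    {A : NonUnitalStarSubalgebra ℂ (H →L[ℂ] H)} (hA : IsClosed (A : Set (H →L[ℂ] H)))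
    (h₁ : ∀ x ∈ M, adjoint x ∘L x ∈ A) (h₂ : ∀ x ∈ M, ∀ a ∈ A, x ∘L a ∈ M) :
    clspan {x : H →L[ℂ] H' | ∃ ξ ∈ M, ∃ a ∈ A, x = ξ ∘L a} = M := by
  refine le_antisymm (clspan_le hM ?_) fun x hx => ?_
  · rintro _ ⟨ξ, hξ, a, ha, rfl⟩
    exact h₂ ξ hξ a ha
  · obtain ⟨l, hl⟩ := exists_isAU A hA
    have := hl.neBot
    exact (isClosed_clspan _).mem_of_tendsto (tendsto_comp_of_adjoint_comp_mem A hl (h₁ x hx))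
      (Eventually.of_forall fun i => subset_clspan _ ⟨x, hx, _, hl.mem i, rfl⟩)

end OperatorSpaces

/-! ### Associated representations: from generators to the closed span -/

namespace CStarBase.IsFactorization

variable {H H' K : Type*} [NormedAddCommGroup H] [InnerProductSpace ℂ H] [CompleteSpace H]
  [NormedAddCommGroup H'] [InnerProductSpace ℂ H'] [CompleteSpace H']
  [NormedAddCommGroup K] [InnerProductSpace ℂ K] [CompleteSpace K]
  {𝒞 : CStarBase H} {α : Submodule ℂ (H →L[ℂ] K)}

lemma norm_rep_le (hα : 𝒞.IsFactorization α) (b : 𝒞.right) : ‖hα.rep b‖ ≤ ‖b‖ := by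
  have : IsClosed (𝒞.right : Set (H →L[ℂ] H)) := 𝒞.isClosed_right
  exact NonUnitalStarAlgHom.norm_apply_le hα.rep b

/-- The elements b of the base algebra with ρ_α(b)η in N form a closed subspace, as ρ_α is linear
and contractive; so generators suffice. -/
lemma rep_comp_mem (hα : 𝒞.IsFactorization α) {S : Set (H →L[ℂ] H)}
    (hS : ∀ b ∈ 𝒞.right, b ∈ clspan S) {N : Submodule ℂ (H' →L[ℂ] K)}
    (hN : IsClosed (N : Set (H' →L[ℂ] K))) (η : H' →L[ℂ] K)
    (h : ∀ b ∈ S, ∃ hb : b ∈ 𝒞.right, hα.rep ⟨b, hb⟩ ∘L η ∈ N) (b : 𝒞.right) :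
    hα.rep b ∘L η ∈ N := by
  let P : Submodule ℂ (H →L[ℂ] H) :=
    { carrier := {x | ∃ hx : x ∈ 𝒞.right, hα.rep ⟨x, hx⟩ ∘L η ∈ N}
      add_mem' := by
        rintro x y ⟨hx, hx'⟩ ⟨hy, hy'⟩
        refine ⟨add_mem hx hy, ?_⟩
        have h1 := map_add hα.rep ⟨x, hx⟩ ⟨y, hy⟩
        have h2 := add_mem hx' hy'
        rw [← ContinuousLinearMap.add_comp, ← h1] at h2
        exact h2
      zero_mem' := by
        refine ⟨zero_mem _, ?_⟩
        have h1 := map_zero hα.rep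
        have h2 : hα.rep ⟨0, zero_mem _⟩ = 0 := h1
        rw [h2, ContinuousLinearMap.zero_comp]
        exact zero_mem _
      smul_mem' := by
        rintro z x ⟨hx, hx'⟩
        refine ⟨SMulMemClass.smul_mem z hx, ?_⟩
        have h1 := map_smul hα.rep z ⟨x, hx⟩
        have h2 := N.smul_mem z hx'
        rw [← ContinuousLinearMap.smul_comp, ← h1] at h2
        exact h2 }
  have hcont : Continuous fun b : 𝒞.right => hα.rep b ∘L η := by
    have h1 : Continuous fun b : 𝒞.right => hα.rep b :=
      AddMonoidHomClass.continuous_of_bound hα.rep 1 fun b => by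
        rw [one_mul]; exact hα.norm_rep_le b
    exact h1.clm_comp continuous_const
  -- P is the image of a closed subset of the algebra under its inclusion, which is a closed
  -- embedding.
  have hP : IsClosed (P : Set (H →L[ℂ] H)) := by
    have h1 := (𝒞.isClosed_right.isClosedEmbedding_subtypeVal).isClosedMap _ (hN.preimage hcont)
    convert h1 using 1
    ext x
    constructor
    · rintro ⟨hx, hx'⟩
      exact ⟨⟨x, hx⟩, hx', rfl⟩
    · rintro ⟨y, hy, rfl⟩
      exact ⟨y.2, hy⟩
  obtain ⟨_, h2⟩ := clspan_le hP h (hS b.1 b.2)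
  exact h2

end CStarBase.IsFactorization

/-! ### Decomposability, relative adjoints and the condition [|E]*|E]] = |B] -/

section

variable {B : Type*} [NonUnitalCStarAlgebra B] [PartialOrder B] [StarOrderedRing B]
variable {E : Type*} [NormedAddCommGroup E] [NormedSpace ℂ E] [SMul Bᵐᵒᵖ E] [CStarModule Bᵐᵒᵖ E]
  [LeftAction B E]
variable {F : Type*} [NormedAddCommGroup F] [NormedSpace ℂ F] [SMul Bᵐᵒᵖ F] [CStarModule Bᵐᵒᵖ F]
  [LeftAction B F]

lemma isDecomposable_of_supported {Θ : Set (PAut B)}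
    (hB : IsDecomposable B (Set.univ : Set (PAut B))) (hΘ : IsSupported B Θ) :
    IsDecomposable B Θ := by
  refine eq_top_iff.mpr (hB.symm.le.trans (clspan_le (isClosed_clspan _) ?_))
  rintro b ⟨θ, -, hb⟩
  rw [hΘ θ] at hb
  refine clspan_mono ?_ hb
  rintro c ⟨θ', hθ', -, hc⟩
  exact ⟨θ', hθ', hc⟩

lemma clspan_lact_self : clspan {x : B | ∃ b c : B, x = lact b c} = ⊤ := by
  rw [← clspan_rsmul_eq_top (B := B) (E := B)]
  rfl

/-- Injectivity of σ determines ⟨Sη|ξ⟩. The adjoint family contains every relative adjoint, and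
uniqueness identifies these with the explicit ones. -/
lemma isAdjoint_unique {σ : PAut B} {T : E →L[ℂ] F} {S S' : F →L[ℂ] E} (h : IsAdjoint σ T S)
    (h' : IsAdjoint σ T S') (η : F) : S η = S' η := by
  refine ext_ip (B := B) fun ξ => ?_
  have h1 := σ.map.inj (h ξ η) (h' ξ η)
  rw [← star_ip, h1, star_ip]

lemma isAdjoint_zero (σ : PAut B) : IsAdjoint σ (0 : E →L[ℂ] F) 0 := fun ξ η => by
  have h1 : ip B η ((0 : E →L[ℂ] F) ξ) = 0 := (bra B F η).map_zero
  have h2 : ip B ((0 : F →L[ℂ] E) η) ξ = 0 := by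
    rw [← star_ip]; exact (congrArg star (bra B E ξ).map_zero).trans (star_zero B)
  have h3 := PAut.app_mem_map σ.isClosedIdeal_dom.zero_mem
  rw [PAut.app_zero] at h3
  rwa [h1, h2]

lemma mem_ketFamily {ρ σ : PAut B} {T : B →L[ℂ] E} (hT : T ∈ ketFamily B E ρ σ) :
    (σ = PAut.id B ∧ ∃ ξ ∈ homog E ρ, T = ket B ξ) ∨ T = 0 := by
  rw [ketFamily] at hT
  split_ifs at hT with h
  · exact Or.inl ⟨h, hT⟩
  · exact Or.inr hT

lemma mem_rketFamily {ρ σ : PAut B} {T : B →L[ℂ] E} (hT : T ∈ rketFamily B E ρ σ) :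
    (∃ ξ ∈ homog E σ.symm, T = rket B ξ) ∨ T = 0 := by
  rw [rketFamily] at hT
  split_ifs at hT
  · exact Or.inl hT
  · exact Or.inr hT

lemma rketFamily_id (σ : PAut B) :
    rketFamily B E (PAut.id B) σ = {T | ∃ ξ ∈ homog E σ.symm, T = rket B ξ} := by
  rw [rketFamily, if_pos rfl]

/-- If `[|E]* |E]] = |B]`, the elements `θ ⟨ξ | η⟩`, with `ξ` homogeneous for `θ`, span `B`. -/
lemma mem_clspan_app_ip (h : (rketFamily B E).adj.prod (rketFamily B E) = rketFamily B B)
    {θ : PAut B} {b : B} (hb : b ∈ homog B θ) :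
    b ∈ clspan {x : B | ∃ (θ : PAut B) (ξ : E), ξ ∈ homog E θ ∧ ∃ η, x = θ.app (ip B ξ η)} := by
  have h1 : rket B b ∈ (rketFamily B E).adj.prod (rketFamily B E) (PAut.id B) θ.symm := by
    rw [h, rketFamily_id]
    exact ⟨b, hb, rfl⟩
  -- Evaluating |b] at c gives cb, while a generator of the product family evaluates to θ⟨ξ|Tc⟩ or
  -- to 0. Letting c run through an approximate unit of B then yields b.
  have h2 (c : B) : c * b ∈
      clspan {x : B | ∃ (θ : PAut B) (ξ : E), ξ ∈ homog E θ ∧ ∃ η, x = θ.app (ip B ξ η)} := by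
    refine map_mem_of_mem_clspan (ContinuousLinearMap.apply ℂ B c) (isClosed_clspan _) ?_ h1
    rintro _ ⟨ρ', σ', ρ, σ, -, -, T', ⟨T₀, hT₀, hT'⟩, T, -, rfl⟩
    change T' (T c) ∈ _
    rcases mem_rketFamily hT₀ with ⟨ξ, hξ, rfl⟩ | rfl
    · rw [isAdjoint_unique hT' (isAdjoint_rket hξ)]
      exact subset_clspan _ ⟨_, ξ, hξ, _, rfl⟩
    · rw [isAdjoint_unique hT' (isAdjoint_zero _)]
      exact zero_mem _
  obtain ⟨l, hl⟩ := exists_isAU (⊤ : NonUnitalStarSubalgebra ℂ B) isClosed_top_subalgebra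
  have := hl.neBot
  exact (isClosed_clspan _).mem_of_tendsto (hl.mul_left b trivial)
    (Eventually.of_forall fun i => h2 _)

end

namespace CovariantRep

variable {B : Type*} [NonUnitalCStarAlgebra B] [PartialOrder B] [StarOrderedRing B]
variable {K : Type*} [NormedAddCommGroup K] [InnerProductSpace ℂ K] [CompleteSpace K]
variable {E : Type*} [NormedAddCommGroup E] [NormedSpace ℂ E] [SMul Bᵐᵒᵖ E] [CStarModule Bᵐᵒᵖ E]
  [LeftAction B E]
variable {Θ : Set (PAut B)} (R : CovariantRep Θ K)

/-! ### Generators of `F_*(|E⟩)` and `F_*(|E])` -/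

variable (E) in
/-- The operators `F(|ξ⟩)`. -/
def ketSet (hΘ : IsAdmissible Θ) : Set (R.obj B →L[ℂ] R.obj E) := Set.range (R.ketOp E hΘ)

variable (E) in
/-- The operators `F(|ξ])` for homogeneous `ξ`. -/
def rketSet : Set (R.obj B →L[ℂ] R.obj E) :=
  {T | ∃ θ ∈ Θ, ∃ ξ ∈ homog E θ, T = R.mor θ.symm (rket B ξ)}

/-- F(|ξ⟩) is linear and continuous in ξ ∈ E, so decomposability allows arbitrary ξ as generators
and degrees play no further role in α(E). -/
lemma morSpan_ketFamily (hΘ : IsAdmissible Θ) (hE : IsDecomposable E Θ) :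
    R.morSpan (ketFamily B E) = clspan (R.ketSet E hΘ) := by
  refine le_antisymm (clspan_le (isClosed_clspan _) ?_) (clspan_le (isClosed_clspan _) ?_)
  · rintro _ ⟨ρ, -, σ, -, T, hT, rfl⟩
    rcases mem_ketFamily hT with ⟨rfl, ξ, -, rfl⟩ | rfl
    · exact subset_clspan _ ⟨ξ, rfl⟩
    · rw [R.mor_zero]; exact zero_mem _
  · rintro _ ⟨ξ, rfl⟩
    refine map_mem_of_mem_clspan (W := R.obj B →L[ℂ] R.obj E) (R.ketOp E hΘ) (isClosed_clspan _) ?_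
      (hE ▸ Submodule.mem_top (x := ξ))
    rintro η ⟨θ, hθ, hη⟩
    refine subset_clspan _ ⟨θ, hθ, PAut.id B, hΘ.id_mem, ket B η, ?_, rfl⟩
    rw [ketFamily, if_pos rfl]
    exact ⟨η, hη, rfl⟩

lemma morSpan_rketFamily (hΘ : IsAdmissible Θ) :
    R.morSpan (rketFamily B E) = clspan (R.rketSet E) := by
  have hs := hΘ.inverseSemigroup.symm_mem
  refine le_antisymm (clspan_le (isClosed_clspan _) ?_) (clspan_mono ?_)
  · rintro _ ⟨ρ, -, σ, hσ, T, hT, rfl⟩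
    rcases mem_rketFamily hT with ⟨ξ, hξ, rfl⟩ | rfl
    · exact subset_clspan _ ⟨σ.symm, hs σ hσ, ξ, hξ, rfl⟩
    · rw [R.mor_zero]; exact zero_mem _
  · rintro _ ⟨θ, hθ, ξ, hξ, rfl⟩
    refine ⟨PAut.id B, hΘ.id_mem, θ.symm, hs θ hθ, rket B ξ, ?_, rfl⟩
    rw [rketFamily_id]
    exact ⟨ξ, hξ, rfl⟩

/-! ### Products of generators -/

variable {θ θ' τ : PAut B}

lemma isComp_symm (h : PAut.IsComp θ θ' τ) : PAut.IsComp θ'.symm θ.symm τ.symm :=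
  (congrArg PEquiv.symm h).trans (PEquiv.symm_trans_rev _ _)

lemma υ_symm_comp (hΘ : IsAdmissible Θ) (hθ : θ ∈ Θ) (hθ' : θ' ∈ Θ) (hτ : τ ∈ Θ)
    (h : PAut.IsComp θ θ' τ) (ζ : K) : R.υ θ'.symm (R.υ θ.symm ζ) = R.υ τ.symm ζ := by
  have hs := hΘ.inverseSemigroup.symm_mem
  exact congrArg (fun f => f ζ)
    (R.υ_comp _ (hs _ hθ') _ (hs _ hθ) _ (hs _ hτ) (isComp_symm h))

lemma mor_rket_comp_mor_rket (hΘ : IsAdmissible Θ) (hθ : θ ∈ Θ) (hθ' : θ' ∈ Θ) (hτ : τ ∈ Θ)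
    (h : PAut.IsComp θ θ' τ) {b : B} (hb : b ∈ homog B θ) {ξ : E} (hξ : ξ ∈ homog E θ') :
    R.mor θ'.symm (rket B ξ) ∘L R.mor θ.symm (rket B b) = R.mor τ.symm (rket B (lact b ξ)) :=
  ext_tmul R.π fun c ζ => by
    rw [ContinuousLinearMap.comp_apply, R.mor_rket_tmul hΘ hθ hb, R.mor_rket_tmul hΘ hθ' hξ,
      R.mor_rket_tmul hΘ hτ (homog.lact_mem hb hξ h), R.υ_symm_comp hΘ hθ hθ' hτ h,
      ← LeftAction.lact_mul]
    rfl

lemma mor_rightMul_tmul (hΘ : IsAdmissible Θ) (hE : IsRightBimodule B E) (hθ : θ ∈ Θ) {b : B}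
    (hb : b ∈ homog B θ) (ξ : E) (ζ : K) :
    R.mor θ.symm (rightMul E b) (tmul R.π ξ ζ) = tmul R.π (ξ <• b) (R.υ θ.symm ζ) :=
  R.mor_tmul hΘ.inverseSemigroup (hΘ.inverseSemigroup.symm_mem θ hθ)
    (isHomogeneous_rightMul hE hb) ξ ζ

lemma mor_rightMul_comp_mor_rket (hΘ : IsAdmissible Θ) (hE : IsRightBimodule B E) (hθ : θ ∈ Θ)
    (hθ' : θ' ∈ Θ) (hτ : τ ∈ Θ) (h : PAut.IsComp θ θ' τ) {ξ : E} (hξ : ξ ∈ homog E θ) {b : B}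
    (hb : b ∈ homog B θ') :
    R.mor θ'.symm (rightMul E b) ∘L R.mor θ.symm (rket B ξ)
      = R.mor τ.symm (rket B (ξ <• b)) :=
  ext_tmul R.π fun c ζ => by
    rw [ContinuousLinearMap.comp_apply, R.mor_rket_tmul hΘ hθ hξ, R.mor_rightMul_tmul hΘ hE hθ' hb,
      R.mor_rket_tmul hΘ hτ (homog.rsmul_mem hξ hb h), R.υ_symm_comp hΘ hθ hθ' hτ h, lact_rsmul]

/-- Both sides send c ⊗ ζ to ξcb ⊗ υ(θ*)ζ. This identifies ρ_α(F(|b])). -/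
lemma mor_rightMul_comp_ketOp (hΘ : IsAdmissible Θ) (hE : IsRightBimodule B E) (hθ : θ ∈ Θ) {b : B}
    (hb : b ∈ homog B θ) (ξ : E) :
    R.mor θ.symm (rightMul E b) ∘L R.ketOp E hΘ ξ
      = R.ketOp E hΘ ξ ∘L R.mor θ.symm (rket B b) :=
  ext_tmul R.π fun c ζ => by
    rw [ContinuousLinearMap.comp_apply, ketOp_tmul, R.mor_rightMul_tmul hΘ hE hθ hb,
      ContinuousLinearMap.comp_apply, R.mor_rket_tmul hΘ hθ hb, ketOp_tmul, ← rsmul_mul]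
    rfl

/-- Both sides send c ⊗ ζ to bcξ ⊗ υ(θ*)ζ. For E = B this is the commutation of 𝔅 and 𝔅†; in general
it identifies ρ_β(F(|b⟩)). -/
lemma leftRep_comp_mor_rket (hΘ : IsAdmissible Θ) (hθ : θ ∈ Θ) (b : B) {ξ : E}
    (hξ : ξ ∈ homog E θ) :
    R.leftRep E hΘ b ∘L R.mor θ.symm (rket B ξ)
      = R.mor θ.symm (rket B ξ) ∘L R.leftRep B hΘ b :=
  ext_tmul R.π fun c ζ => by
    rw [ContinuousLinearMap.comp_apply, R.mor_rket_tmul hΘ hθ hξ, leftRep_tmul,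
      ContinuousLinearMap.comp_apply, leftRep_tmul, R.mor_rket_tmul hΘ hθ hξ,
      ← LeftAction.lact_mul]
    rfl

/-- The adjoint sends c to θ(b*c), and the adjoint of θ(c*b) = bc* reads θ(b*c) = cb*. -/
lemma adjoint_mor_rket (hΘ : IsAdmissible Θ) (hθ : θ ∈ Θ) {b : B} (hb : b ∈ homog B θ) :
    adjoint (R.mor θ.symm (rket B b)) = R.mor θ.symm.symm (rket B (star b)) :=
  ext_tmul R.π fun c ζ => by
    rw [R.adjoint_mor_rket_tmul hΘ hθ hb, R.mor_rket_tmul hΘ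
      (hΘ.inverseSemigroup.symm_mem θ hθ) (homog.star_mem hb), PAut.symm_symm, ip_self, lact_self]
    have h := congrArg star (homog.app_mul_right hb (star c))
    rw [← PAut.app_star (show star c * b ∈ θ.dom from homog.ip_mem_dom hb c), star_mul, star_mul, star_star] at h
    rw [h]

/-- The product |ξ]*|η] lies in the component of degree (id, θθ'*) of [|E]*|E]] = |B], so it equals
|c] for a homogeneous c. As θθ'* is in Θ, the functor applies, and υ(θ)υ(θ'*) = υ(θθ'*). -/
lemma adjoint_mor_rket_comp_mem (hΘ : IsAdmissible Θ)
    (h : (rketFamily B E).adj.prod (rketFamily B E) = rketFamily B B) {x y : R.obj B →L[ℂ] R.obj E}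
    (hx : x ∈ R.rketSet E) (hy : y ∈ R.rketSet E) : adjoint x ∘L y ∈ clspan (R.rketSet B) := by
  obtain ⟨θ, hθ, ξ, hξ, rfl⟩ := hx
  obtain ⟨θ', hθ', η, hη, rfl⟩ := hy
  have hs := hΘ.inverseSemigroup.symm_mem
  obtain ⟨τ, hτ, hcomp⟩ := hΘ.inverseSemigroup.comp_mem θ hθ θ'.symm (hs _ hθ')
  have h1 : rbra hξ ∘L rket B η ∈ (rketFamily B E).adj.prod (rketFamily B E) (PAut.id B) τ := by
    refine subset_clspan _ ⟨PAut.id B, θ, PAut.id B, θ'.symm, le_of_eq (PEquiv.refl_trans _),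
      le_of_eq hcomp.symm, rbra hξ, ⟨rket B ξ, ?_, isAdjoint_rket hξ⟩, rket B η, ?_, rfl⟩
    · rw [PAut.id_symm, rketFamily_id]; exact ⟨ξ, hξ, rfl⟩
    · rw [rketFamily_id]; exact ⟨η, hη, rfl⟩
  rw [h, rketFamily_id] at h1
  obtain ⟨c, hc, hc'⟩ := h1
  refine subset_clspan _ ⟨τ.symm, hs _ hτ, c, hc, ext_tmul R.π fun b ζ => ?_⟩
  rw [ContinuousLinearMap.comp_apply, R.mor_rket_tmul hΘ hθ' hη, R.adjoint_mor_rket_tmul hΘ hθ hξ,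
    R.mor_rket_tmul hΘ (hs _ hτ) hc, PAut.symm_symm,
    ← R.υ_comp θ hθ _ (hs _ hθ') τ hτ hcomp]
  exact congrArg (fun x => tmul R.π x _) (congrArg (fun f => f b) hc')

end CovariantRep

namespace CovariantRep

variable {B : Type*} [NonUnitalCStarAlgebra B] [PartialOrder B] [StarOrderedRing B]
variable {K : Type*} [NormedAddCommGroup K] [InnerProductSpace ℂ K] [CompleteSpace K]
variable {E : Type*} [NormedAddCommGroup E] [NormedSpace ℂ E] [SMul Bᵐᵒᵖ E] [CStarModule Bᵐᵒᵖ E]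
  [LeftAction B E]
variable {Θ : Set (PAut B)} (R : CovariantRep Θ K)

/-! ### Nondegeneracy -/

lemma clspan_ketSet_apply (hΘ : IsAdmissible Θ) :
    clspan {x : R.obj E | ∃ a ∈ clspan (R.ketSet E hΘ), ∃ ζ, x = a ζ} = ⊤ := by
  refine eq_top_of_tmul_mem R.π (isClosed_clspan _) (clspan_rsmul_eq_top (B := B) (E := E)) ?_
  rintro _ ⟨ξ, b, rfl⟩ ζ
  exact subset_clspan _ ⟨_, subset_clspan _ ⟨ξ, rfl⟩, tmul R.π b ζ, (R.ketOp_tmul hΘ ξ b ζ).symm⟩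

/-- Since υ(θ*) is not surjective, ζ is first cut down: bξ ⊗ ζ = lim bξ ⊗ π(e_i)ζ for an approximate
unit e_i of Dom(θ), and π(e_i)ζ lies in the range of υ(θ*), so F(|ξ]) reaches these tensors. -/
lemma tmul_lact_mem (hΘ : IsAdmissible Θ) {θ : PAut B} (hθ : θ ∈ Θ) {ξ : E}
    (hξ : ξ ∈ homog E θ) (b : B) (ζ : K) : tmul R.π (lact b ξ) ζ ∈
      clspan {x : R.obj E | ∃ a ∈ clspan (R.rketSet E), ∃ ζ, x = a ζ} := by
  obtain ⟨l, hl⟩ := θ.exists_isAU_dom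
  have := hl.neBot
  have h1 : Tendsto (fun i => tmul R.π (lact b ξ <• (i.1 : B)) ζ) l (𝓝 (tmul R.π (lact b ξ) ζ)) := by
    simp only [← lact_rsmul]
    exact (((tmulL R.π).flip ζ ∘L lact b).continuous.tendsto ξ).comp (homog.tendsto_rsmul hξ hl)
  refine (isClosed_clspan _).mem_of_tendsto h1 (Eventually.of_forall fun i => ?_)
  have h2 : R.π i.1 ζ ∈ Set.range (R.υ θ.symm) := by
    rw [R.range_υ _ (hΘ.inverseSemigroup.symm_mem θ hθ)]
    exact subset_clspan _ ⟨i.1, by rw [PAut.img_symm]; exact hl.mem i, ζ, rfl⟩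
  obtain ⟨κ, hκ⟩ := h2
  refine subset_clspan _ ⟨_, subset_clspan _ ⟨θ, hθ, ξ, hξ, rfl⟩, tmul R.π b κ, ?_⟩
  rw [R.mor_rket_tmul hΘ hθ hξ, tmul_rsmul, hκ]

lemma clspan_rketSet_apply (hΘ : IsAdmissible Θ) (hE : IsDecomposable E Θ)
    (hE' : clspan {ξ : E | ∃ (b : B) (η : E), ξ = lact b η} = ⊤) :
    clspan {x : R.obj E | ∃ a ∈ clspan (R.rketSet E), ∃ ζ, x = a ζ} = ⊤ := by
  refine eq_top_of_tmul_mem R.π (isClosed_clspan _) hE' ?_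
  rintro _ ⟨b, η, rfl⟩ ζ
  refine map_mem_of_mem_clspan ((tmulL R.π).flip ζ ∘L lact b) (isClosed_clspan _) ?_
    (hE ▸ Submodule.mem_top (x := η))
  rintro ξ ⟨θ, hθ, hξ⟩
  exact R.tmul_lact_mem hΘ hθ hξ b ζ

/-! ### The base -/

/-- The `C*`-base `(F(B), F_*(|B⟩), F_*(|B]))`. -/
def base (hΘ : IsAdmissible Θ) (hB : IsDecomposable B Θ) : CStarBase (R.obj B) where
  left := spanAlg (R.ketSet B hΘ)
    (by
      rintro _ ⟨b, rfl⟩ _ ⟨c, rfl⟩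
      exact subset_clspan _ ⟨b * c, map_mul (R.leftRep B hΘ) b c⟩)
    (by
      rintro _ ⟨b, rfl⟩
      exact subset_clspan _ ⟨star b, map_star (R.leftRep B hΘ) b⟩)
  right := spanAlg (R.rketSet B)
    (by
      rintro _ ⟨θ, hθ, b, hb, rfl⟩ _ ⟨θ', hθ', c, hc, rfl⟩
      obtain ⟨τ, hτ, h⟩ := hΘ.inverseSemigroup.comp_mem θ' hθ' θ hθ
      exact subset_clspan _ ⟨τ, hτ, _, homog.lact_mem hc hb h,
        R.mor_rket_comp_mor_rket hΘ hθ' hθ hτ h hc hb⟩)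
    (by
      rintro _ ⟨θ, hθ, b, hb, rfl⟩
      exact subset_clspan _ ⟨θ.symm, hΘ.inverseSemigroup.symm_mem θ hθ, star b,
        homog.star_mem hb, R.adjoint_mor_rket hΘ hθ hb⟩)
  isClosed_left := isClosed_clspan _
  isClosed_right := isClosed_clspan _
  commute a ha b hb := by
    refine comp_eq_comp_of_mem_clspan a a ?_ hb
    rintro _ ⟨θ, hθ, b, hb, rfl⟩
    refine (comp_eq_comp_of_mem_clspan (R.mor θ.symm (rket B b)) (R.mor θ.symm (rket B b))
      ?_ ha).symm
    rintro _ ⟨c, rfl⟩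
    exact (R.leftRep_comp_mor_rket hΘ hθ c hb).symm
  nondegenerate_left := R.clspan_ketSet_apply hΘ
  nondegenerate_right := R.clspan_rketSet_apply hΘ hB clspan_lact_self

/-! ### The factorization `F_*(|E⟩)` -/

lemma adjoint_comp_mem_clspan_ketSet (hΘ : IsAdmissible Θ) {x y : R.obj B →L[ℂ] R.obj E}
    (hx : x ∈ clspan (R.ketSet E hΘ)) (hy : y ∈ clspan (R.ketSet E hΘ)) :
    adjoint x ∘L y ∈ clspan (R.ketSet B hΘ) := by
  refine adjoint_comp_mem_of_mem_clspan (isClosed_clspan _) ?_ hx hy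
  rintro _ ⟨ξ, rfl⟩ _ ⟨η, rfl⟩
  exact subset_clspan _ ⟨_, (R.adjoint_ketOp_comp hΘ ξ η).symm⟩

lemma isFactorization_ket (hΘ : IsAdmissible Θ) (hB : IsDecomposable B Θ)
    (hE : IsRightBimodule B E) :
    (R.base hΘ hB).IsFactorization (clspan (R.ketSet E hΘ)) where
  isClosed := isClosed_clspan _
  adjoint_comp := by
    refine congrArg SetLike.coe (a₂ := clspan (R.ketSet B hΘ)) (le_antisymm
      (clspan_le (isClosed_clspan _) ?_) (clspan_le (isClosed_clspan _) ?_))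
    · rintro _ ⟨ξ, hξ, η, hη, rfl⟩
      exact R.adjoint_comp_mem_clspan_ketSet hΘ hξ hη
    -- On B, F(|b⟩) and F(l_b) are the same operator, so fullness of E writes F(|b⟩) as a limit of
    -- sums of F(|ξ⟩)*F(|η⟩).
    · rintro _ ⟨b, rfl⟩
      refine map_mem_of_mem_clspan (W := R.obj B →L[ℂ] R.obj B) (R.ketOp B hΘ)
        (isClosed_clspan _) ?_ (hE.full ▸ Submodule.mem_top (x := b))
      rintro _ ⟨ξ, η, rfl⟩
      exact subset_clspan _ ⟨_, subset_clspan _ ⟨ξ, rfl⟩, _, subset_clspan _ ⟨η, rfl⟩,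
        (R.adjoint_ketOp_comp hΘ ξ η).symm⟩
  comp_left := by
    refine clspan_comp_eq (isClosed_clspan _) (R.base hΘ hB).isClosed_left
      (fun x hx => R.adjoint_comp_mem_clspan_ketSet hΘ hx hx) fun x hx a ha =>
      comp_mem_of_mem_clspan (isClosed_clspan _) ?_ hx ha
    rintro _ ⟨ξ, rfl⟩ _ ⟨b, rfl⟩
    exact subset_clspan _ ⟨_, (R.ketOp_comp_leftRep hΘ ξ b).symm⟩
  nondegenerate := R.clspan_ketSet_apply hΘ

/-! ### The factorization `F_*(|E])` -/

lemma isClosed_homogSub (θ : PAut B) : IsClosed (homogSub E θ : Set E) := by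
  have h : (homogSub E θ : Set E) =
      (clspan {x : E | ∃ (η : E), ∃ d ∈ θ.dom, x = η <• d} : Set E) ∩
        ⋂ (b : B) (c : B) (_ : c ∈ θ.map b), {ξ | ξ <• b = lact c ξ} := by
    ext ξ
    simp [homog]
  rw [h]
  refine (isClosed_clspan _).inter (isClosed_iInter fun b => isClosed_iInter fun c =>
    isClosed_iInter fun _ => isClosed_eq ((rmul B E).flip b).continuous
      (lact (B := B) (E := E) c).continuous)

variable (E) in
/-- The homogeneous elements `c` of `B` for which `F(|c])` lies in `[β* β]`, `β = F_*(|E])`. -/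
def rketPreimage (hΘ : IsAdmissible Θ) {θ : PAut B} (hθ : θ ∈ Θ) : Submodule ℂ B :=
  ((clspan {x | ∃ ξ ∈ clspan (R.rketSet E), ∃ η ∈ clspan (R.rketSet E), x = adjoint ξ ∘L η}).comap
    (R.rketOp B θ hΘ hθ).toLinearMap).map (homogSub B θ).subtype

lemma isClosed_rketPreimage (hΘ : IsAdmissible Θ) {θ : PAut B} (hθ : θ ∈ Θ) :
    IsClosed (R.rketPreimage E hΘ hθ : Set B) :=
  (isClosed_homogSub θ).isClosedEmbedding_subtypeVal.isClosedMap _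
    ((isClosed_clspan _).preimage (R.rketOp B θ hΘ hθ).continuous)

lemma mem_rketPreimage (hΘ : IsAdmissible Θ) {θ : PAut B} (hθ : θ ∈ Θ) {c : B} :
    c ∈ R.rketPreimage E hΘ hθ ↔ c ∈ homog B θ ∧ R.mor θ.symm (rket B c) ∈
      clspan {x | ∃ ξ ∈ clspan (R.rketSet E), ∃ η ∈ clspan (R.rketSet E), x = adjoint ξ ∘L η} := by
  constructor
  · rintro ⟨c, hc, rfl⟩
    exact ⟨c.2, hc⟩
  · rintro ⟨hc, hc'⟩
    exact ⟨⟨c, hc⟩, hc', rfl⟩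

variable (E) in
/-- The multipliers `h` such that `F(|h c])` and `F(|h* c])` lie in `[β* β]`, `β = F_*(|E])`, for
all homogeneous `c`. -/
def multiplierAlg (hΘ : IsAdmissible Θ) : NonUnitalStarSubalgebra ℂ B where
  carrier := {h | ∀ (θ : PAut B) (hθ : θ ∈ Θ), ∀ c ∈ homog B θ,
    h * c ∈ R.rketPreimage E hΘ hθ ∧ star h * c ∈ R.rketPreimage E hΘ hθ}
  add_mem' := fun {h h'} H H' θ hθ c hc => by
    rw [star_add, add_mul, add_mul]
    exact ⟨add_mem (H θ hθ c hc).1 (H' θ hθ c hc).1, add_mem (H θ hθ c hc).2 (H' θ hθ c hc).2⟩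
  zero_mem' := fun θ hθ c hc => by
    rw [star_zero, zero_mul]
    exact ⟨zero_mem _, zero_mem _⟩
  smul_mem' := fun z h H θ hθ c hc => by
    rw [star_smul, smul_mul_assoc, smul_mul_assoc]
    exact ⟨Submodule.smul_mem _ _ (H θ hθ c hc).1, Submodule.smul_mem _ _ (H θ hθ c hc).2⟩
  mul_mem' := fun {h h'} H H' θ hθ c hc => by
    rw [star_mul, mul_assoc, mul_assoc]
    exact ⟨(H θ hθ _ ((R.mem_rketPreimage hΘ hθ).mp (H' θ hθ c hc).1).1).1,
      (H' θ hθ _ ((R.mem_rketPreimage hΘ hθ).mp (H θ hθ c hc).2).1).2⟩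
  star_mem' := fun {h} H θ hθ c hc => by
    rw [star_star]
    exact (H θ hθ c hc).symm

lemma isClosed_multiplierAlg (hΘ : IsAdmissible Θ) :
    IsClosed (R.multiplierAlg E hΘ : Set B) := by
  have h : (R.multiplierAlg E hΘ : Set B) =
      ⋂ (θ : PAut B) (hθ : θ ∈ Θ) (c : B) (_ : c ∈ homog B θ),
        ({h | h * c ∈ R.rketPreimage E hΘ hθ} ∩ {h | star h * c ∈ R.rketPreimage E hΘ hθ}) := by
    ext h
    simp only [Set.mem_iInter]
    rfl
  rw [h]
  refine isClosed_iInter fun θ => isClosed_iInter fun hθ => isClosed_iInter fun c =>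
    isClosed_iInter fun _ => IsClosed.inter ?_ ?_
  · exact (R.isClosed_rketPreimage hΘ hθ).preimage (continuous_id.mul continuous_const)
  · exact (R.isClosed_rketPreimage hΘ hθ).preimage (continuous_star.mul continuous_const)

/-- `F(|ξ])* F(|c ξ]) = F(|θ⟨ξ | ξ⟩ c])` for `ξ` homogeneous for `θ`. -/
lemma app_ip_self_mem_multiplierAlg (hΘ : IsAdmissible Θ) {θ : PAut B} (hθ : θ ∈ Θ) {ξ : E}
    (hξ : ξ ∈ homog E θ) : θ.app (ip B ξ ξ) ∈ R.multiplierAlg E hΘ := by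
  set h := θ.app (ip B ξ ξ) with hh
  have hd := homog.ip_mem_dom hξ ξ
  have hstar : star h = h := by rw [hh, ← PAut.app_star hd, star_ip]
  have key : ∀ (θ' : PAut B) (hθ' : θ' ∈ Θ), ∀ c ∈ homog B θ',
      h * c ∈ R.rketPreimage E hΘ hθ' := by
    intro θ' hθ' c hc
    have hhc : h * c ∈ homog B θ' := homog.lact_central hc (homog.app_ip_self_mul hξ hξ)
    obtain ⟨τ, hτ, hcomp⟩ := hΘ.inverseSemigroup.comp_mem θ' hθ' θ hθ
    have hcξ := homog.lact_mem hc hξ hcomp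
    refine (R.mem_rketPreimage hΘ hθ').mpr ⟨hhc, subset_clspan _ ⟨_,
      subset_clspan _ ⟨θ, hθ, ξ, hξ, rfl⟩, _, subset_clspan _ ⟨τ, hτ, _, hcξ, rfl⟩, ?_⟩⟩
    refine ext_tmul R.π fun b ζ => ?_
    rw [ContinuousLinearMap.comp_apply, R.mor_rket_tmul hΘ hθ' hhc, R.mor_rket_tmul hΘ hτ hcξ,
      R.adjoint_mor_rket_tmul hΘ hθ hξ, ← LeftAction.lact_mul, homog.app_ip_lact hξ, ← hh,
      ← R.υ_symm_comp hΘ hθ' hθ hτ hcomp, lact_self, ← mul_assoc, ← homog.app_ip_self_mul hξ hξ b,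
      ← hh, mul_assoc]
    -- After the central h has been moved to the front, the first tensor factor lies in Img(θ), and
    -- υ(θ)υ(θ*) cancels.
    refine (tmul_congr R.π fun d => R.π_υ_υ_symm hΘ.inverseSemigroup hθ ?_ _).symm
    exact θ.isClosedIdeal_img.mul_mem_left _ (θ.isClosedIdeal_img.mul_mem_right _
      (PAut.app_mem_img hd))
  exact fun θ' hθ' c hc => ⟨key θ' hθ' c hc, by rw [hstar]; exact key θ' hθ' c hc⟩

/-- For ξ of degree θ put h = θ⟨ξ|ξ⟩, an element of the multiplier algebra. Then θ⟨eξ - ξ|eξ - ξ⟩ =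
e(he - h) - (he - h) is small, and θ is isometric. -/
lemma tendsto_lact_of_isAU_multiplierAlg (hΘ : IsAdmissible Θ) (hE : IsDecomposable E Θ) {ι : Type*}
    {l : Filter ι} {e : ι → B} (he : IsAU (R.multiplierAlg E hΘ : Set B) l e) (ξ : E) :
    Tendsto (fun i => lact (e i) ξ) l (𝓝 ξ) := by
  refine tendsto_of_mem_clspan (T := fun i => lact (B := B) (E := E) (e i))
    (C := ‖lact (B := B) (E := E)‖) (fun i => ?_) ?_ (hE ▸ Submodule.mem_top (x := ξ))
  · exact (le_opNorm _ _).trans (mul_le_of_le_one_right (norm_nonneg _) (he.norm_le i))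
  rintro ξ ⟨θ, hθ, hξ⟩
  set h := θ.app (ip B ξ ξ) with hh
  have h1 : Tendsto (fun i => h * e i - h) l (𝓝 0) := by
    simpa using (he.mul_right h (R.app_ip_self_mem_multiplierAlg hΘ hθ hξ)).sub_const h
  refine tendsto_of_tendsto_ip_self (B := B) (squeeze_zero_norm
    (a := fun i => 2 * ‖h * e i - h‖) (fun i => ?_) (by simpa using h1.norm.const_mul 2))
  have e1 (ζ : E) : θ.app (ip B (lact (e i) ξ - ξ) ζ)
      = e i * θ.app (ip B ξ ζ) - θ.app (ip B ξ ζ) := by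
    have hm : ip B (lact (e i) ξ) ζ ∈ θ.dom := by
      rw [LeftAction.ip_lact]; exact homog.ip_mem_dom' hξ _
    rw [ip_sub_left, PAut.app_sub hm (homog.ip_mem_dom' hξ ζ), homog.app_ip_lact' hξ,
      he.star_eq]
  have hm : ip B ξ (lact (e i) ξ) ∈ θ.dom := homog.ip_mem_dom' hξ _
  have e2 : θ.app (ip B ξ (lact (e i) ξ - ξ)) = h * e i - h := by
    rw [ip_sub_right, PAut.app_sub hm (homog.ip_mem_dom hξ ξ), homog.app_ip_lact hξ]
  have hm' : ip B (lact (e i) ξ - ξ) (lact (e i) ξ - ξ) ∈ θ.dom := by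
    rw [ip_sub_left]
    refine θ.isClosedIdeal_dom.sub_mem ?_ (homog.ip_mem_dom' hξ _)
    rw [LeftAction.ip_lact]; exact homog.ip_mem_dom' hξ _
  rw [← PAut.norm_app hm', e1, e2]
  have h2 : ‖e i * (h * e i - h)‖ ≤ ‖h * e i - h‖ :=
    (norm_mul_le _ _).trans (mul_le_of_le_one_left (norm_nonneg _) (he.norm_le i))
  refine (norm_sub_le _ _).trans ?_
  linarith

/-- By construction every e_i c with e_i a multiplier gives an operator in [β*β]. It remains to see
e_i c → c, and here the equation [|E]*|E]] = |B] enters only through B, where degrees outside Θ do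
no harm. -/
lemma mor_rket_mem_clspan_adjoint_comp (hΘ : IsAdmissible Θ) (hE : IsDecomposable E Θ)
    (h : (rketFamily B E).adj.prod (rketFamily B E) = rketFamily B B) {θ : PAut B} (hθ : θ ∈ Θ)
    {c : B} (hc : c ∈ homog B θ) : R.mor θ.symm (rket B c) ∈
      clspan {x | ∃ ξ ∈ clspan (R.rketSet E), ∃ η ∈ clspan (R.rketSet E), x = adjoint ξ ∘L η} := by
  obtain ⟨l, hl⟩ := exists_isAU (R.multiplierAlg E hΘ) (R.isClosed_multiplierAlg hΘ)
  have := hl.neBot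
  have h1 : Tendsto (fun i => (i.1 : B) * c) l (𝓝 c) := by
    refine tendsto_of_mem_clspan (T := fun i => ContinuousLinearMap.mul ℂ B (i.1 : B)) (C := 1)
      (fun i => (opNorm_mul_apply_le ℂ B _).trans (hl.norm_le i)) ?_ (mem_clspan_app_ip h hc)
    -- The degree σ is arbitrary, but e_i σ⟨ξ|η⟩ = σ⟨e_i ξ|η⟩ and e_i ξ → ξ for every ξ in E.
    rintro _ ⟨σ, ξ, hξ, η, rfl⟩
    have hm (i) : ip B (lact (i : B) ξ) η ∈ σ.dom := by
      rw [LeftAction.ip_lact]; exact homog.ip_mem_dom' hξ _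
    refine (PAut.tendsto_app (fun i => hm _) (homog.ip_mem_dom' hξ η) (tendsto_ip_left (B := B) η
      (R.tendsto_lact_of_isAU_multiplierAlg hΘ hE hl ξ))).congr fun i => ?_
    rw [homog.app_ip_lact' hξ, hl.star_eq]
    rfl
  have h2 := (R.isClosed_rketPreimage hΘ hθ).mem_of_tendsto h1
    (Eventually.of_forall fun i => (i.1.2 θ hθ c hc).1)
  exact ((R.mem_rketPreimage hΘ hθ).mp h2).2

lemma isFactorization_rket (hΘ : IsAdmissible Θ) (hB : IsDecomposable B Θ)
    (hE : IsAdmissibleBimodule E Θ) :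
    (R.base hΘ hB).op.IsFactorization (clspan (R.rketSet E)) where
  isClosed := isClosed_clspan _
  adjoint_comp := by
    refine congrArg SetLike.coe (a₂ := clspan (R.rketSet B)) (le_antisymm
      (clspan_le (isClosed_clspan _) ?_) (clspan_le (isClosed_clspan _) ?_))
    · rintro _ ⟨ξ, hξ, η, hη, rfl⟩
      exact adjoint_comp_mem_of_mem_clspan (isClosed_clspan _)
        (fun x hx y hy => R.adjoint_mor_rket_comp_mem hΘ hE.rket_adj_rket hx hy) hξ hη
    · rintro _ ⟨θ, hθ, c, hc, rfl⟩
      exact R.mor_rket_mem_clspan_adjoint_comp hΘ hE.decomposable hE.rket_adj_rket hθ hc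
  comp_left := by
    refine clspan_comp_eq (isClosed_clspan _) (R.base hΘ hB).isClosed_right
      (fun x hx => adjoint_comp_mem_of_mem_clspan (isClosed_clspan _)
        (fun x hx y hy => R.adjoint_mor_rket_comp_mem hΘ hE.rket_adj_rket hx hy) hx hx)
      fun x hx a ha => comp_mem_of_mem_clspan (isClosed_clspan _) ?_ hx ha
    rintro _ ⟨θ', hθ', ξ, hξ, rfl⟩ _ ⟨θ, hθ, b, hb, rfl⟩
    obtain ⟨τ, hτ, h⟩ := hΘ.inverseSemigroup.comp_mem θ hθ θ' hθ'
    exact subset_clspan _ ⟨τ, hτ, _, homog.lact_mem hb hξ h,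
      R.mor_rket_comp_mor_rket hΘ hθ hθ' hτ h hb hξ⟩
  nondegenerate := R.clspan_rketSet_apply hΘ hE.decomposable hE.bimodule.nondegenerate

/-! ### The associated representations and compatibility -/

lemma rep_ket (hΘ : IsAdmissible Θ) (hB : IsDecomposable B Θ) (hE : IsRightBimodule B E)
    (hα : (R.base hΘ hB).IsFactorization (clspan (R.ketSet E hΘ))) {θ : PAut B} (hθ : θ ∈ Θ)
    {b : B} (hb : b ∈ homog B θ) (h : R.mor θ.symm (rket B b) ∈ (R.base hΘ hB).right) :
    hα.rep ⟨_, h⟩ = R.mor θ.symm (rightMul E b) := by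
  refine hα.ext_comp fun ξ hξ ζ => ?_
  rw [hα.rep_apply _ hξ]
  have h1 := comp_eq_comp_of_mem_clspan (R.mor θ.symm (rightMul E b))
    (R.mor θ.symm (rket B b)) (S := R.ketSet E hΘ) (by
      rintro _ ⟨η, rfl⟩
      exact R.mor_rightMul_comp_ketOp hΘ hE hθ hb η) hξ
  exact congrArg (fun f => f ζ) h1.symm

lemma rep_rket (hΘ : IsAdmissible Θ) (hB : IsDecomposable B Θ)
    (hβ : (R.base hΘ hB).op.IsFactorization (clspan (R.rketSet E))) (b : B)
    (h : R.mor (PAut.id B) (ket B b) ∈ (R.base hΘ hB).op.right) :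
    hβ.rep ⟨_, h⟩ = R.leftRep E hΘ b := by
  refine hβ.ext_comp fun ξ hξ ζ => ?_
  rw [hβ.rep_apply _ hξ]
  have h1 := comp_eq_comp_of_mem_clspan (R.leftRep E hΘ b)
    (R.leftRep B hΘ b) (S := R.rketSet E) (by
      rintro _ ⟨θ, hθ, η, hη, rfl⟩
      exact R.leftRep_comp_mor_rket hΘ hθ b hη) hξ
  exact congrArg (fun f => f ζ) h1.symm

lemma clspan_rep_ket_comp (hΘ : IsAdmissible Θ) (hB : IsDecomposable B Θ)
    (hE : IsRightBimodule B E)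
    (hα : (R.base hΘ hB).IsFactorization (clspan (R.ketSet E hΘ))) :
    clspan {x | ∃ b, ∃ η ∈ clspan (R.rketSet E), x = hα.rep b ∘L η} = clspan (R.rketSet E) := by
  have hmem {θ : PAut B} (hθ : θ ∈ Θ) {b : B} (hb : b ∈ homog B θ) :
      R.mor θ.symm (rket B b) ∈ (R.base hΘ hB).right := subset_clspan _ ⟨θ, hθ, b, hb, rfl⟩
  refine le_antisymm (clspan_le (isClosed_clspan _) ?_) (clspan_le (isClosed_clspan _) ?_)
  · rintro _ ⟨b, η, hη, rfl⟩
    refine hα.rep_comp_mem (fun b hb => hb) (isClosed_clspan _) η ?_ b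
    rintro _ ⟨θ', hθ', b, hb, rfl⟩
    refine ⟨hmem hθ' hb, ?_⟩
    rw [R.rep_ket hΘ hB hE hα hθ' hb]
    refine map_mem_of_mem_clspan
      (ContinuousLinearMap.compL ℂ _ _ _ (R.mor θ'.symm (rightMul E b))) (isClosed_clspan _) ?_ hη
    rintro _ ⟨θ, hθ, ξ, hξ, rfl⟩
    obtain ⟨τ, hτ, h⟩ := hΘ.inverseSemigroup.comp_mem θ hθ θ' hθ'
    exact subset_clspan _ ⟨τ, hτ, _, homog.rsmul_mem hξ hb h,
      R.mor_rightMul_comp_mor_rket hΘ hE hθ hθ' hτ h hξ hb⟩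
  · rintro _ ⟨θ, hθ, ξ, hξ, rfl⟩
    -- Central z are homogeneous for id ∈ Θ, so F(r_z) lies in ρ_α(𝔅†), and F(r_z)F(|ξ]) = F(|ξz]).
    -- An approximate unit of the centre fixes ξ in the limit because ⟨ξ|ξ⟩ is central.
    let Z : NonUnitalStarSubalgebra ℂ B := NonUnitalStarSubalgebra.center ℂ B
    have hZ {z : B} : z ∈ Z ↔ ∀ b, z * b = b * z := by
      rw [NonUnitalStarSubalgebra.mem_center_iff]
      exact forall_congr' fun b => eq_comm
    have hZc : IsClosed (Z : Set B) := by
      have h : (Z : Set B) = ⋂ b : B, {z | z * b = b * z} := by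
        ext z; simpa using hZ
      rw [h]
      exact isClosed_iInter fun b => isClosed_eq (continuous_id.mul continuous_const)
        (continuous_const.mul continuous_id)
    obtain ⟨l, hl⟩ := exists_isAU Z hZc
    have := hl.neBot
    have hcomp : PAut.IsComp θ (PAut.id B) θ := (PEquiv.refl_trans _).symm
    have hid (i : {x : Z // ‖x‖ ≤ 1 ∧ IsSelfAdjoint x}) : (i.1 : B) ∈ homog B (PAut.id B) :=
      homog_id_of_central (hZ.mp i.1.2)
    have hmemξ (i : {x : Z // ‖x‖ ≤ 1 ∧ IsSelfAdjoint x}) : ξ <• (i.1 : B) ∈ homog E θ :=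
      homog.rsmul_mem hξ (hid i) hcomp
    have h1 : Tendsto (fun i => ξ <• (i.1 : B)) l (𝓝 ξ) :=
      hl.tendsto_rsmul_of_ip_self (hZ.mpr (homog.ip_self_mul hξ hξ))
    -- F(|ξ]) is continuous in ξ only within a fixed degree; the elements ξz all keep degree θ.
    have h2 : Tendsto (fun i => (⟨_, hmemξ i⟩ : homogSub E θ)) l (𝓝 ⟨ξ, hξ⟩) :=
      tendsto_subtype_rng.mpr h1
    have h3 := ((R.rketOp E θ hΘ hθ).continuous.tendsto _).comp h2
    refine (isClosed_clspan _).mem_of_tendsto h3 (Eventually.of_forall fun i => ?_)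
    refine subset_clspan _ ⟨⟨_, hmem hΘ.id_mem (hid i)⟩, _,
      subset_clspan _ ⟨θ, hθ, ξ, hξ, rfl⟩, ?_⟩
    rw [R.rep_ket hΘ hB hE hα hΘ.id_mem (hid i),
      R.mor_rightMul_comp_mor_rket hΘ hE hθ hΘ.id_mem hθ hcomp hξ (hid i)]
    rfl

lemma clspan_rep_rket_comp (hΘ : IsAdmissible Θ) (hB : IsDecomposable B Θ)
    (hE : IsRightBimodule B E)
    (hβ : (R.base hΘ hB).op.IsFactorization (clspan (R.rketSet E))) :
    clspan {x | ∃ c, ∃ ξ ∈ clspan (R.ketSet E hΘ), x = hβ.rep c ∘L ξ}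
      = clspan (R.ketSet E hΘ) := by
  have hmem (b : B) : R.mor (PAut.id B) (ket B b) ∈ (R.base hΘ hB).op.right :=
    subset_clspan _ ⟨b, rfl⟩
  refine le_antisymm (clspan_le (isClosed_clspan _) ?_) (clspan_le (isClosed_clspan _) ?_)
  · rintro _ ⟨b, η, hη, rfl⟩
    refine hβ.rep_comp_mem (S := R.ketSet B hΘ) (fun b hb => hb) (isClosed_clspan _) η ?_ b
    rintro _ ⟨b, rfl⟩
    refine ⟨hmem b, ?_⟩
    have h1 : hβ.rep ⟨R.ketOp B hΘ b, hmem b⟩ = R.leftRep E hΘ b := R.rep_rket hΘ hB hβ b (hmem b)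
    rw [h1]
    refine map_mem_of_mem_clspan
      (ContinuousLinearMap.compL ℂ _ _ _ (R.leftRep E hΘ b)) (isClosed_clspan _) ?_ hη
    rintro _ ⟨ξ, rfl⟩
    exact subset_clspan _ ⟨_, (R.leftRep_comp_ketOp hΘ b ξ).symm⟩
  · rintro _ ⟨ξ, rfl⟩
    -- By nondegeneracy of the left action it suffices to treat ξ = bη, where F(|bη⟩) =
    -- F(l_b)F(|η⟩).
    refine map_mem_of_mem_clspan (W := R.obj B →L[ℂ] R.obj E) (R.ketOp E hΘ) (isClosed_clspan _)
      ?_ (hE.nondegenerate ▸ Submodule.mem_top (x := ξ))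
    rintro _ ⟨b, η, rfl⟩
    refine subset_clspan _ ⟨⟨_, hmem b⟩, _, subset_clspan _ ⟨η, rfl⟩, ?_⟩
    rw [R.rep_rket hΘ hB hβ b, R.leftRep_comp_ketOp]

end CovariantRep

end HomMod

end

/-! ### The main theorem -/

theorem mainTheorem12 {B : Type*} [NonUnitalCStarAlgebra B] [PartialOrder B]
    [StarOrderedRing B] (hB : IsDecomposable B (Set.univ : Set (PAut B)))
    (Θ : Set (PAut B)) (hΘ : IsAdmissible Θ)
    {K : Type*} [NormedAddCommGroup K] [InnerProductSpace ℂ K] [CompleteSpace K]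
    (R : CovariantRep Θ K) (hπ : Function.Injective R.π) :
    ∃ 𝒞 : CStarBase (R.obj B),
      (𝒞.left : Set (R.obj B →L[ℂ] R.obj B)) = R.morSpan (ketFamily B B) ∧
      (𝒞.right : Set (R.obj B →L[ℂ] R.obj B)) = R.morSpan (rketFamily B B) ∧
      (∀ θ ∈ Θ, ∀ b ∈ homog B θ,
        IsHomogeneous θ (PAut.id B) (ket B b) ∧ IsHomogeneous (PAut.id B) θ.symm (rket B b)) ∧
      ∀ (E : Type*) [NormedAddCommGroup E] [NormedSpace ℂ E] [SMul Bᵐᵒᵖ E]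
        [CStarModule Bᵐᵒᵖ E] [LeftAction B E], IsAdmissibleBimodule E Θ →
        (∀ θ ∈ Θ, ∀ ξ ∈ homog E θ,
          IsHomogeneous θ (PAut.id B) (ket B ξ) ∧ IsHomogeneous (PAut.id B) θ.symm (rket B ξ)) ∧
        (∀ θ ∈ Θ, ∀ b ∈ homog B θ,
          IsHomogeneous θ (PAut.id B) (leftMul E b) ∧
          IsHomogeneous (PAut.id B) θ.symm (rightMul E b)) ∧
        ∃ (hβ : 𝒞.op.IsFactorization (R.morSpan (rketFamily B E)))
          (hα : 𝒞.IsFactorization (R.morSpan (ketFamily B E))),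
          hα.Compatible hβ ∧
          ∀ θ ∈ Θ, ∀ b ∈ homog B θ,
            (∃ h : R.mor (PAut.id B) (ket B b) ∈ 𝒞.op.right,
              hβ.rep ⟨_, h⟩ = R.mor (PAut.id B) (leftMul E b)) ∧
            (∃ h : R.mor θ.symm (rket B b) ∈ 𝒞.right,
              hα.rep ⟨_, h⟩ = R.mor θ.symm (rightMul E b)) := by
  have hB' := isDecomposable_of_supported hB hΘ.supported
  refine ⟨R.base hΘ hB', ?_, ?_, fun θ hθ b hb => ⟨isHomogeneous_ket hb, isHomogeneous_rket hb⟩, ?_⟩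
  · rw [R.morSpan_ketFamily hΘ hB']; rfl
  · rw [R.morSpan_rketFamily hΘ]; rfl
  intro E _ _ _ _ _ hE
  rw [R.morSpan_ketFamily hΘ hE.decomposable, R.morSpan_rketFamily hΘ]
  have hα := R.isFactorization_ket hΘ hB' hE.bimodule
  have hβ := R.isFactorization_rket hΘ hB' hE
  refine ⟨fun θ hθ ξ hξ => ⟨isHomogeneous_ket hξ, isHomogeneous_rket hξ⟩,
    fun θ hθ b hb => ⟨isHomogeneous_leftMul hb, isHomogeneous_rightMul hE.bimodule hb⟩,
    hβ, hα, ⟨R.clspan_rep_ket_comp hΘ hB' hE.bimodule hα,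
      R.clspan_rep_rket_comp hΘ hB' hE.bimodule hβ⟩, fun θ hθ b hb => ⟨?_, ?_⟩⟩
  · have h : R.mor (PAut.id B) (ket B b) ∈ (R.base hΘ hB').op.right := subset_clspan _ ⟨b, rfl⟩
    exact ⟨h, R.rep_rket hΘ hB' hβ b h⟩
  · have h : R.mor θ.symm (rket B b) ∈ (R.base hΘ hB').right :=
      subset_clspan _ ⟨θ, hθ, b, hb, rfl⟩
    exact ⟨h, R.rep_ket hΘ hB' hE.bimodule hα hθ hb h⟩
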